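/- **Theorem 3.4.** A *pattern* with period $\mathcal L\subseteq\mathbb Z^n$ (a full-rank lattice) is a union of finitely many integer cosets of $\mathcal L$. A *presentation* in dimension $n$ is a finite list $D=(Q_1,\mathcal L_1),\dots,(Q_k,\mathcal L_k)$ of pairwise disjoint rational polyhedra $Q_i\subseteq\mathbb R^n$, each given by a system $A_i x\le b_i$ with integer $A_i,b_i$, and full-rank lattices $\mathcal L_i\subseteq\mathbb Z^n$, each given by an integer basis. It *presents* $X\subseteq\mathbb Z^n$ if $$X=\bigsqcup_{i=1}^k Q_i\cap \mathbf L_i\quad\text{for some patterns }\mathbf L_i\text{ with period }\mathcal L_i ;$$ such sets $X$ are called semilinear. Let $\psi(D)$ be the total binary length of all $A_i,b_i$ and lattice bases, let $\eta(Q)$ be the number of facets of a polyhedron $Q$, put $\eta(D)=\sum_i\eta(Q_i)$, and let $\kappa(D)$ be the number of indices $i$ for which $Q_i$ is nonempty and not full-dimensional. There is an absolute constant $C$ such that for all fixed $m,n\in\mathbb N$ there is a polynomial-time algorithm which, given a presentation $D$ in dimension $m$ and a matrix $T\in\mathbb Z^{n\times m}$, computes in time polynomial in $\psi(D)+\phi(T)$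 (where $\phi(T)$ is the binary length of $T$) a presentation $E=(R_1,\mathcal T_1),\dots,(R_r,\mathcal T_r)$ in dimension $n$ (pairwise disjoint polyhedra, full-rank lattices) such that for every set $X\subseteq\mathbb Z^m$ presented by $D$, the image $T(X)\subseteq\mathbb Z^n$ is presented by $E$: $$T(X)=\bigsqcup_{j=1}^r R_j\cap\mathbf T_j\quad\text{for some patterns }\mathbf T_j\text{ with period }\mathcal T_j .$$ Moreover $$r\le N^{C\,m!}\quad\text{and}\quad \eta(R_j)\le N^{C\,m!}\ (1\le j\le r),\qquad N=\max\{2,\ \eta(D)+\kappa(D)\}.$$ In particular, if all the $Q_i$ are full-dimensional, then $r$ and all $\eta(R_j)$ are at most $\max\{2,\eta(D)\}^{C\,m!}$. -/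

import Mathlib

namespace SemilinearProj

/-! ### Rational polyhedra, lattices, patterns -/

/-- A finite system of linear inequalities `a ⬝ x ≤ b` in `n` unknowns with integer coefficients,
i.e. a system `A x ≤ b` with `A`, `b` integral (listed row by row). -/
abbrev IneqSystem (n : ℕ) : Type := List ((Fin n → ℤ) × ℤ)

/-- The rational polyhedron in `ℝⁿ` that the system describes. -/
def IneqSystem.region {n : ℕ} (S : IneqSystem n) : Set (Fin n → ℝ) :=
  {x | ∀ row ∈ S, (∑ i, (row.1 i : ℝ) * x i) ≤ (row.2 : ℝ)}

/-- The dimension of (the affine hull of) a nonempty set. -/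
noncomputable def affDim {n : ℕ} (P : Set (Fin n → ℝ)) : ℕ :=
  Module.finrank ℝ (vectorSpan ℝ P)

/-- A facet of `P`: a nonempty face `{x ∈ P | l x = max of l on P}` of dimension `dim P - 1`. -/
def IsFacet {n : ℕ} (P F : Set (Fin n → ℝ)) : Prop :=
  F.Nonempty ∧ IsExposed ℝ P F ∧ affDim F + 1 = affDim P

/-- The number of facets (finite for every polyhedron). -/
noncomputable def facetCount {n : ℕ} (P : Set (Fin n → ℝ)) : ℕ :=
  {F | IsFacet P F}.ncard

/-- The lattice generated by the columns of an integer matrix; it has full rank iff the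
determinant is nonzero. -/
def latticeOf {n : ℕ} (B : Matrix (Fin n) (Fin n) ℤ) : AddSubgroup (Fin n → ℤ) :=
  AddSubgroup.closure (Set.range fun j => fun i => B i j)

/-- `P` is a pattern with period `L`: a union of finitely many integer cosets of `L`. -/
def IsPattern {n : ℕ} (L : AddSubgroup (Fin n → ℤ)) (P : Set (Fin n → ℤ)) : Prop :=
  ∃ S : Finset (Fin n → ℤ), P = {x | ∃ s ∈ S, x - s ∈ L}

/-! ### Presentations of semilinear sets -/

/-- The data of a patterned polyhedron apart from the choice of the cosets: a rational
polyhedron and a basis (the columns of `period`) of the period lattice. -/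
structure Piece (n : ℕ) where
  ineqs : IneqSystem n
  period : Matrix (Fin n) (Fin n) ℤ

/-- A finite list of polyhedra with period lattices. -/
abbrev Presentation (n : ℕ) : Type := List (Piece n)

/-- The periods are of full rank and the polyhedra are pairwise disjoint (as subsets of `ℝⁿ`). -/
def Presentation.Valid {n : ℕ} (D : Presentation n) : Prop :=
  (∀ q ∈ D, q.period.det ≠ 0) ∧
    D.Pairwise fun q q' => Disjoint q.ineqs.region q'.ineqs.region

/-- `X` is the union of the sets `Qᵢ ∩ Lᵢ` for some patterns `Lᵢ` with the periods listed
in `D`. The union is disjoint as soon as `D` is valid. -/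
def Presentation.Presents {n : ℕ} (D : Presentation n) (X : Set (Fin n → ℤ)) : Prop :=
  ∃ pat : Fin D.length → Set (Fin n → ℤ),
    (∀ i, IsPattern (latticeOf (D.get i).period) (pat i)) ∧
    X = ⋃ i, {x | (fun t => (x t : ℝ)) ∈ (D.get i).ineqs.region ∧ x ∈ pat i}

/-- Total number of facets of the polyhedra. -/
noncomputable def Presentation.eta {n : ℕ} (D : Presentation n) : ℕ :=
  (D.map fun q => facetCount q.ineqs.region).sum

/-- Number of nonempty polyhedra in the list that are not full-dimensional. -/
noncomputable def Presentation.kappa {n : ℕ} (D : Presentation n) : ℕ :=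
  {i : Fin D.length | (D.get i).ineqs.region.Nonempty ∧
    affineSpan ℝ (D.get i).ineqs.region ≠ ⊤}.ncard

/-! ### Binary lengths -/

/-- Binary length of an integer, with one bit for the sign. -/
def intLen (z : ℤ) : ℕ := Nat.size z.natAbs + 1

def matLen {m n : ℕ} (A : Matrix (Fin m) (Fin n) ℤ) : ℕ := ∑ i, ∑ j, intLen (A i j)

def IneqSystem.len {n : ℕ} (S : IneqSystem n) : ℕ :=
  (S.map fun row => (∑ i, intLen (row.1 i)) + intLen row.2).sum

/-- The period length: the total binary length of the polyhedra and of the period lattices. -/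
def Presentation.psi {n : ℕ} (D : Presentation n) : ℕ :=
  (D.map fun q => q.ineqs.len + matLen q.period).sum

/-! ### A machine model with bit cost

Programs work on trees with integer leaves. The integers are held in binary; every elementary step
is charged the total binary length of what it reads and writes (logarithmic cost), so running times
agree with those of multitape Turing machines up to a polynomial. -/

inductive Data : Type
  | num (z : ℤ) : Data
  | pair (a b : Data) : Data

/-- Binary length of a tree. -/
def Data.size : Data → ℕ
  | .num z => intLen z
  | .pair a b => a.size + b.size + 1

/-- Elementary operations. -/
inductive Op : Type
  | zero | one | copy | fst | snd | isPair | add | sub | mul | div | le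

/-- Meaning of the elementary operations; on arguments of the wrong shape the result is `0`. -/
def Op.eval : Op → Data → Data
  | .zero, _ => .num 0
  | .one, _ => .num 1
  | .copy, x => x
  | .fst, .pair a _ => a
  | .snd, .pair _ b => b
  | .isPair, .pair _ _ => .num 1
  | .add, .pair (.num a) (.num b) => .num (a + b)
  | .sub, .pair (.num a) (.num b) => .num (a - b)
  | .mul, .pair (.num a) (.num b) => .num (a * b)
  | .div, .pair (.num a) (.num b) => .num (a / b)
  | .le, .pair (.num a) (.num b) => .num (if a ≤ b then 1 else 0)
  | _, _ => .num 0

/-- Programs: an elementary operation; `p` followed by `q`; the pair of the results of `p` and `q`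
on the same argument; branching on whether the result of `c` is `0`; and repeating `p` while the
result of `c` is not `0`. -/
inductive Prog : Type
  | op (o : Op) : Prog
  | seq (p q : Prog) : Prog
  | both (p q : Prog) : Prog
  | ite (c p q : Prog) : Prog
  | loop (c p : Prog) : Prog

/-- `Runs p x y t`: on the argument `x` the program `p` halts with the result `y` at cost `t`. -/
inductive Runs : Prog → Data → Data → ℕ → Prop
  | op (o : Op) (x : Data) : Runs (.op o) x (o.eval x) (x.size + (o.eval x).size)
  | seq {p q : Prog} {x y z : Data} {s t : ℕ} :
      Runs p x y s → Runs q y z t → Runs (.seq p q) x z (s + t + 1)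
  | both {p q : Prog} {x y z : Data} {s t : ℕ} :
      Runs p x y s → Runs q x z t →
      Runs (.both p q) x (.pair y z) (s + t + x.size + (Data.pair y z).size)
  | ite_true {c p q : Prog} {x b y : Data} {s t : ℕ} :
      Runs c x b s → b ≠ .num 0 → Runs p x y t → Runs (.ite c p q) x y (s + t + x.size)
  | ite_false {c p q : Prog} {x y : Data} {s t : ℕ} :
      Runs c x (.num 0) s → Runs q x y t → Runs (.ite c p q) x y (s + t + x.size)
  | loop_stop {c p : Prog} {x : Data} {s : ℕ} :
      Runs c x (.num 0) s → Runs (.loop c p) x x (s + x.size)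
  | loop_step {c p : Prog} {x b y z : Data} {s t u : ℕ} :
      Runs c x b s → b ≠ .num 0 → Runs p x y t → Runs (.loop c p) y z u →
      Runs (.loop c p) x z (s + t + u + x.size)

/-! ### Inputs and outputs as trees -/

/-- A list, as nested pairs that end in the leaf `0`. -/
def encList {α : Type} (f : α → Data) : List α → Data
  | [] => .num 0
  | a :: l => .pair (f a) (encList f l)

def encVec {n : ℕ} (v : Fin n → ℤ) : Data := encList Data.num (List.ofFn v)

/-- A matrix, as the list of its rows. -/
def encMat {m n : ℕ} (A : Matrix (Fin m) (Fin n) ℤ) : Data := encList encVec (List.ofFn A)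

def encSystem {n : ℕ} (S : IneqSystem n) : Data :=
  encList (fun row => .pair (encVec row.1) (.num row.2)) S

def encPresentation {n : ℕ} (D : Presentation n) : Data :=
  encList (fun q => .pair (encSystem q.ineqs) (encMat q.period)) D

end SemilinearProj

namespace SemilinearProj

/-! ### Polynomial-time computable functions -/

/-! Instead of polyhedra and cosets, the proof follows a coarser property that survives projection.
An arrangement consists of linear equations, a list of normals, a thickness `M` and a period `K`. A
set is `Tame` for it if it satisfies the equations and if membership of a solution `x` depends only
on `x` mod `K` and, for each normal `a`, on `a ⬝ x` truncated at `M`: the exact value inside `[-M,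
M]`, only the side outside. A presented set is tame (`Presentation.Presents.tame`), with `M` at
least all right hand sides and `K` a multiple of all lattice determinants, and so is the graph of
`T` over it, with the equations `T x = y`.

The image is the projection of the graph along `m` coordinates, eliminated one at a time. If an
equation involves the coordinate, it is solved for it, and the number of normals stays the same
(`Tame.substStep`). Otherwise the normals that involve the coordinate are combined in pairs, as in
Fourier–Motzkin elimination (`Tame.pairStep`). A point of a fibre can be shifted by multiples of `K`
until it is near some hyperplane (`Tame.exists_near`); near it, the remaining conditions involve
only the combined normals. One step at most squares the number of normals, so `m` steps raise it at
most to the power `2 ^ m`.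

The solution space of the final equations is then cut along slabs around the hyperplanes. On each
cell a tame set is a pattern with period `K (2M + 1)`, because two values in `[-M, M]` congruent
modulo `2M + 1` are equal (`Tame.presents`). The arrangement is computed from `D` and `T` alone, so
one presentation serves all `X`.

For the bounds, `k` slabs cut an affine space of dimension `e` into at most `(2k + 1) ^ e` cells
(`meetCount_cells_le`), and here `e ≤ m` because the final equations force a point into the range of
`T`. The initial number of normals is at most `η + m κ`: in an irredundant description the proper
inequalities correspond to facets, while the implicit equations are linearly independent and occur
only if the polyhedron is not full-dimensional (`IneqSystem.length_trimmed_le`).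

The construction is a composition of functions with property `PT`. The dimensions are fixed, so
recursion on them only lengthens the program; loops run over lists, and every intermediate state is
bounded by a polynomial. -/

theorem Runs.size_le {p : Prog} {x y : Data} {t : ℕ} (h : Runs p x y t) : y.size ≤ t := by
  induction h <;> omega

theorem Runs.loop_halt {c p : Prog} {x : Data} {s : ℕ} (h : Runs c x (.num 0) s) :
    Runs (.loop c p) x x (s + x.size) := by
  constructor
  exact h

theorem eval_mono (q : Polynomial ℕ) {a b : ℕ} (h : a ≤ b) : q.eval a ≤ q.eval b := by
  induction q using Polynomial.induction_on' with
  | add p q hp hq => simpa using add_le_add hp hq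
  | monomial n c => simpa using Nat.mul_le_mul_left c (Nat.pow_le_pow_left h n)

/-- `y` is computed from `x` in polynomial time, uniformly in the index. -/
def DataPT {ι : Type} (x y : ι → Data) : Prop :=
  ∃ (p : Prog) (q : Polynomial ℕ), ∀ i, ∃ t, Runs p (x i) (y i) t ∧ t ≤ q.eval (x i).size

namespace DataPT

variable {ι : Type} {x y z w : ι → Data}

theorem size_le (h : DataPT x y) : ∃ q : Polynomial ℕ, ∀ i, (y i).size ≤ q.eval (x i).size := by
  obtain ⟨p, q, h⟩ := h
  refine ⟨q, fun i => ?_⟩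
  obtain ⟨t, ht, hq⟩ := h i
  exact ht.size_le.trans hq

theorem trans (h : DataPT x y) (h' : DataPT y z) : DataPT x z := by
  obtain ⟨p, q, h⟩ := h
  obtain ⟨p', q', h'⟩ := h'
  refine ⟨.seq p p', q + q'.comp q + 1, fun i => ?_⟩
  obtain ⟨t, ht, hq⟩ := h i
  obtain ⟨t', ht', hq'⟩ := h' i
  refine ⟨_, .seq ht ht', ?_⟩
  have := eval_mono q' (ht.size_le.trans hq)
  simp only [Polynomial.eval_add, Polynomial.eval_comp, Polynomial.eval_one]
  omega

theorem comp_index {κ : Type} (h : DataPT x y) (g : κ → ι) :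
    DataPT (fun k => x (g k)) (fun k => y (g k)) := by
  obtain ⟨p, q, h⟩ := h
  exact ⟨p, q, fun k => h (g k)⟩

theorem pair (h : DataPT x y) (h' : DataPT x z) : DataPT x (fun i => .pair (y i) (z i)) := by
  obtain ⟨p, q, h⟩ := h
  obtain ⟨p', q', h'⟩ := h'
  refine ⟨.both p p', q + q' + Polynomial.X + (q + q' + 1), fun i => ?_⟩
  obtain ⟨t, ht, hq⟩ := h i
  obtain ⟨t', ht', hq'⟩ := h' i
  refine ⟨_, .both ht ht', ?_⟩
  have h1 := ht.size_le
  have h2 := ht'.size_le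
  simp only [Polynomial.eval_add, Polynomial.eval_X, Polynomial.eval_one, Data.size]
  omega

theorem op (o : Op) (q : Polynomial ℕ) (h : ∀ i, (o.eval (x i)).size ≤ q.eval (x i).size) :
    DataPT x (fun i => o.eval (x i)) :=
  ⟨.op o, Polynomial.X + q, fun i => ⟨_, .op o _, by simpa using h i⟩⟩

theorem ite {P : ι → Prop} [DecidablePred P] (h : DataPT x y) (hP : ∀ i, y i = .num 0 ↔ ¬ P i)
    (hz : DataPT x z) (hw : DataPT x w) : DataPT x (fun i => if P i then z i else w i) := by
  obtain ⟨p, q, h⟩ := h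
  obtain ⟨p₁, q₁, h₁⟩ := hz
  obtain ⟨p₂, q₂, h₂⟩ := hw
  refine ⟨.ite p p₁ p₂, q + (q₁ + q₂) + Polynomial.X, fun i => ?_⟩
  obtain ⟨t, ht, hq⟩ := h i
  simp only [Polynomial.eval_add, Polynomial.eval_X]
  by_cases hi : P i
  · obtain ⟨t', ht', hq'⟩ := h₁ i
    refine ⟨_, .ite_true ht (fun h0 => (hP i).1 h0 hi) (by simpa [hi] using ht'), ?_⟩
    omega
  · obtain ⟨t', ht', hq'⟩ := h₂ i
    rw [(hP i).2 hi] at ht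
    refine ⟨_, .ite_false ht (by simpa [hi] using ht'), ?_⟩
    omega

end DataPT

/-! ### Binary lengths under the elementary operations -/

theorem intLen_pos (z : ℤ) : 1 ≤ intLen z := by unfold intLen; omega

theorem intLen_le {z : ℤ} {k : ℕ} (h : z.natAbs < 2 ^ k) : intLen z ≤ k + 1 := by
  unfold intLen
  have := Nat.size_le.2 h
  omega

theorem natAbs_lt_intLen (z : ℤ) : z.natAbs < 2 ^ (intLen z - 1) := Nat.lt_size_self _

theorem intLen_mul_le (a b : ℤ) : intLen (a * b) ≤ intLen a + intLen b := by
  have h : (a * b).natAbs < 2 ^ (intLen a - 1 + (intLen b - 1)) := by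
    rw [Int.natAbs_mul, pow_add]
    exact Nat.mul_lt_mul'' (natAbs_lt_intLen a) (natAbs_lt_intLen b)
  have := intLen_le h
  have := intLen_pos a
  have := intLen_pos b
  omega

theorem intLen_le_add {a b c : ℤ} (h : c.natAbs ≤ a.natAbs + b.natAbs) :
    intLen c ≤ intLen a + intLen b := by
  have ha := natAbs_lt_intLen a
  have hb := natAbs_lt_intLen b
  have h1 : c.natAbs < 2 ^ (intLen a - 1 + (intLen b - 1) + 1) := by
    have e1 : 2 ^ (intLen a - 1) ≤ 2 ^ (intLen a - 1 + (intLen b - 1)) :=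
      Nat.pow_le_pow_right (by norm_num) (by omega)
    have e2 : 2 ^ (intLen b - 1) ≤ 2 ^ (intLen a - 1 + (intLen b - 1)) :=
      Nat.pow_le_pow_right (by norm_num) (by omega)
    rw [pow_succ]
    omega
  have := intLen_le h1
  have := intLen_pos a
  have := intLen_pos b
  omega

theorem Data.size_pos (d : Data) : 1 ≤ d.size := by
  cases d with
  | num z => exact intLen_pos z
  | pair a b => simp [Data.size]

/-- Sums and products need at most the bits of both arguments together. Division is left out because
the algorithm never divides. -/
theorem Op.size_eval_le (o : Op) (ho : o ≠ .div) (d : Data) : (o.eval d).size ≤ d.size + 2 := by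
  have h0 : intLen 0 = 1 := by simp [intLen]
  have h1 : intLen 1 = 2 := by simp [intLen]
  have hd := d.size_pos
  unfold Op.eval
  split <;> (try simp only [Data.size] at hd) <;> (try simp only [Data.size]) <;>
    try omega
  · rename_i a b
    have := intLen_le_add (Int.natAbs_add_le a b)
    omega
  · rename_i a b
    have := intLen_le_add (Int.natAbs_sub_le a b)
    omega
  · rename_i a b
    have := intLen_mul_le a b
    omega
  · exact absurd rfl ho
  · split <;> omega

theorem DataPT.op' {ι : Type} {x : ι → Data} (o : Op) (ho : o ≠ .div) :
    DataPT x (fun i => o.eval (x i)) :=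
  .op o (Polynomial.X + 2) fun i => by simpa using o.size_eval_le ho _

theorem DataPT.refl {ι : Type} (x : ι → Data) : DataPT x x := .op' .copy (by simp)

theorem DataPT.fst {ι : Type} {x y : ι → Data} : DataPT (fun i => .pair (x i) (y i)) x :=
  .op' (x := fun i => .pair (x i) (y i)) .fst (by simp)

theorem DataPT.snd {ι : Type} {x y : ι → Data} : DataPT (fun i => .pair (x i) (y i)) y :=
  .op' (x := fun i => .pair (x i) (y i)) .snd (by simp)

/-- The program may depend on `d`, so counting up or down to an integer leaf costs only a constant
number of operations. -/
theorem DataPT.const {ι : Type} (x : ι → Data) (d : Data) : DataPT x (fun _ => d) := by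
  induction d with
  | num z =>
    have h1 : DataPT x (fun _ => .num 1) := .op' .one (by simp)
    induction z using Int.induction_on with
    | zero => exact .op' .zero (by simp)
    | succ k ih => exact (ih.pair h1).trans (.op' .add (by simp))
    | pred k ih => exact (ih.pair h1).trans (.op' .sub (by simp))
  | pair a b ha hb => exact ha.pair hb

/-- Types whose elements are given to programs as trees. -/
class Enc (α : Type) where
  enc : α → Data

open Enc (enc)

section Computable

variable {α β γ σ : Type} [Enc α] [Enc β] [Enc γ] [Enc σ] {n : ℕ}

instance : Enc ℤ := ⟨.num⟩
instance : Enc ℕ := ⟨fun k => .num k⟩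
instance : Enc Bool := ⟨fun b => .num (if b then 1 else 0)⟩
instance : Enc (α × β) := ⟨fun p => .pair (enc p.1) (enc p.2)⟩
instance : Enc (List α) := ⟨encList enc⟩
instance : Enc (Fin n → α) := ⟨fun v => encList enc (List.ofFn v)⟩

/-- Size of an element as an input of a program. -/
def esize (a : α) : ℕ := (enc a).size

/-- Functions computed by a program in polynomial time. -/
@[fun_prop]
def PT (f : α → β) : Prop := DataPT enc fun a => enc (f a)

theorem PT.esize_le {f : α → β} (hf : PT f) :
    ∃ q : Polynomial ℕ, ∀ a, esize (f a) ≤ q.eval (esize a) := DataPT.size_le hf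

@[fun_prop]
theorem PT.id : PT fun a : α => a := DataPT.refl _

@[fun_prop]
theorem PT.const (b : β) : PT fun _ : α => b := DataPT.const _ _

@[fun_prop]
theorem PT.comp {g : β → γ} {f : α → β} (hg : PT g) (hf : PT f) : PT fun a => g (f a) :=
  DataPT.trans hf (DataPT.comp_index hg f)

@[fun_prop]
theorem PT.prodMk {f : α → β} {g : α → γ} (hf : PT f) (hg : PT g) : PT fun a => (f a, g a) :=
  DataPT.pair hf hg

@[fun_prop]
theorem PT.fst {f : α → β × γ} (hf : PT f) : PT fun a => (f a).1 := DataPT.trans hf DataPT.fst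

@[fun_prop]
theorem PT.snd {f : α → β × γ} (hf : PT f) : PT fun a => (f a).2 := DataPT.trans hf DataPT.snd

@[fun_prop]
theorem PT.intAdd {f g : α → ℤ} (hf : PT f) (hg : PT g) : PT fun a => f a + g a :=
  (DataPT.pair hf hg).trans (.op' .add (by simp))

@[fun_prop]
theorem PT.intSub {f g : α → ℤ} (hf : PT f) (hg : PT g) : PT fun a => f a - g a :=
  (DataPT.pair hf hg).trans (.op' .sub (by simp))

@[fun_prop]
theorem PT.intMul {f g : α → ℤ} (hf : PT f) (hg : PT g) : PT fun a => f a * g a :=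
  (DataPT.pair hf hg).trans (.op' .mul (by simp))

@[fun_prop]
theorem PT.intNeg {f : α → ℤ} (hf : PT f) : PT fun a => -f a := by
  simpa using (PT.const (α := α) (0 : ℤ)).intSub hf

@[fun_prop]
theorem PT.natCast {f : α → ℕ} (hf : PT f) : PT fun a => (f a : ℤ) := hf

theorem PT.of_natCast {f : α → ℕ} (hf : PT fun a => (f a : ℤ)) : PT f := hf

@[fun_prop]
theorem PT.natAdd {f g : α → ℕ} (hf : PT f) (hg : PT g) : PT fun a => f a + g a :=
  PT.of_natCast (by push_cast; fun_prop)

@[fun_prop]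
theorem PT.natMul {f g : α → ℕ} (hf : PT f) (hg : PT g) : PT fun a => f a * g a :=
  PT.of_natCast (by push_cast; fun_prop)

@[fun_prop]
theorem PT.natPow {f : α → ℕ} (hf : PT f) (k : ℕ) : PT fun a => f a ^ k := by
  induction k with
  | zero => simpa using PT.const 1
  | succ k ih => simp only [pow_succ]; fun_prop

@[fun_prop]
theorem PT.decide_le {f g : α → ℤ} (hf : PT f) (hg : PT g) : PT fun a => decide (f a ≤ g a) := by
  refine ((DataPT.pair hf hg).trans (.op' .le (by simp))).trans ?_
  convert DataPT.refl _ using 2 with a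
  simp only [Op.eval, enc, decide_eq_true_eq]

@[fun_prop]
theorem PT.cond {c : α → Bool} {f g : α → β} (hc : PT c) (hf : PT f) (hg : PT g) :
    PT fun a => bif c a then f a else g a := by
  have := DataPT.ite (P := fun a => c a = true) hc (fun a => by cases h : c a <;> simp [enc]) hf hg
  unfold PT
  convert this using 2 with a
  cases h : c a <;> simp [h]

@[fun_prop]
theorem PT.boolAnd {f g : α → Bool} (hf : PT f) (hg : PT g) : PT fun a => f a && g a := by
  have : PT fun a => bif f a then g a else false := by fun_prop
  convert this using 2 with a
  cases f a <;> rfl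

@[fun_prop]
theorem PT.boolNot {f : α → Bool} (hf : PT f) : PT fun a => !f a := by
  have : PT fun a => bif f a then false else true := by fun_prop
  convert this using 2 with a
  cases f a <;> rfl

@[fun_prop]
theorem PT.natAbs {f : α → ℤ} (hf : PT f) : PT fun a => (f a).natAbs := by
  have : PT fun a => bif decide (0 ≤ f a) then f a else -f a := by fun_prop
  refine PT.of_natCast ?_
  convert this using 2 with a
  by_cases h : 0 ≤ f a
  · simp [h]
  · simp only [h, decide_false, cond_false]
    omega

@[fun_prop]
theorem PT.cons {f : α → β} {g : α → List β} (hf : PT f) (hg : PT g) : PT fun a => f a :: g a :=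
  DataPT.pair hf hg

theorem PT.listCases {l : α → List β} {f : α → γ} {g : α → β → List β → γ} (hl : PT l) (hf : PT f)
    (hg : PT fun p : α × β × List β => g p.1 p.2.1 p.2.2) :
    PT fun a => match l a with
      | [] => f a
      | b :: t => g a b t := by
  have h0 : DataPT (fun a => enc (a, l a)) fun a => Op.isPair.eval (enc (l a)) :=
    DataPT.snd.trans (.op' _ (by simp))
  have hf' : DataPT (fun a => enc (a, l a)) fun a => enc (f a) := DataPT.fst.trans hf
  obtain ⟨p, q, h⟩ := h0
  obtain ⟨p₁, q₁, h₁⟩ := hf'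
  obtain ⟨p₂, q₂, h₂⟩ := hg
  refine (DataPT.pair (DataPT.refl enc) hl).trans
    ⟨.ite p p₂ p₁, q + (q₁ + q₂) + Polynomial.X, fun a => ?_⟩
  obtain ⟨t, ht, hq⟩ := h a
  simp only [Polynomial.eval_add, Polynomial.eval_X]
  cases hla : l a with
  | nil =>
    obtain ⟨t', ht', hq'⟩ := h₁ a
    beta_reduce at ht ht' hq hq'
    rw [hla] at ht ht' hq hq'
    exact ⟨_, .ite_false ht ht', by simp only [enc] at *; omega⟩
  | cons b tl =>
    obtain ⟨t', ht', hq'⟩ := h₂ (a, b, tl)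
    beta_reduce at ht ht' hq hq'
    rw [hla] at ht hq
    exact ⟨_, .ite_true ht (by simp [enc, encList, Op.eval]) ht',
      by simp only [enc, encList] at *; omega⟩

@[fun_prop]
theorem PT.tail {l : α → List β} (hl : PT l) : PT fun a => (l a).tail := by
  convert PT.listCases (g := fun _ _ t => t) hl (PT.const ([] : List β)) (by fun_prop) using 2
    with a
  cases l a <;> rfl

theorem length_le_esize (l : List α) : l.length ≤ esize l := by
  induction l with
  | nil => simp
  | cons a l ih =>
    simp only [esize, enc, encList, Data.size, List.length_cons] at *
    omega

theorem esize_cons (a : α) (l : List α) : esize (a :: l) = esize a + esize l + 1 := rfl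

theorem esize_nil : esize ([] : List α) = 1 := by
  simp [esize, enc, encList, Data.size, intLen]

theorem esize_list_le (l : List α) {B : ℕ} (h : ∀ a ∈ l, esize a ≤ B) :
    esize l ≤ l.length * (B + 1) + 1 := by
  induction l with
  | nil => simp [esize_nil]
  | cons a l ih =>
    have h1 := ih fun x hx => h x (by simp [hx])
    have h2 := h a (by simp)
    rw [esize_cons, List.length_cons]
    nlinarith

theorem esize_le_of_mem {l : List α} {a : α} (h : a ∈ l) : esize a ≤ esize l := by
  induction l with
  | nil => simp at h
  | cons b l ih =>
    rw [esize_cons]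
    rcases List.mem_cons.1 h with rfl | h
    · omega
    · have := ih h; omega

/-- Iterating a polynomial-time step can produce exponentially large values, hence the hypothesis
`hq`: the state after every prefix of the list must be polynomially bounded. The loop carries the
parameter, the state and the unread part of the list. -/
theorem PT.foldl {step : α → σ → β → σ} {s : α → σ} {l : α → List β}
    (hstep : PT fun p : α × σ × β => step p.1 p.2.1 p.2.2) (hs : PT s) (hl : PT l)
    (q : Polynomial ℕ)
    (hq : ∀ a, ∀ l', l' <+: l a → esize (l'.foldl (step a) (s a)) ≤ q.eval (esize a)) :
    PT fun a => (l a).foldl (step a) (s a) := by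
  have hc : DataPT (ι := α × σ × List β) enc fun i => Op.isPair.eval (enc i.2.2) :=
    DataPT.snd.trans (DataPT.snd.trans (.op' _ (by simp)))
  have hb : DataPT (ι := α × σ × β × List β) enc
      fun i => enc (i.1, step i.1 i.2.1 i.2.2.1, i.2.2.2) := by
    change PT fun i : α × σ × β × List β => (i.1, step i.1 i.2.1 i.2.2.1, i.2.2.2)
    have : PT fun i : α × σ × β × List β => step i.1 i.2.1 i.2.2.1 :=
      hstep.comp (f := fun i : α × σ × β × List β => (i.1, i.2.1, i.2.2.1)) (by fun_prop)
    fun_prop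
  obtain ⟨c, qc, hc⟩ := hc
  obtain ⟨p, qp, hp⟩ := hb
  -- `S` bounds the size of the loop data in all rounds, because the unread list only shrinks; each
  -- round thus costs at most `qc.eval S + qp.eval S + S`.
  have key : ∀ (a : α) (B S : ℕ) (l : List β) (s : σ),
      (∀ l', l' <+: l → esize (l'.foldl (step a) s) ≤ B) → esize a + B + esize l + 2 ≤ S →
      ∃ t, Runs (.loop c p) (enc (a, s, l)) (enc (a, l.foldl (step a) s, ([] : List β))) t ∧
        t ≤ (l.length + 1) * (qc.eval S + qp.eval S + S) := by
    intro a B S l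
    induction l with
    | nil =>
      intro s hB hS
      obtain ⟨t, ht, hq⟩ := hc (a, s, [])
      have h1 := hB [] (by simp)
      have h2 : (enc (a, s, ([] : List β))).size ≤ S := by
        simp only [esize, enc, Data.size, List.foldl_nil] at *; omega
      refine ⟨_, Runs.loop_halt ht, ?_⟩
      have := eval_mono qc h2
      simp only [List.length_nil]
      omega
    | cons b l ih =>
      intro s hB hS
      obtain ⟨t, ht, hq⟩ := hc (a, s, b :: l)
      obtain ⟨t', ht', hq'⟩ := hp (a, s, b, l)
      have h1 := hB [] (by simp)
      have h2 : (enc (a, s, b :: l)).size ≤ S := by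
        simp only [esize, enc, Data.size, List.foldl_nil] at *; omega
      obtain ⟨u, hu, hu'⟩ := ih (step a s b)
        (fun l' hl' => hB (b :: l') (by simpa using hl'))
        (by rw [esize_cons] at hS; omega)
      refine ⟨_, .loop_step ht (by simp [enc, encList, Op.eval]) ht' hu, ?_⟩
      have e1 := eval_mono qc h2
      have e2 : qp.eval (enc (a, s, b, l)).size ≤ qp.eval S := eval_mono qp h2
      have e3 : (b :: l).length = l.length + 1 := rfl
      rw [e3, add_mul, one_mul]
      omega
  obtain ⟨ql, hql⟩ := hl.esize_le
  have h1 : PT fun a => (a, s a, l a) := by fun_prop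
  refine DataPT.trans h1
    (DataPT.trans (y := fun a => enc (a, (l a).foldl (step a) (s a), ([] : List β))) ?_
    (DataPT.snd.trans DataPT.fst))
  refine ⟨.loop c p, (Polynomial.X + 1) *
    (qc.comp (Polynomial.X + q + 2) + qp.comp (Polynomial.X + q + 2) + (Polynomial.X + q + 2)),
    fun a => ?_⟩
  have hX : esize a + q.eval (esize a) + esize (l a) + 2 ≤
      (Polynomial.X + q + 2 : Polynomial ℕ).eval (enc (a, s a, l a)).size := by
    have := eval_mono q (show esize a ≤ (enc (a, s a, l a)).size by
      simp only [esize, enc, Data.size]; omega)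
    simp only [Polynomial.eval_add, Polynomial.eval_X, Polynomial.eval_ofNat]
    simp only [esize, enc, Data.size] at *
    omega
  obtain ⟨t, ht, hq⟩ := key a _ _ (l a) (s a) (hq a) hX
  refine ⟨t, ht, hq.trans ?_⟩
  simp only [Polynomial.eval_add, Polynomial.eval_mul, Polynomial.eval_comp, Polynomial.eval_one,
    Polynomial.eval_X]
  refine Nat.mul_le_mul_right _ ?_
  have := length_le_esize (l a)
  simp only [esize, enc, Data.size] at *
  omega

end Computable

/-! ### Lists, vectors and determinants in polynomial time -/

section Computable

variable {α β γ σ : Type} [Enc α] [Enc β] [Enc γ] [Enc σ] {n : ℕ}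

theorem esize_prod (a : α) (b : β) : esize (a, b) = esize a + esize b + 1 := rfl

theorem esize_append (l l' : List α) : esize (l ++ l') + 1 = esize l + esize l' := by
  induction l with
  | nil => rw [List.nil_append, esize_nil, add_comm]
  | cons a l ih => rw [List.cons_append, esize_cons, esize_cons]; omega

theorem esize_reverse (l : List α) : esize l.reverse = esize l := by
  induction l with
  | nil => rfl
  | cons a l ih =>
    have := esize_append l.reverse [a]
    rw [esize_cons, esize_nil] at this
    rw [List.reverse_cons, esize_cons]
    omega

theorem esize_le_of_sublist {l l' : List α} (h : l'.Sublist l) : esize l' ≤ esize l := by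
  induction h with
  | slnil => exact le_rfl
  | cons a _ ih => rw [esize_cons]; omega
  | cons_cons a _ ih => rw [esize_cons, esize_cons]; omega

theorem esize_flatMap_le {ι : Type} (l : List ι) (f : ι → List β)
    {B : ℕ} (h : ∀ a ∈ l, esize (f a) ≤ B) :
    esize (l.flatMap f) ≤ l.length * B + 1 := by
  induction l with
  | nil => simp [esize_nil]
  | cons a l ih =>
    have h1 := ih fun x hx => h x (by simp [hx])
    have h2 := h a (by simp)
    have h3 := esize_append (f a) (l.flatMap f)
    rw [List.flatMap_cons, List.length_cons, add_mul, one_mul]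
    omega

@[fun_prop]
theorem PT.reverse {l : α → List β} (hl : PT l) : PT fun a => (l a).reverse := by
  have e : ∀ (l s : List β), l.foldl (fun s b => b :: s) s = l.reverse ++ s := by
    intro l
    induction l with
    | nil => simp
    | cons b l ih => simp [ih]
  obtain ⟨q, hq⟩ := hl.esize_le
  have := PT.foldl (step := fun (_ : α) (s : List β) (b : β) => b :: s) (s := fun _ => [])
    (by fun_prop) (by fun_prop) hl q fun a l' hl' => by
      rw [e, List.append_nil, esize_reverse]
      exact (esize_le_of_sublist hl'.sublist).trans (hq a)
  simpa [e] using this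

theorem PT.foldr {step : α → β → σ → σ} {s : α → σ} {l : α → List β}
    (hstep : PT fun p : α × β × σ => step p.1 p.2.1 p.2.2) (hs : PT s) (hl : PT l)
    (q : Polynomial ℕ)
    (hq : ∀ a, ∀ l', l' <:+ l a → esize (l'.foldr (step a) (s a)) ≤ q.eval (esize a)) :
    PT fun a => (l a).foldr (step a) (s a) := by
  simp only [List.foldr_eq_foldl_reverse] at hq ⊢
  refine PT.foldl (step := fun a s b => step a b s) ?_ hs (by fun_prop) q fun a l' hl' => ?_
  · exact hstep.comp (f := fun p : α × σ × β => (p.1, p.2.2, p.2.1)) (by fun_prop)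
  · have := hq a l'.reverse (by rw [← List.reverse_prefix]; simpa using hl')
    simpa using this

theorem PT.map {f : α → β → γ} {l : α → List β} (hf : PT fun p : α × β => f p.1 p.2) (hl : PT l) :
    PT fun a => (l a).map (f a) := by
  obtain ⟨q, hq⟩ := hl.esize_le
  obtain ⟨r, hr⟩ := hf.esize_le
  have := PT.foldr (step := fun a b (s : List γ) => f a b :: s) (s := fun _ => []) (l := l)
    (by
      have : PT fun p : α × β × List γ => f p.1 p.2.1 :=
        hf.comp (f := fun p : α × β × List γ => (p.1, p.2.1)) (by fun_prop)
      fun_prop) (by fun_prop) hl (q * (r.comp (.X + q + 1) + 1) + 1) fun a l' hl' => by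
      rw [← List.map_eq_foldr]
      have h1 := esize_list_le (l'.map (f a)) (B := r.eval (esize a + q.eval (esize a) + 1))
        (by
          intro c hc
          obtain ⟨b, hb, rfl⟩ := List.mem_map.1 hc
          refine (hr (a, b)).trans (eval_mono r ?_)
          rw [esize_prod]
          have := esize_le_of_mem (hl'.subset hb)
          have := hq a
          omega)
      refine h1.trans ?_
      simp only [Polynomial.eval_add, Polynomial.eval_mul, Polynomial.eval_comp,
        Polynomial.eval_one, Polynomial.eval_X, List.length_map]
      have h2 : l'.length ≤ q.eval (esize a) :=
        ((length_le_esize l').trans (esize_le_of_sublist hl'.sublist)).trans (hq a)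
      exact Nat.add_le_add_right (Nat.mul_le_mul_right _ h2) 1
  simpa only [← List.map_eq_foldr] using this

@[fun_prop]
theorem PT.append {f g : α → List β} (hf : PT f) (hg : PT g) : PT fun a => f a ++ g a := by
  obtain ⟨q, hq⟩ := hf.esize_le
  obtain ⟨r, hr⟩ := hg.esize_le
  have e : ∀ l s : List β, l.foldr (fun b s => b :: s) s = l ++ s := by simp
  have := PT.foldr (step := fun (_ : α) (b : β) s => b :: s) (s := g) (l := f)
    (by fun_prop) hg hf (q + r) fun a l' hl' => by
      have h1 := esize_append l' (g a)
      have h2 := esize_le_of_sublist hl'.sublist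
      have h3 := hq a
      have h4 := hr a
      rw [e, Polynomial.eval_add]
      omega
  simpa only [e] using this

theorem PT.flatMap {f : α → β → List γ} {l : α → List β} (hf : PT fun p : α × β => f p.1 p.2)
    (hl : PT l) : PT fun a => (l a).flatMap (f a) := by
  obtain ⟨q, hq⟩ := hl.esize_le
  obtain ⟨r, hr⟩ := hf.esize_le
  have e : ∀ (a : α) (l : List β), l.foldr (fun b s => f a b ++ s) [] = l.flatMap (f a) := by
    intro a l
    induction l with
    | nil => rfl
    | cons b l ih => simp [ih]
  have := PT.foldr (step := fun a b (s : List γ) => f a b ++ s) (s := fun _ => []) (l := l)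
    (by
      have : PT fun p : α × β × List γ => f p.1 p.2.1 :=
        hf.comp (f := fun p : α × β × List γ => (p.1, p.2.1)) (by fun_prop)
      fun_prop) (by fun_prop) hl (q * r.comp (.X + q + 1) + 1) fun a l' hl' => by
      rw [e]
      have h1 := esize_flatMap_le l' (f a) (B := r.eval (esize a + q.eval (esize a) + 1))
        (by
          intro b hb
          refine (hr (a, b)).trans (eval_mono r ?_)
          rw [esize_prod]
          have := esize_le_of_mem (hl'.subset hb)
          have := hq a
          omega)
      refine h1.trans ?_
      simp only [Polynomial.eval_add, Polynomial.eval_mul, Polynomial.eval_comp,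
        Polynomial.eval_one, Polynomial.eval_X]
      have h2 : l'.length ≤ q.eval (esize a) :=
        ((length_le_esize l').trans (esize_le_of_sublist hl'.sublist)).trans (hq a)
      exact Nat.add_le_add_right (Nat.mul_le_mul_right _ h2) 1
  simpa only [e] using this

theorem PT.filter {f : α → β → Bool} {l : α → List β} (hf : PT fun p : α × β => f p.1 p.2)
    (hl : PT l) : PT fun a => (l a).filter (f a) := by
  have e : ∀ (a : α) (l : List β),
      l.flatMap (fun b => bif f a b then [b] else []) = l.filter (f a) := by
    intro a l
    induction l with
    | nil => rfl
    | cons b l ih => cases h : f a b <;> simp [ih, h]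
  simp only [← e]
  exact PT.flatMap (f := fun a b => bif f a b then [b] else []) (by fun_prop) hl

theorem PT.all {f : α → β → Bool} {l : α → List β} (hf : PT fun p : α × β => f p.1 p.2)
    (hl : PT l) : PT fun a => (l a).all (f a) := by
  have e : ∀ (a : α) (l : List β),
      (match l.filter (fun b => !f a b) with
        | [] => true
        | _ :: _ => false) = l.all (f a) := by
    intro a l
    induction l with
    | nil => rfl
    | cons b l ih => cases h : f a b <;> simp [ih, h]
  simp only [← e]
  exact PT.listCases (g := fun _ _ _ => false)
    (PT.filter (f := fun a b => !f a b) (by fun_prop) hl) (by fun_prop) (by fun_prop)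

@[fun_prop]
theorem PT.natSum {l : α → List ℕ} (hl : PT l) : PT fun a => (l a).sum := by
  have e : ∀ l : List ℕ, esize l.sum ≤ esize l := by
    intro l
    induction l with
    | nil => simp [esize, enc, encList, Data.size]
    | cons b l ih =>
      rw [List.sum_cons, esize_cons]
      have := intLen_le_add (a := (b : ℤ)) (b := (l.sum : ℤ)) (c := ((b + l.sum : ℕ) : ℤ))
        (by push_cast; omega)
      simp only [esize, enc, Data.size] at *
      omega
  obtain ⟨q, hq⟩ := hl.esize_le
  simp only [List.sum]
  exact PT.foldr (step := fun (_ : α) b s => b + s) (s := fun _ => 0) (by fun_prop) (by fun_prop)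
    hl q fun a l' hl' => ((e l').trans (esize_le_of_sublist hl'.sublist)).trans (hq a)

@[fun_prop]
theorem PT.natProd {l : α → List ℕ} (hl : PT l) : PT fun a => (l a).prod := by
  have e : ∀ l : List ℕ, esize l.prod ≤ esize l + 1 := by
    intro l
    induction l with
    | nil => simp [esize, enc, encList, Data.size, intLen]
    | cons b l ih =>
      rw [List.prod_cons, esize_cons]
      have := intLen_mul_le (b : ℤ) (l.prod : ℤ)
      simp only [esize, enc, Data.size, Nat.cast_mul] at *
      omega
  obtain ⟨q, hq⟩ := hl.esize_le
  simp only [List.prod]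
  exact PT.foldr (step := fun (_ : α) b s => b * s) (s := fun _ => 1) (by fun_prop) (by fun_prop)
    hl (q + 1) fun a l' hl' => by
      have := ((e l').trans (Nat.add_le_add_right (esize_le_of_sublist hl'.sublist) 1)).trans
        (Nat.add_le_add_right (hq a) 1)
      simpa [List.prod] using this

theorem enc_fin_succ (v : Fin (n + 1) → α) : enc v = .pair (enc (v 0)) (enc (Fin.tail v)) := by
  simp only [enc, List.ofFn_succ, encList]
  rfl

/-- The length `n` is fixed, so the recursion takes place in the construction of the program and not
at run time. -/
theorem PT.apply {f : α → Fin n → β} (hf : PT f) (i : Fin n) : PT fun a => f a i := by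
  induction n generalizing α with
  | zero => exact i.elim0
  | succ n ih =>
    have h : DataPT enc fun a => Data.pair (enc (f a 0)) (enc (Fin.tail (f a))) := by
      have := hf
      unfold PT at this
      simpa only [enc_fin_succ] using this
    refine Fin.cases ?_ (fun j => ?_) i
    · exact h.trans .fst
    · exact ih (f := fun a => Fin.tail (f a)) (h.trans .snd) j

@[fun_prop]
theorem PT.eval_at (i : Fin n) : PT fun v : Fin n → β => v i := PT.apply PT.id i

@[fun_prop]
theorem PT.pi {f : α → Fin n → β} (hf : ∀ i, PT fun a => f a i) : PT fun a i => f a i := by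
  induction n with
  | zero =>
    have : (fun a i => f a i) = fun _ => Fin.elim0 := by ext a i; exact i.elim0
    rw [this]
    exact PT.const _
  | succ n ih =>
    have h : DataPT enc fun a => Data.pair (enc (f a 0)) (enc (Fin.tail (f a))) :=
      (hf 0).pair (ih fun i => hf i.succ)
    unfold PT
    simpa only [enc_fin_succ] using h

theorem PT.intSum {ι : Type} (s : Finset ι) {f : ι → α → ℤ} (hf : ∀ i, PT (f i)) :
    PT fun a => ∑ i ∈ s, f i a := by
  classical
  induction s using Finset.induction_on with
  | empty => simpa using PT.const 0
  | insert i s hi ih => simp only [Finset.sum_insert hi]; exact (hf i).intAdd ih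

theorem PT.intProd {ι : Type} (s : Finset ι) {f : ι → α → ℤ} (hf : ∀ i, PT (f i)) :
    PT fun a => ∏ i ∈ s, f i a := by
  classical
  induction s using Finset.induction_on with
  | empty => simpa using PT.const 1
  | insert i s hi ih => simp only [Finset.prod_insert hi]; exact (hf i).intMul ih

instance {m : ℕ} : Enc (Matrix (Fin m) (Fin n) ℤ) := ⟨encMat⟩

/-- For fixed `n` the Leibniz formula has a constant number of terms. -/
theorem PT.det {f : α → Matrix (Fin n) (Fin n) ℤ} (hf : PT f) : PT fun a => (f a).det := by
  have h : PT (β := Fin n → Fin n → ℤ) f := hf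
  simp only [Matrix.det_apply']
  exact PT.intSum _ fun σ => (PT.const _).intMul (PT.intProd _ fun i => (h.apply _).apply _)

end Computable

/-! ### Fourier–Motzkin elimination -/

section Rows

variable {n : ℕ}

/-- A linear inequality `a ⬝ x ≤ b`. -/
abbrev Ineq (n : ℕ) : Type := (Fin n → ℤ) × ℤ

/-- The linear functional on `ℝⁿ` with the given integer coefficients. -/
def rdot (a : Fin n → ℤ) : (Fin n → ℝ) →ₗ[ℝ] ℝ := ∑ i, (a i : ℝ) • LinearMap.proj i

theorem rdot_apply (a : Fin n → ℤ) (x : Fin n → ℝ) : rdot a x = ∑ i, (a i : ℝ) * x i := by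
  simp [rdot]

theorem IneqSystem.mem_region {S : IneqSystem n} {x : Fin n → ℝ} :
    x ∈ S.region ↔ ∀ r ∈ S, rdot r.1 x ≤ r.2 := by
  simp only [region, Set.mem_ofPred_eq, rdot_apply]

theorem rdot_neg (a : Fin n → ℤ) (x : Fin n → ℝ) : rdot (-a) x = -rdot a x := by
  simp [rdot_apply]

theorem rdot_cons (c : ℤ) (a : Fin n → ℤ) (z : ℝ) (x : Fin n → ℝ) :
    rdot (Fin.cons c a : Fin (n + 1) → ℤ) (Fin.cons z x) = c * z + rdot a x := by
  simp [rdot_apply, Fin.sum_univ_succ]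

theorem rdot_succ (a : Fin (n + 1) → ℤ) (z : ℝ) (x : Fin n → ℝ) :
    rdot a (Fin.cons z x) = a 0 * z + rdot (Fin.tail a) x := by
  simp [rdot_apply, Fin.sum_univ_succ, Fin.tail]

/-- The combination `p r - c q` of two vectors. -/
def comb (p c : ℤ) (r q : Fin n → ℤ) : Fin n → ℤ := fun i => p * r i - c * q i

theorem rdot_comb (p c : ℤ) (r q : Fin n → ℤ) (x : Fin n → ℝ) :
    rdot (comb p c r q) x = p * rdot r x - c * rdot q x := by
  simp only [rdot_apply, comb, Finset.mul_sum, ← Finset.sum_sub_distrib]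
  exact Finset.sum_congr rfl fun i _ => by push_cast; ring

@[fun_prop]
theorem PT.comb {α : Type} [Enc α] {p c : α → ℤ} {r q : α → Fin n → ℤ} (hp : PT p) (hc : PT c)
    (hr : PT r) (hq : PT q) : PT fun a => comb (p a) (c a) (r a) (q a) := by
  unfold SemilinearProj.comb
  fun_prop

@[fun_prop]
theorem PT.vecTail {α : Type} [Enc α] {f : α → Fin (n + 1) → ℤ} (hf : PT f) :
    PT fun a => (Fin.tail (f a) : Fin n → ℤ) := by
  change PT fun a (i : Fin n) => f a i.succ
  fun_prop

@[fun_prop]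
theorem PT.vecCons {α : Type} [Enc α] {c : α → ℤ} {f : α → Fin n → ℤ} (hc : PT c) (hf : PT f) :
    PT fun a => (Fin.cons (c a) (f a) : Fin (n + 1) → ℤ) := by
  refine PT.pi fun i => ?_
  refine Fin.cases ?_ (fun j => ?_) i
  · simpa using hc
  · simpa using hf.apply j

@[fun_prop]
theorem PT.vecNeg {α : Type} [Enc α] {f : α → Fin n → ℤ} (hf : PT f) : PT fun a => -f a := by
  change PT fun a (i : Fin n) => -f a i
  fun_prop

/-- `z = 0`, decided by two comparisons. -/
def isZero (z : ℤ) : Bool := decide (z ≤ 0) && decide (0 ≤ z)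

theorem isZero_iff {z : ℤ} : isZero z = true ↔ z = 0 := by
  simp only [isZero, Bool.and_eq_true, decide_eq_true_eq]; omega

theorem not_isZero_iff {z : ℤ} : (!isZero z) = true ↔ z ≠ 0 := by
  rw [Bool.not_eq_true', ← Bool.not_eq_true, isZero_iff]

@[fun_prop]
theorem PT.isZero {α : Type} [Enc α] {f : α → ℤ} (hf : PT f) : PT fun a => isZero (f a) := by
  unfold SemilinearProj.isZero
  fun_prop

/-- Elimination of the first unknown from a system of inequalities. -/
def IneqSystem.elim {k : ℕ} (S : IneqSystem (k + 1)) : IneqSystem k :=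
  (S.filter fun r => isZero (r.1 0)).map (fun r => (Fin.tail r.1, r.2)) ++
    (S.filter fun r => !decide (r.1 0 ≤ 0)).flatMap fun p =>
      (S.filter fun r => !decide (0 ≤ r.1 0)).map fun q =>
        (comb (p.1 0) (q.1 0) (Fin.tail q.1) (Fin.tail p.1), p.1 0 * q.2 - q.1 0 * p.2)

theorem exists_between_lists (L U : List ℝ) (h : ∀ l ∈ L, ∀ u ∈ U, l ≤ u) :
    ∃ z, (∀ l ∈ L, l ≤ z) ∧ ∀ u ∈ U, z ≤ u := by
  induction L with
  | nil =>
    obtain ⟨z, hz⟩ := U.toFinset.exists_le (α := ℝᵒᵈ)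
    exact ⟨z, by simp, fun u hu => hz u (List.mem_toFinset.2 hu)⟩
  | cons l L ih =>
    obtain ⟨z, h1, h2⟩ := ih fun l' hl' => h l' (by simp [hl'])
    refine ⟨max l z, ?_, fun u hu => max_le (h l (by simp) u hu) (h2 u hu)⟩
    intro l' hl'
    rcases List.mem_cons.1 hl' with rfl | hl'
    · exact le_max_left _ _
    · exact (h1 l' hl').trans (le_max_right _ _)

/-- Rows with negative leading coefficient bound `z` from below, those with positive one from above.
A suitable `z` exists iff every lower bound is at most every upper bound, and clearing denominators
turns these comparisons into the combined rows. -/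
theorem IneqSystem.mem_region_elim {k : ℕ} {S : IneqSystem (k + 1)} {x : Fin k → ℝ} :
    x ∈ S.elim.region ↔ ∃ z : ℝ, (Fin.cons z x : Fin (k + 1) → ℝ) ∈ S.region := by
  simp only [mem_region, elim, List.mem_append, List.mem_map, List.mem_filter, List.mem_flatMap,
    isZero_iff, Bool.not_eq_true', decide_eq_false_iff_not, not_le]
  constructor
  · intro h
    obtain ⟨z, h1, h2⟩ := exists_between_lists
      ((S.filter fun r => !decide (0 ≤ r.1 0)).map fun q =>
        ((q.2 : ℝ) - rdot (Fin.tail q.1) x) / q.1 0)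
      ((S.filter fun r => !decide (r.1 0 ≤ 0)).map fun q =>
        ((q.2 : ℝ) - rdot (Fin.tail q.1) x) / q.1 0) (by
        simp only [List.mem_map, List.mem_filter, Bool.not_eq_true', decide_eq_false_iff_not,
          not_le]
        rintro _ ⟨q, ⟨hq, hq0⟩, rfl⟩ _ ⟨p, ⟨hp, hp0⟩, rfl⟩
        have := h _ (Or.inr ⟨p, ⟨hp, hp0⟩, q, ⟨hq, hq0⟩, rfl⟩)
        simp only [rdot_comb] at this
        push_cast at this
        have hp' : (0 : ℝ) < p.1 0 := by exact_mod_cast hp0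
        have hq' : (q.1 0 : ℝ) < 0 := by exact_mod_cast hq0
        rw [le_div_iff₀ hp', div_mul_eq_mul_div, div_le_iff_of_neg hq']
        nlinarith)
    refine ⟨z, fun r hr => ?_⟩
    rw [rdot_succ]
    rcases lt_trichotomy (r.1 0) 0 with h0 | h0 | h0
    · have := h1 _ (List.mem_map.2 ⟨r, List.mem_filter.2 ⟨hr, by simpa using h0⟩, rfl⟩)
      have h0' : (r.1 0 : ℝ) < 0 := by exact_mod_cast h0
      rw [div_le_iff_of_neg h0'] at this
      linarith
    · have := h _ (Or.inl ⟨r, ⟨hr, h0⟩, rfl⟩)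
      rw [h0]
      simpa using this
    · have := h2 _ (List.mem_map.2 ⟨r, List.mem_filter.2 ⟨hr, by simpa using h0⟩, rfl⟩)
      have h0' : (0 : ℝ) < r.1 0 := by exact_mod_cast h0
      rw [le_div_iff₀ h0'] at this
      linarith
  · rintro ⟨z, h⟩ r (⟨r, ⟨hr, hr0⟩, rfl⟩ | ⟨p, ⟨hp, hp0⟩, q, ⟨hq, hq0⟩, rfl⟩)
    · have := h r hr
      rw [rdot_succ, hr0] at this
      simpa using this
    · have h1 := h p hp
      have h2 := h q hq
      rw [rdot_succ] at h1 h2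
      have hp' : (0 : ℝ) < p.1 0 := by exact_mod_cast hp0
      have hq' : (q.1 0 : ℝ) < 0 := by exact_mod_cast hq0
      rw [rdot_comb]
      push_cast
      nlinarith

/-- Feasibility over the reals, by elimination of all unknowns. -/
def IneqSystem.feasible : {k : ℕ} → IneqSystem k → Bool
  | 0, S => S.all fun r => decide (0 ≤ r.2)
  | _ + 1, S => IneqSystem.feasible S.elim

theorem IneqSystem.feasible_iff {k : ℕ} {S : IneqSystem k} :
    S.feasible = true ↔ S.region.Nonempty := by
  induction k with
  | zero =>
    simp only [feasible, List.all_eq_true, decide_eq_true_eq, Set.Nonempty, mem_region, rdot_apply,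
      Finset.univ_eq_empty, Finset.sum_empty, exists_const]
    exact ⟨fun h r hr => by exact_mod_cast h r hr, fun h r hr => by exact_mod_cast h r hr⟩
  | succ k ih =>
    rw [feasible, ih]
    constructor
    · rintro ⟨x, hx⟩
      obtain ⟨z, hz⟩ := mem_region_elim.1 hx
      exact ⟨_, hz⟩
    · rintro ⟨x, hx⟩
      exact ⟨Fin.tail x, mem_region_elim.2 ⟨x 0, by rwa [Fin.cons_self_tail]⟩⟩

theorem PT.ineqElim {k : ℕ} : PT (IneqSystem.elim (k := k)) := by
  unfold IneqSystem.elim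
  refine PT.append ?_ ?_
  · exact PT.map (f := fun _ (r : Ineq (k + 1)) => ((Fin.tail r.1 : Fin k → ℤ), r.2)) (by fun_prop)
      (PT.filter (f := fun _ (r : Ineq (k + 1)) => SemilinearProj.isZero (r.1 0))
        (by fun_prop) (by fun_prop))
  · refine PT.flatMap (f := fun (S : IneqSystem (k + 1)) (p : Ineq (k + 1)) =>
      (S.filter fun r => !decide (0 ≤ r.1 0)).map fun q =>
        (SemilinearProj.comb (p.1 0) (q.1 0) (Fin.tail q.1) (Fin.tail p.1),
          p.1 0 * q.2 - q.1 0 * p.2)) ?_ ?_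
    · refine PT.map (f := fun (s : IneqSystem (k + 1) × Ineq (k + 1)) (q : Ineq (k + 1)) =>
        (SemilinearProj.comb (s.2.1 0) (q.1 0) (Fin.tail q.1) (Fin.tail s.2.1),
          s.2.1 0 * q.2 - q.1 0 * s.2.2)) (by fun_prop) ?_
      exact PT.filter (f := fun _ (r : Ineq (k + 1)) => !decide (0 ≤ r.1 0))
        (by fun_prop) (by fun_prop)
    · exact PT.filter (f := fun _ (r : Ineq (k + 1)) => !decide (r.1 0 ≤ 0))
        (by fun_prop) (by fun_prop)

/-- The number of elimination rounds is the fixed dimension, so the composition of the rounds stays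
polynomial although each may square the number of rows. -/
theorem PT.feasible {k : ℕ} : PT (IneqSystem.feasible (k := k)) := by
  induction k with
  | zero => exact PT.all (f := fun _ (r : Ineq 0) => decide (0 ≤ r.2)) (by fun_prop) PT.id
  | succ k ih => exact ih.comp PT.ineqElim

/-- Whether some point of the polyhedron satisfies one more inequality strictly. The system is
homogenized by an unknown that is at least `1`. -/
def IneqSystem.strictFeasible {k : ℕ} (S : IneqSystem k) (r : Ineq k) : Bool :=
  IneqSystem.feasible (k := k + 1) ((Fin.cons (-1) 0, -1) :: (Fin.cons (-r.2) r.1, -1) ::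
    S.map fun r => (Fin.cons (-r.2) r.1, 0))

/-- Scaling turns the strict inequality into a weak one: a solution `(d, x)` of the homogenized
system with `d ≥ 1` and slack at least `1` gives the point `x / d`, and conversely a point with
positive slack is scaled up. -/
theorem IneqSystem.strictFeasible_iff {k : ℕ} {S : IneqSystem k} {r : Ineq k} :
    S.strictFeasible r = true ↔ ∃ x ∈ S.region, rdot r.1 x < r.2 := by
  rw [strictFeasible, feasible_iff]
  constructor
  · rintro ⟨y, hy⟩
    rw [← Fin.cons_self_tail y] at hy
    generalize y 0 = d at hy
    generalize Fin.tail y = x at hy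
    simp only [mem_region, List.mem_cons, List.mem_map, forall_eq_or_imp, rdot_cons,
      forall_exists_index, and_imp, forall_apply_eq_imp_iff₂] at hy
    obtain ⟨h1, h2, h3⟩ := hy
    have e : rdot (0 : Fin k → ℤ) x = 0 := by simp [rdot_apply]
    push_cast at h1 h2 h3
    rw [e] at h1
    have hd : 0 < d := by linarith
    refine ⟨d⁻¹ • x, mem_region.2 fun q hq => ?_, ?_⟩
    · have := h3 q hq
      rw [map_smul, smul_eq_mul, inv_mul_le_iff₀ hd]
      linarith
    · rw [map_smul, smul_eq_mul, inv_mul_lt_iff₀ hd]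
      linarith
  · rintro ⟨x, hx, hr⟩
    have hp : 0 < (r.2 : ℝ) - rdot r.1 x := by linarith
    -- The summand `1` ensures `d ≥ 1`; the inverse of the slack makes the scaled slack at least
    -- `1`.
    set d : ℝ := 1 + 1 / ((r.2 : ℝ) - rdot r.1 x) with hd
    have hd1 : 1 ≤ d := by
      have := one_div_pos.2 hp
      linarith
    have hd2 : 1 ≤ d * ((r.2 : ℝ) - rdot r.1 x) := by
      rw [hd, add_mul, one_div_mul_cancel hp.ne']
      linarith
    refine ⟨Fin.cons d (d • x), ?_⟩
    simp only [mem_region, List.mem_cons, List.mem_map, forall_eq_or_imp, rdot_cons,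
      forall_exists_index, and_imp, forall_apply_eq_imp_iff₂]
    refine ⟨?_, ?_, fun q hq => ?_⟩
    · simp only [map_smul, smul_eq_mul]
      have e : rdot (0 : Fin k → ℤ) x = 0 := by simp [rdot_apply]
      rw [e]
      push_cast
      linarith
    · rw [map_smul, smul_eq_mul]
      push_cast
      linarith
    · have := mem_region.1 hx q hq
      rw [map_smul, smul_eq_mul]
      push_cast
      nlinarith

@[fun_prop]
theorem PT.strictFeasible {α : Type} [Enc α] {k : ℕ} {S : α → IneqSystem k}
    {r : α → Ineq k} (hS : PT S) (hr : PT r) :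
    PT fun a => (S a).strictFeasible (r a) := by
  unfold IneqSystem.strictFeasible
  refine PT.feasible.comp ?_
  have : PT fun a => (S a).map fun r => ((Fin.cons (-r.2) r.1 : Fin (k + 1) → ℤ), (0 : ℤ)) :=
    PT.map (f := fun _ (r : Ineq k) => ((Fin.cons (-r.2) r.1 : Fin (k + 1) → ℤ), (0 : ℤ)))
      (by fun_prop) hS
  fun_prop

end Rows

/-! ### Irredundant descriptions -/

section Constraints

variable {n : ℕ}

/-- A linear inequality, or a linear equation if the flag is set. -/
abbrev Constraint (n : ℕ) : Type := Ineq n × Bool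

/-- The point `x` satisfies the constraint. -/
def Constraint.Holds (c : Constraint n) (x : Fin n → ℝ) : Prop :=
  rdot c.1.1 x ≤ c.1.2 ∧ (c.2 = true → rdot c.1.1 x = c.1.2)

/-- The opposite inequality. -/
def Ineq.neg (r : Ineq n) : Ineq n := (-r.1, -r.2)

@[fun_prop]
theorem PT.ineqNeg {α : Type} [Enc α] {f : α → Ineq n} (hf : PT f) : PT fun a => (f a).neg := by
  unfold Ineq.neg
  fun_prop

theorem Ineq.rdot_neg_le {r : Ineq n} {x : Fin n → ℝ} :
    rdot r.neg.1 x ≤ r.neg.2 ↔ (r.2 : ℝ) ≤ rdot r.1 x := by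
  simp [Ineq.neg, rdot_neg]

theorem Ineq.rdot_neg_lt {r : Ineq n} {x : Fin n → ℝ} :
    rdot r.neg.1 x < r.neg.2 ↔ (r.2 : ℝ) < rdot r.1 x := by
  simp [Ineq.neg, rdot_neg]

/-- The system of inequalities given by a list of constraints. -/
def toSystem (cs : List (Constraint n)) : IneqSystem n :=
  cs.flatMap fun c => bif c.2 then [c.1, c.1.neg] else [c.1]

theorem mem_region_toSystem {cs : List (Constraint n)} {x : Fin n → ℝ} :
    x ∈ (toSystem cs).region ↔ ∀ c ∈ cs, c.Holds x := by
  simp only [IneqSystem.mem_region, toSystem, List.mem_flatMap, forall_exists_index, and_imp]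
  constructor
  · intro h c hc
    refine ⟨h _ c hc (by cases c.2 <;> simp), fun h2 => le_antisymm (h _ c hc (by simp [h2])) ?_⟩
    exact Ineq.rdot_neg_le.1 (h _ c hc (by simp [h2]))
  · intro h r c hc hr
    obtain ⟨h1, h2⟩ := h c hc
    cases hb : c.2
    · simp only [hb, cond_false, List.mem_singleton] at hr
      rwa [hr]
    · simp only [hb, cond_true, List.mem_cons, List.not_mem_nil, or_false] at hr
      rcases hr with rfl | rfl
      · exact h1
      · exact Ineq.rdot_neg_le.2 (h2 hb).ge

@[fun_prop]
theorem PT.toSystem {α : Type} [Enc α] {f : α → List (Constraint n)} (hf : PT f) :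
    PT fun a => toSystem (f a) :=
  PT.flatMap (f := fun _ (c : Constraint n) => bif c.2 then [c.1, c.1.neg] else [c.1])
    (by fun_prop) hf

/-- Whether the constraint follows from the others. -/
def implied (cs : List (Constraint n)) (c : Constraint n) : Bool :=
  !(toSystem cs).strictFeasible c.1.neg && bif c.2 then !(toSystem cs).strictFeasible c.1 else true

theorem implied_iff {cs : List (Constraint n)} {c : Constraint n} :
    implied cs c = true ↔ ∀ x ∈ (toSystem cs).region, c.Holds x := by
  have h1 : ((!(toSystem cs).strictFeasible c.1.neg) = true) ↔
      ∀ x ∈ (toSystem cs).region, rdot c.1.1 x ≤ c.1.2 := by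
    rw [Bool.not_eq_true', ← Bool.not_eq_true, IneqSystem.strictFeasible_iff]
    push Not
    simp only [← not_lt, Ineq.rdot_neg_lt]
  have h2 : ((!(toSystem cs).strictFeasible c.1) = true) ↔
      ∀ x ∈ (toSystem cs).region, (c.1.2 : ℝ) ≤ rdot c.1.1 x := by
    rw [Bool.not_eq_true', ← Bool.not_eq_true, IneqSystem.strictFeasible_iff]
    push Not
    rfl
  rw [implied, Bool.and_eq_true, h1]
  cases hb : c.2
  · simp [Constraint.Holds, hb]
  · simp only [cond_true, h2, Constraint.Holds, hb, forall_const]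
    exact ⟨fun h x hx => ⟨h.1 x hx, le_antisymm (h.1 x hx) (h.2 x hx)⟩,
      fun h => ⟨fun x hx => (h x hx).1, fun x hx => (h x hx).2.ge⟩⟩

@[fun_prop]
theorem PT.implied {α : Type} [Enc α] {f : α → List (Constraint n)} {g : α → Constraint n}
    (hf : PT f) (hg : PT g) : PT fun a => implied (f a) (g a) := by
  unfold SemilinearProj.implied
  fun_prop

/-- The inequalities of a system, those that hold with equality throughout marked as equations. -/
def flagged (S : IneqSystem n) : List (Constraint n) := S.map fun r => (r, !S.strictFeasible r)

theorem region_flagged (S : IneqSystem n) : (toSystem (flagged S)).region = S.region := by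
  ext x
  rw [mem_region_toSystem, IneqSystem.mem_region]
  simp only [flagged, List.mem_map, forall_exists_index, and_imp, forall_apply_eq_imp_iff₂]
  refine ⟨fun h r hr => (h r hr).1, fun h r hr => ⟨h r hr, fun h2 => ?_⟩⟩
  simp only [Bool.not_eq_true', ← Bool.not_eq_true, IneqSystem.strictFeasible_iff] at h2
  push Not at h2
  exact le_antisymm (h r hr) (h2 x (IneqSystem.mem_region.2 h))

theorem PT.flagged : PT (flagged (n := n)) :=
  PT.map (f := fun (S : IneqSystem n) r => (r, !S.strictFeasible r)) (by fun_prop) PT.id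

/-- One step of the removal of redundant constraints: the state consists of the constraints kept so
far and of those not yet examined. -/
def pruneStep (s : List (Constraint n) × List (Constraint n)) (c : Constraint n) :
    List (Constraint n) × List (Constraint n) :=
  bif implied (s.1 ++ s.2.tail) c then (s.1, s.2.tail) else (c :: s.1, s.2.tail)

/-- Successive removal of redundant constraints. -/
def prune (cs : List (Constraint n)) : List (Constraint n) := (cs.foldl pruneStep ([], cs)).1

theorem PT.prune : PT (prune (n := n)) := by
  refine PT.fst (PT.foldl (α := List (Constraint n)) (step := fun _ => pruneStep)
    (s := fun cs => ([], cs)) ?_ (by fun_prop) (by fun_prop) (3 * .X + 10) ?_)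
  · unfold pruneStep
    fun_prop
  · have key : ∀ (l : List (Constraint n)) (s : List (Constraint n) × List (Constraint n)),
        esize (l.foldl pruneStep s) ≤ esize l + esize s := by
      intro l
      induction l with
      | nil => intro s; simp
      | cons c l ih =>
        intro s
        refine (ih _).trans ?_
        have h2 : esize s.2.tail ≤ esize s.2 := esize_le_of_sublist (List.tail_sublist _)
        have h3 : esize s = esize s.1 + esize s.2 + 1 := rfl
        rw [pruneStep, esize_cons]
        cases SemilinearProj.implied (s.1 ++ s.2.tail) c
        · rw [cond_false, esize_prod, esize_cons]; omega
        · rw [cond_true, esize_prod]; omega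
    intro cs l' hl'
    refine (key l' _).trans ?_
    have := esize_le_of_sublist hl'.sublist
    rw [esize_prod, esize_nil]
    simp
    omega

/-- No constraint of the list follows from the others. -/
def Irredundant (cs : List (Constraint n)) : Prop :=
  ∀ l₁ c l₂, cs = l₁ ++ c :: l₂ → ∃ x, (∀ d ∈ l₁ ++ l₂, d.Holds x) ∧ ¬ c.Holds x

/-- The invariant is that no kept constraint follows from the other kept ones together with all
unexamined ones. Dropping a constraint later only weakens the premises, so a constraint once found
necessary stays necessary. -/
theorem prune_aux (rest : List (Constraint n)) : ∀ kept : List (Constraint n),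
    (∀ l₁ c l₂, kept = l₁ ++ c :: l₂ → ∃ x, (∀ d ∈ l₁ ++ l₂ ++ rest, d.Holds x) ∧ ¬ c.Holds x) →
    Irredundant (rest.foldl pruneStep (kept, rest)).1 ∧
    (∀ c ∈ (rest.foldl pruneStep (kept, rest)).1, c ∈ kept ++ rest) ∧
    ∀ x, (∀ c ∈ (rest.foldl pruneStep (kept, rest)).1, c.Holds x) →
      ∀ c ∈ kept ++ rest, c.Holds x := by
  induction rest with
  | nil =>
    intro kept h
    simp only [List.append_nil] at h
    simp only [List.foldl_nil, List.append_nil]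
    exact ⟨h, fun c hc => hc, fun x hx => hx⟩
  | cons c rest ih =>
    intro kept h
    rw [List.foldl_cons]
    cases hi : implied (kept ++ rest) c
    · have e : pruneStep (kept, c :: rest) c = (c :: kept, rest) := by simp [pruneStep, hi]
      rw [e]
      obtain ⟨h1, h2, h3⟩ := ih (c :: kept) (by
        intro l₁ d l₂ hl
        rcases List.cons_eq_append_iff.1 hl with ⟨rfl, hd⟩ | ⟨l, rfl, hl'⟩
        · obtain ⟨rfl, rfl⟩ := List.cons.inj hd
          rw [← Bool.not_eq_true, implied_iff] at hi
          push Not at hi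
          obtain ⟨x, hx, hx'⟩ := hi
          exact ⟨x, by simpa using mem_region_toSystem.1 hx, hx'⟩
        · obtain ⟨x, hx, hx'⟩ := h l d l₂ hl'
          refine ⟨x, fun e he => hx e ?_, hx'⟩
          simp only [List.mem_append, List.mem_cons] at he ⊢
          tauto)
      refine ⟨h1, fun d hd => ?_, fun x hx d hd => h3 x hx d ?_⟩
      · have := h2 d hd
        simp only [List.mem_append, List.mem_cons] at this ⊢
        tauto
      · simp only [List.mem_append, List.mem_cons] at hd ⊢
        tauto
    · have e : pruneStep (kept, c :: rest) c = (kept, rest) := by simp [pruneStep, hi]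
      rw [e]
      obtain ⟨h1, h2, h3⟩ := ih kept (by
        intro l₁ d l₂ hl
        obtain ⟨x, hx, hx'⟩ := h l₁ d l₂ hl
        refine ⟨x, fun e he => hx e ?_, hx'⟩
        simp only [List.mem_append, List.mem_cons] at he ⊢
        tauto)
      refine ⟨h1, fun d hd => ?_, fun x hx d hd => ?_⟩
      · have := h2 d hd
        simp only [List.mem_append, List.mem_cons] at this ⊢
        tauto
      · have h4 := h3 x hx
        have h5 := implied_iff.1 hi x (mem_region_toSystem.2 h4)
        simp only [List.mem_append, List.mem_cons] at hd h4
        rcases hd with hd | rfl | hd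
        · exact h4 d (Or.inl hd)
        · exact h5
        · exact h4 d (Or.inr hd)

theorem prune_spec (cs : List (Constraint n)) : Irredundant (prune cs) ∧
    (∀ c ∈ prune cs, c ∈ cs) ∧ (toSystem (prune cs)).region = (toSystem cs).region := by
  obtain ⟨h1, h2, h3⟩ := prune_aux cs [] (by simp)
  refine ⟨h1, h2, ?_⟩
  ext x
  rw [mem_region_toSystem, mem_region_toSystem]
  exact ⟨h3 x, fun h c hc => h c (h2 c hc)⟩

/-- An irredundant list of constraints that describes the same polyhedron, empty if the polyhedron
is. -/
def IneqSystem.trimmed (S : IneqSystem n) : List (Constraint n) :=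
  bif S.feasible then prune (flagged S) else []

theorem PT.trimmed : PT (IneqSystem.trimmed (n := n)) := by
  have h1 : PT fun S : IneqSystem n =>
    SemilinearProj.prune (SemilinearProj.flagged S) := PT.prune.comp PT.flagged
  have h2 := PT.feasible (k := n)
  unfold IneqSystem.trimmed
  fun_prop

end Constraints

/-! ### Facets -/

section Facets

variable {n : ℕ}

theorem IneqSystem.convex_region (S : IneqSystem n) : Convex ℝ S.region := by
  intro x hx y hy a b ha hb hab
  rw [mem_region] at *
  intro r hr
  have h1 := mul_le_mul_of_nonneg_left (hx r hr) ha
  have h2 := mul_le_mul_of_nonneg_left (hy r hr) hb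
  rw [map_add, map_smul, map_smul, smul_eq_mul, smul_eq_mul]
  have : (r.2 : ℝ) = a * r.2 + b * r.2 := by rw [← add_mul, hab, one_mul]
  linarith

theorem vectorSpan_le_of_forall_sub_mem {P : Set (Fin n → ℝ)} {W : Submodule ℝ (Fin n → ℝ)}
    (h : ∀ x ∈ P, ∀ y ∈ P, x - y ∈ W) : vectorSpan ℝ P ≤ W := by
  rw [vectorSpan_def, Submodule.span_le]
  rintro _ ⟨x, hx, y, hy, rfl⟩
  exact h x hx y hy

/-- A common point where all inequalities of a list are strict. -/
theorem exists_forall_strict {F : Set (Fin n → ℝ)} (hF : Convex ℝ F) (hne : F.Nonempty)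
    {ι : Type} (row : ι → Ineq n) (p : ι → Prop) (L : List ι)
    (hle : ∀ i ∈ L, ∀ x ∈ F, rdot (row i).1 x ≤ (row i).2)
    (h : ∀ i ∈ L, p i ∨ ∃ x ∈ F, rdot (row i).1 x < (row i).2) :
    ∃ x ∈ F, ∀ i ∈ L, p i ∨ rdot (row i).1 x < (row i).2 := by
  induction L with
  | nil => obtain ⟨x, hx⟩ := hne; exact ⟨x, hx, by simp⟩
  | cons r L ih =>
    obtain ⟨x, hx, h1⟩ := ih (fun r hr => hle r (by simp [hr])) fun r hr => h r (by simp [hr])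
    rcases h r (by simp) with h2 | ⟨y, hy, h2⟩
    · refine ⟨x, hx, fun s hs => ?_⟩
      rcases List.mem_cons.1 hs with rfl | hs
      exacts [Or.inl h2, h1 s hs]
    · refine ⟨(1 / 2 : ℝ) • x + (1 / 2 : ℝ) • y,
        hF hx hy (by norm_num) (by norm_num) (by norm_num), fun s hs => ?_⟩
      have hsx := hle s hs x hx
      have hsy := hle s hs y hy
      simp only [map_add, map_smul, smul_eq_mul]
      rcases List.mem_cons.1 hs with rfl | hs
      · right; linarith
      · refine (h1 s hs).imp_right fun h3 => ?_
        linarith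

/-- From a point one can move a little in a direction along which the tight inequalities do not
change. -/
theorem exists_pos_forall_le {ι : Type} (row : ι → Ineq n) (L : List ι) (x v : Fin n → ℝ)
    (h : ∀ i ∈ L, rdot (row i).1 v = 0 ∧ rdot (row i).1 x ≤ (row i).2 ∨
      rdot (row i).1 x < (row i).2) :
    ∃ ε : ℝ, 0 < ε ∧ ∀ i ∈ L, rdot (row i).1 (x + ε • v) ≤ (row i).2 := by
  have h1 : ∀ᶠ ε : ℝ in nhdsWithin 0 (Set.Ioi 0), ∀ i ∈ {i | i ∈ L},
      rdot (row i).1 (x + ε • v) ≤ (row i).2 := by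
    rw [Filter.eventually_all_finite L.finite_toSet]
    intro i hi
    simp only [map_add, map_smul, smul_eq_mul]
    rcases h i hi with ⟨h1, h2⟩ | h1
    · rw [h1]
      exact Filter.Eventually.of_forall fun ε => by simpa using h2
    · refine nhdsWithin_le_nhds ?_
      have hc : Continuous fun ε : ℝ => rdot (row i).1 x + ε * rdot (row i).1 v := by fun_prop
      have := hc.continuousAt.eventually_lt
        (continuousAt_const (x := (0 : ℝ)) (y := ((row i).2 : ℝ)))
        (by simpa using h1)
      exact this.mono fun ε hε => hε.le
  obtain ⟨ε, h2, h3⟩ := (h1.and self_mem_nhdsWithin).exists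
  exact ⟨ε, h3, h2⟩

/-- The part of a set where an inequality is tight. -/
def tightOn (Q : Set (Fin n → ℝ)) (r : Ineq n) : Set (Fin n → ℝ) := {x | x ∈ Q ∧ rdot r.1 x = r.2}

/-- Some row must be tight on `F` but not on the whole polyhedron, and a dimension count shows that
`F` fills the face where that row is tight. The rows of `S₀`, being tight everywhere, cannot be the
one. -/
theorem IsFacet.exists_eq_tightOn {S S₀ : IneqSystem n}
    (h₀ : ∀ r ∈ S₀, ∀ x ∈ IneqSystem.region (S ++ S₀), rdot r.1 x = r.2) {F : Set (Fin n → ℝ)}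
    (hF : IsFacet (IneqSystem.region (S ++ S₀)) F) :
    ∃ r ∈ S, F = tightOn (IneqSystem.region (S ++ S₀)) r := by
  obtain ⟨hne, hexp, hdim⟩ := hF
  have hconv := hexp.convex (IneqSystem.convex_region _)
  obtain ⟨l, hl⟩ := hexp hne
  set Q := IneqSystem.region (S ++ S₀) with hQ
  have hFQ : F ⊆ Q := fun x hx => by rw [hl] at hx; exact hx.1
  have hmemQ : ∀ x, x ∈ Q ↔ ∀ r ∈ S ++ S₀, rdot r.1 x ≤ r.2 := fun x => IneqSystem.mem_region
  have hlF : ∀ x ∈ F, ∀ y ∈ Q, l y ≤ l x := fun x hx y hy => by rw [hl] at hx; exact hx.2 y hy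
  -- Otherwise a point `x` of `F` that is strict in all rows strict somewhere on `F` is relatively
  -- interior to the polyhedron, which forces `F` to be everything.
  have key : ∃ r ∈ S, (∀ x ∈ F, rdot r.1 x = r.2) ∧ ∃ x ∈ Q, rdot r.1 x ≠ r.2 := by
    by_contra! hcon
    obtain ⟨x, hx, hs⟩ := exists_forall_strict hconv hne id
      (fun r => ∀ x ∈ Q, rdot r.1 x = r.2) (S ++ S₀)
      (fun r hr x hx => (hmemQ x).1 (hFQ hx) r hr) fun r hr => by
        rcases List.mem_append.1 hr with hr' | hr'
        · by_cases h : ∀ x ∈ F, rdot r.1 x = r.2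
          · exact Or.inl (hcon r hr' h)
          · push Not at h
            obtain ⟨x, hx, hne⟩ := h
            exact Or.inr ⟨x, hx, lt_of_le_of_ne ((hmemQ x).1 (hFQ hx) r hr) hne⟩
        · exact Or.inl (h₀ r hr')
    have hFeq : F = Q := by
      refine hFQ.antisymm fun p hp => ?_
      -- One can move from `x` slightly away from `p` without leaving the polyhedron. Since `l` is
      -- maximal at `x`, its value at `p` cannot be smaller.
      obtain ⟨ε, hε, h⟩ := exists_pos_forall_le id (S ++ S₀) x (x - p) fun r hr => by
        rcases hs r hr with h | h
        · left
          rw [map_sub, id, h x (hFQ hx), h p hp, sub_self]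
          exact ⟨rfl, le_rfl⟩
        · exact Or.inr h
      have h2 := hlF x hx _ ((hmemQ _).2 h)
      rw [map_add, map_smul, map_sub, smul_eq_mul] at h2
      have h3 : l x ≤ l p := by
        by_contra h3
        nlinarith [mul_pos hε (sub_pos.2 (not_le.1 h3))]
      rw [hl]
      exact ⟨hp, fun y hy => (hlF x hx y hy).trans h3⟩
    rw [hFeq] at hdim
    omega
  obtain ⟨r, hr, hrF, p, hp, hrp⟩ := key
  refine ⟨r, hr, ?_⟩
  have hsub : F ⊆ tightOn Q r := fun x hx => ⟨hFQ hx, hrF x hx⟩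
  refine hsub.antisymm fun y hy => ?_
  obtain ⟨x, hx⟩ := hne
  have h1 : vectorSpan ℝ (tightOn Q r) ≤ LinearMap.ker (rdot r.1) :=
    vectorSpan_le_of_forall_sub_mem fun x hx y hy => by
      rw [LinearMap.mem_ker, map_sub, hx.2, hy.2, sub_self]
  have h2 : vectorSpan ℝ (tightOn Q r) < vectorSpan ℝ Q := by
    refine lt_of_le_of_ne (vectorSpan_mono ℝ fun x hx => hx.1) fun h => hrp ?_
    have h3 := h1 (h ▸ vsub_mem_vectorSpan ℝ hp (hFQ hx))
    rw [LinearMap.mem_ker, vsub_eq_sub, map_sub, hrF x hx, sub_eq_zero] at h3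
    exact h3
  have h3 := Submodule.finrank_lt_finrank_of_lt h2
  -- The span of `F` has codimension one and that of the tight set is proper, so they agree; hence
  -- `l`, constant on `F`, is constant on the tight set.
  have h4 : vectorSpan ℝ F = vectorSpan ℝ (tightOn Q r) :=
    Submodule.eq_of_le_of_finrank_le (vectorSpan_mono ℝ hsub) (by unfold affDim at hdim; omega)
  have h5 : vectorSpan ℝ F ≤ LinearMap.ker (l : (Fin n → ℝ) →ₗ[ℝ] ℝ) :=
    vectorSpan_le_of_forall_sub_mem fun x hx y hy => by
      rw [LinearMap.mem_ker, map_sub, sub_eq_zero]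
      exact le_antisymm (hlF y hy x (hFQ hx)) (hlF x hx y (hFQ hy))
  have h6 := h5 (h4 ▸ vsub_mem_vectorSpan ℝ hy (hsub hx))
  rw [LinearMap.mem_ker, vsub_eq_sub, map_sub, sub_eq_zero] at h6
  rw [hl]
  refine ⟨hy.1, fun z hz => (hlF x hx z hz).trans (le_of_eq ?_)⟩
  exact h6.symm

theorem facets_subset {S S₀ : IneqSystem n}
    (h₀ : ∀ r ∈ S₀, ∀ x ∈ IneqSystem.region (S ++ S₀), rdot r.1 x = r.2) :
    {F | IsFacet (IneqSystem.region (S ++ S₀)) F} ⊆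
      ((List.map (tightOn (IneqSystem.region (S ++ S₀))) S).toFinset :
        Set (Set (Fin n → ℝ))) := by
  intro F hF
  obtain ⟨r, hr, rfl⟩ := IsFacet.exists_eq_tightOn h₀ hF
  simpa using ⟨r.1, r.2, hr, rfl⟩

theorem facetCount_le {S S₀ : IneqSystem n}
    (h₀ : ∀ r ∈ S₀, ∀ x ∈ IneqSystem.region (S ++ S₀), rdot r.1 x = r.2) :
    facetCount (IneqSystem.region (S ++ S₀)) ≤ S.length := by
  refine (Set.ncard_le_ncard (facets_subset h₀) (Finset.finite_toSet _)).trans ?_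
  rw [Set.ncard_coe_finset]
  exact (List.toFinset_card_le _).trans (by simp)

/-- `Set.ncard` is `0` on infinite sets, so a lower bound for `facetCount` needs finiteness. -/
theorem finite_facets (S : IneqSystem n) : {F | IsFacet S.region F}.Finite := by
  have := facets_subset (S := S) (S₀ := []) (by simp)
  rw [List.append_nil] at this
  exact (Finset.finite_toSet _).subset this

theorem finrank_inf_ker_add_one {W : Submodule ℝ (Fin n → ℝ)} {f : (Fin n → ℝ) →ₗ[ℝ] ℝ}
    (h : ∃ v ∈ W, f v ≠ 0) :
    Module.finrank ℝ (W ⊓ LinearMap.ker f : Submodule ℝ (Fin n → ℝ)) + 1 = Module.finrank ℝ W := by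
  obtain ⟨v, hv, hfv⟩ := h
  have h1 : f ∘ₗ W.subtype ≠ 0 := fun h0 => hfv (by simpa using LinearMap.congr_fun h0 ⟨v, hv⟩)
  have h2 := Module.Dual.finrank_ker_add_one_of_ne_zero (f := f ∘ₗ W.subtype) h1
  rw [LinearMap.ker_comp] at h2
  rw [← h2, ← Submodule.finrank_map_subtype_eq W, Submodule.map_comap_subtype]

theorem Irredundant.exists_get {cs : List (Constraint n)} (h : Irredundant cs)
    (i : Fin cs.length) :
    ∃ x, (∀ j, j ≠ i → (cs.get j).Holds x) ∧ ¬ (cs.get i).Holds x := by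
  obtain ⟨x, h1, h2⟩ := h (cs.take i) (cs.get i) (cs.drop (i + 1)) (by simp)
  refine ⟨x, fun j hj => h1 _ ?_, h2⟩
  rw [List.mem_append]
  rcases lt_or_gt_of_ne (Fin.val_ne_of_ne hj) with hlt | hlt
  · left
    rw [List.mem_take_iff_getElem]
    exact ⟨j, by have := j.2; omega, rfl⟩
  · right
    rw [List.mem_drop_iff_getElem]
    exact ⟨j - (i + 1), by have := j.2; omega, by simp; congr 1; omega⟩

/-- In an irredundant description of a nonempty polyhedron, different inequalities that are not
implicit equations define different facets. -/
theorem Irredundant.ncard_le_facetCount {cs : List (Constraint n)} (hirr : Irredundant cs)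
    (hne : (toSystem cs).region.Nonempty)
    (hstrict : ∀ c ∈ cs, c.2 = false → ∃ x ∈ (toSystem cs).region, rdot c.1.1 x < c.1.2) :
    {i : Fin cs.length | (cs.get i).2 = false}.ncard ≤ facetCount (toSystem cs).region := by
  set Q := (toSystem cs).region with hQ
  have hmem : ∀ x, x ∈ Q ↔ ∀ i, (cs.get i).Holds x := fun x => by
    rw [hQ, mem_region_toSystem, List.forall_mem_iff_get]
  obtain ⟨x₀, hx₀, hs⟩ := exists_forall_strict (IneqSystem.convex_region _) hne
    (fun c : Constraint n => c.1) (fun c => c.2 = true) cs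
    (fun c hc x hx => (mem_region_toSystem.1 hx c hc).1) fun c hc => by
      cases h : c.2
      · exact Or.inr (hstrict c hc h)
      · exact Or.inl rfl
  -- The segment from the relatively interior point `x₀` to a point `z` that violates only
  -- constraint `i` meets the hyperplane of `i` at a point where all other proper inequalities are
  -- strict.
  have hpt : ∀ i, (cs.get i).2 = false → ∃ y ∈ Q, rdot (cs.get i).1.1 y = (cs.get i).1.2 ∧
      ∀ j, j ≠ i → (cs.get j).2 = false → rdot (cs.get j).1.1 y < (cs.get j).1.2 := by
    intro i hi
    obtain ⟨z, hz, hzi⟩ := hirr.exists_get i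
    have hzi' : ((cs.get i).1.2 : ℝ) < rdot (cs.get i).1.1 z := by
      by_contra hcon
      exact hzi ⟨not_lt.1 hcon, fun h => absurd (hi.symm.trans h) (by simp)⟩
    have hxi := (hs (cs.get i) (List.get_mem _ _)).resolve_left (by rw [hi]; simp)
    obtain ⟨t, ht0, ht1, ht⟩ : ∃ t : ℝ, 0 < t ∧ t < 1 ∧
        t * (rdot (cs.get i).1.1 z - rdot (cs.get i).1.1 x₀) =
          (cs.get i).1.2 - rdot (cs.get i).1.1 x₀ := by
      have hpos : 0 < rdot (cs.get i).1.1 z - rdot (cs.get i).1.1 x₀ := by linarith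
      refine ⟨((cs.get i).1.2 - rdot (cs.get i).1.1 x₀) /
        (rdot (cs.get i).1.1 z - rdot (cs.get i).1.1 x₀), div_pos (by linarith) hpos, ?_, ?_⟩
      · rw [div_lt_one hpos]; linarith
      · rw [div_mul_cancel₀ _ hpos.ne']
    have hval : ∀ a : Fin n → ℤ, rdot a (x₀ + t • (z - x₀)) =
        rdot a x₀ + t * (rdot a z - rdot a x₀) := fun a => by
      rw [map_add, map_smul, map_sub, smul_eq_mul]
    have hyi : rdot (cs.get i).1.1 (x₀ + t • (z - x₀)) = (cs.get i).1.2 := by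
      rw [hval, ht]; ring
    refine ⟨x₀ + t • (z - x₀), ?_, hyi, fun j hj hjf => ?_⟩
    · rw [hmem]
      intro j
      by_cases hj : j = i
      · subst hj
        exact ⟨hyi.le, fun _ => hyi⟩
      · have h1 := hz j hj
        have h2 := (hmem x₀).1 hx₀ j
        refine ⟨?_, fun he => ?_⟩
        · rw [hval]
          nlinarith [h1.1, h2.1]
        · rw [hval, h1.2 he, h2.2 he]
          ring
    · have h1 := (hz j hj).1
      have h2 := (hs (cs.get j) (List.get_mem _ _)).resolve_left (by rw [hjf]; simp)
      rw [hval]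
      nlinarith
  refine Set.ncard_le_ncard_of_injOn (fun i => tightOn Q (cs.get i).1) ?_ ?_ (finite_facets _)
  · intro i hi
    obtain ⟨y, hyQ, hyi, hy⟩ := hpt i hi
    have hxi := (hs (cs.get i) (List.get_mem _ _)).resolve_left
      (by rw [show (cs.get i).2 = false from hi]; simp)
    refine ⟨⟨y, hyQ, hyi⟩, fun _ => ⟨(rdot (cs.get i).1.1).toContinuousLinearMap, ?_⟩, ?_⟩
    · ext x
      constructor
      · rintro ⟨hx, hxe⟩
        exact ⟨hx, fun w hw => (((hmem w).1 hw i).1.trans hxe.ge :)⟩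
      · rintro ⟨hx, hxm⟩
        have h1 := hxm y hyQ
        simp only [LinearMap.coe_toContinuousLinearMap', hyi] at h1
        exact ⟨hx, le_antisymm ((hmem x).1 hx i).1 h1⟩
    -- At `y` only constraint `i` and the equations are tight, so every direction of the polyhedron
    -- in the kernel of row `i` can be followed a little within the face. The face thus has
    -- codimension one.
    · have h1 : vectorSpan ℝ (tightOn Q (cs.get i).1) =
          vectorSpan ℝ Q ⊓ LinearMap.ker (rdot (cs.get i).1.1) := by
        refine le_antisymm (le_inf (vectorSpan_mono ℝ fun x hx => hx.1)
          (vectorSpan_le_of_forall_sub_mem fun x hx y hy => ?_)) ?_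
        · rw [LinearMap.mem_ker, map_sub, hx.2, hy.2, sub_self]
        · rintro v ⟨hv, hvi⟩
          have hve : ∀ j, (cs.get j).2 = true → rdot (cs.get j).1.1 v = 0 := fun j hj => by
            have : vectorSpan ℝ Q ≤ LinearMap.ker (rdot (cs.get j).1.1) :=
              vectorSpan_le_of_forall_sub_mem fun x hx y hy => by
                rw [LinearMap.mem_ker, map_sub, ((hmem x).1 hx j).2 hj, ((hmem y).1 hy j).2 hj,
                  sub_self]
            exact this hv
          obtain ⟨ε, hε, h⟩ := exists_pos_forall_le (fun j => (cs.get j).1)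
            (List.finRange cs.length) y v fun j _ => by
              by_cases hj : j = i
              · subst hj; exact Or.inl ⟨hvi, hyi.le⟩
              · cases hjf : (cs.get j).2
                · exact Or.inr (hy j hj hjf)
                · exact Or.inl ⟨hve j hjf, ((hmem y).1 hyQ j).1⟩
          have hin : y + ε • v ∈ tightOn Q (cs.get i).1 := by
            refine ⟨(hmem _).2 fun j => ⟨h j (List.mem_finRange j), fun hj => ?_⟩, ?_⟩
            · rw [map_add, map_smul, hve j hj, smul_zero, add_zero]
              exact ((hmem y).1 hyQ j).2 hj
            · rw [map_add, map_smul, LinearMap.mem_ker.1 hvi, smul_zero, add_zero, hyi]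
          have h2 := vsub_mem_vectorSpan ℝ hin (show y ∈ tightOn Q (cs.get i).1 from ⟨hyQ, hyi⟩)
          rw [vsub_eq_sub, add_sub_cancel_left] at h2
          have h3 := Submodule.smul_mem _ ε⁻¹ h2
          rwa [smul_smul, inv_mul_cancel₀ hε.ne', one_smul] at h3
      rw [affDim, h1]
      refine finrank_inf_ker_add_one ⟨y - x₀, vsub_mem_vectorSpan ℝ hyQ hx₀, ?_⟩
      rw [map_sub, hyi]
      linarith
  · intro i hi j hj hij
    obtain ⟨y, hyQ, hyi, hy⟩ := hpt i hi
    by_contra hne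
    have h1 : y ∈ tightOn Q (cs.get j).1 := by
      have : y ∈ tightOn Q (cs.get i).1 := ⟨hyQ, hyi⟩
      exact (congrArg (y ∈ ·) hij).mp this
    exact (hy j (Ne.symm hne) hj).ne h1.2

/-- The functionals of the equations are linearly independent. Take a point that violates only
equation `i` and subtract a solution: the other equations vanish on the difference, and row `i`
would too if it lay in their span. -/
theorem Irredundant.ncard_eq_le {cs : List (Constraint n)} (hirr : Irredundant cs)
    (hne : (toSystem cs).region.Nonempty) :
    {i : Fin cs.length | (cs.get i).2 = true}.ncard ≤ n := by
  classical
  obtain ⟨x₀, hx₀⟩ := hne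
  rw [mem_region_toSystem, List.forall_mem_iff_get] at hx₀
  have hli : LinearIndependent ℝ
      (fun i : {i : Fin cs.length | (cs.get i).2 = true} => rdot (cs.get i).1.1) := by
    rw [linearIndependent_iff_notMem_span]
    intro i hi
    obtain ⟨x, hx, hxi⟩ := hirr.exists_get i
    refine hxi ?_
    have h1 : Submodule.span ℝ ((fun i : {i : Fin cs.length | (cs.get i).2 = true} =>
        rdot (cs.get i).1.1) '' (Set.univ \ {i})) ≤
        LinearMap.ker (Module.Dual.eval ℝ (Fin n → ℝ) (x - x₀)) := by
      rw [Submodule.span_le]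
      rintro _ ⟨j, hj, rfl⟩
      have hj' : (j : Fin cs.length) ≠ i := fun h => hj.2 (Subtype.ext h)
      simp only [SetLike.mem_coe, LinearMap.mem_ker, Module.Dual.eval_apply]
      rw [map_sub, (hx j hj').2 j.2, (hx₀ j).2 j.2, sub_self]
    have h2 := h1 hi
    simp only [LinearMap.mem_ker, Module.Dual.eval_apply] at h2
    rw [map_sub, sub_eq_zero, (hx₀ i).2 i.2] at h2
    exact ⟨h2.le, fun _ => h2⟩
  have h3 := hli.fintype_card_le_finrank
  rw [Subspace.dual_finrank_eq, Module.finrank_fin_fun] at h3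
  rwa [← Nat.card_coe_set_eq, Nat.card_eq_fintype_card]

theorem Irredundant.affineSpan_ne_top {cs : List (Constraint n)} (hirr : Irredundant cs)
    (hne : (toSystem cs).region.Nonempty) {i : Fin cs.length} (hi : (cs.get i).2 = true) :
    affineSpan ℝ (toSystem cs).region ≠ ⊤ := by
  intro htop
  have hmem : ∀ x, x ∈ (toSystem cs).region ↔ ∀ i, (cs.get i).Holds x := fun x => by
    rw [mem_region_toSystem, List.forall_mem_iff_get]
  have h1 : vectorSpan ℝ (toSystem cs).region = ⊤ := by
    rw [← direction_affineSpan, htop, AffineSubspace.direction_top]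
  have h2 : vectorSpan ℝ (toSystem cs).region ≤ LinearMap.ker (rdot (cs.get i).1.1) :=
    vectorSpan_le_of_forall_sub_mem fun x hx y hy => by
      rw [LinearMap.mem_ker, map_sub, ((hmem x).1 hx i).2 hi, ((hmem y).1 hy i).2 hi, sub_self]
  obtain ⟨x₀, hx₀⟩ := hne
  obtain ⟨x, -, hxi⟩ := hirr.exists_get i
  have h3 : x - x₀ ∈ LinearMap.ker (rdot (cs.get i).1.1) := h2 (h1 ▸ Submodule.mem_top)
  rw [LinearMap.mem_ker, map_sub, sub_eq_zero, ((hmem x₀).1 hx₀ i).2 hi] at h3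
  exact hxi ⟨h3.le, fun _ => h3⟩

theorem IneqSystem.region_trimmed {S : IneqSystem n} (h : S.region.Nonempty) :
    (toSystem S.trimmed).region = S.region := by
  rw [trimmed, feasible_iff.2 h, cond_true, (prune_spec _).2.2, region_flagged]

-- Proper inequalities inject into the facets. Implicit equations number at most `n`, and a single
-- irredundant one already prevents full dimension. An empty polyhedron contributes nothing, which
-- is why its trimmed list is empty.
open Classical in
theorem IneqSystem.length_trimmed_le (S : IneqSystem n) : S.trimmed.length ≤
    facetCount S.region + if S.region.Nonempty ∧ affineSpan ℝ S.region ≠ ⊤ then n else 0 := by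
  by_cases hne : S.region.Nonempty
  swap
  · rw [← feasible_iff, Bool.not_eq_true] at hne
    simp [trimmed, hne]
  have hreg := region_trimmed hne
  have hirr : Irredundant S.trimmed := by
    rw [trimmed, feasible_iff.2 hne, cond_true]
    exact (prune_spec _).1
  have hsub : ∀ c ∈ S.trimmed, c ∈ flagged S := by
    rw [trimmed, feasible_iff.2 hne, cond_true]
    exact (prune_spec _).2.1
  have hne' : (toSystem S.trimmed).region.Nonempty := hreg ▸ hne
  have h1 := hirr.ncard_le_facetCount hne' fun c hc hcf => by
    obtain ⟨r, hr, rfl⟩ := List.mem_map.1 (hsub c hc)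
    rw [hreg]
    exact strictFeasible_iff.1 (by simpa using hcf)
  have h2 : {i : Fin S.trimmed.length | (S.trimmed.get i).2 = false}.ncard +
      {i : Fin S.trimmed.length | (S.trimmed.get i).2 = true}.ncard = S.trimmed.length := by
    have := Set.ncard_add_ncard_compl {i : Fin S.trimmed.length | (S.trimmed.get i).2 = false}
    rw [Nat.card_eq_fintype_card, Fintype.card_fin] at this
    refine Eq.trans ?_ this
    congr 2
    ext i
    simp
  rw [← h2, ← hreg]
  refine add_le_add h1 ?_
  split_ifs with hif
  · exact hirr.ncard_eq_le hne'
  · rw [Nat.le_zero, Set.ncard_eq_zero]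
    ext i
    simp only [Set.mem_ofPred_eq, Set.mem_empty_iff_false, iff_false]
    exact fun hi => hif ⟨hne', hirr.affineSpan_ne_top hne' hi⟩

end Facets

/-! ### Sets that are periodic away from finitely many hyperplanes -/

section Tame

variable {d m : ℕ}

theorem rdot_intCast (a x : Fin d → ℤ) : rdot a (fun i => (x i : ℝ)) = ((a ⬝ᵥ x : ℤ) : ℝ) := by
  simp [rdot_apply, dotProduct]

theorem comb_dotProduct (p c : ℤ) (r q x : Fin d → ℤ) :
    comb p c r q ⬝ᵥ x = p * (r ⬝ᵥ x) - c * (q ⬝ᵥ x) := by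
  simp only [dotProduct, comb, Finset.mul_sum, ← Finset.sum_sub_distrib]
  exact Finset.sum_congr rfl fun i _ => by ring

theorem dotProduct_consVec (a : Fin (d + 1) → ℤ) (z : ℤ) (x : Fin d → ℤ) :
    a ⬝ᵥ (Fin.cons z x : Fin (d + 1) → ℤ) = a 0 * z + Fin.tail a ⬝ᵥ x := by
  simp [dotProduct, Fin.sum_univ_succ, Fin.tail]

theorem dvd_dotProduct_sub {K : ℤ} {x y : Fin d → ℤ} (h : ∀ i, K ∣ y i - x i) (a : Fin d → ℤ) :
    K ∣ a ⬝ᵥ y - a ⬝ᵥ x := by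
  rw [← dotProduct_sub]
  exact Finset.dvd_sum fun i _ => Dvd.dvd.mul_left (h i) _

/-- Two integers that agree or lie on the same side of `[-M, M]`. -/
def SameClass (M : ℕ) (u v : ℤ) : Prop := u = v ∨ ((M : ℤ) < u ∧ (M : ℤ) < v) ∨ (u < -M ∧ v < -M)

theorem SameClass.mono {M M' : ℕ} (h : M ≤ M') {u v : ℤ} (huv : SameClass M' u v) :
    SameClass M u v := by
  unfold SameClass at *
  omega

/-- Multiplication by `c` stretches `[-M, M]` by `|c|` and, for negative `c`, exchanges the sides.
-/
theorem SameClass.of_mul {M : ℕ} {c u v : ℤ} (hc : c ≠ 0)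
    (h : SameClass (c.natAbs * M) (c * u) (c * v)) : SameClass M u v := by
  have hM : ((c.natAbs * M : ℕ) : ℤ) = |c| * M := by push_cast; rfl
  unfold SameClass at *
  rw [hM] at h
  rcases lt_or_gt_of_ne hc with h0 | h0
  · rw [abs_of_neg h0] at h
    rcases h with h | ⟨h1, h2⟩ | ⟨h1, h2⟩
    · exact Or.inl (mul_left_cancel₀ hc h)
    · right; right
      constructor <;> nlinarith
    · right; left
      constructor <;> nlinarith
  · rw [abs_of_pos h0] at h
    rcases h with h | ⟨h1, h2⟩ | ⟨h1, h2⟩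
    · exact Or.inl (mul_left_cancel₀ hc h)
    · right; left
      constructor <;> nlinarith
    · right; right
      constructor <;> nlinarith

/-- Linear equations, normals of hyperplanes, the thickness of the hyperplanes, and a period. -/
abbrev Arr (d : ℕ) : Type := List (Fin d → ℤ) × List (Fin d → ℤ) × ℕ × ℕ

/-- The set `X` satisfies the equations, and membership in `X` of a solution of the equations
depends only on its residues and on its position relative to the thick hyperplanes. -/
def Tame (s : Arr d) (X : Set (Fin d → ℤ)) : Prop :=
  (∀ x ∈ X, ∀ e ∈ s.1, e ⬝ᵥ x = 0) ∧
    ∀ x ∈ X, ∀ y, (∀ e ∈ s.1, e ⬝ᵥ y = 0) → (∀ i, (s.2.2.2 : ℤ) ∣ y i - x i) →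
      (∀ a ∈ s.2.1, SameClass s.2.2.1 (a ⬝ᵥ x) (a ⬝ᵥ y)) → y ∈ X

/-- The projection along the first coordinate. -/
def proj (X : Set (Fin (d + 1) → ℤ)) : Set (Fin d → ℤ) :=
    {x | ∃ z, (Fin.cons z x : Fin (d + 1) → ℤ) ∈ X}

/-- The vectors that involve the first coordinate. -/
def withHead (A : List (Fin (d + 1) → ℤ)) : List (Fin (d + 1) → ℤ) :=
    A.filter fun a => !isZero (a 0)

/-- Elimination of the first coordinate by means of an equation. -/
def Arr.substStep (s : Arr (d + 1)) (p : Fin (d + 1) → ℤ) : Arr d :=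
  (s.1.map fun r => comb (p 0) (r 0) (Fin.tail r) (Fin.tail p),
    s.2.1.map fun r => comb (p 0) (r 0) (Fin.tail r) (Fin.tail p),
    (p 0).natAbs * s.2.2.1, (p 0).natAbs * s.2.2.2)

/-- The normals left after elimination of the first coordinate by pairwise combination. -/
def elimNormals (A : List (Fin (d + 1) → ℤ)) : List (Fin d → ℤ) :=
  (A.filter fun a => isZero (a 0)).map (fun a => Fin.tail a) ++
    (withHead A).flatMap fun p =>
      (withHead A).map fun q => comb (p 0) (q 0) (Fin.tail q) (Fin.tail p)

/-- The product of the nonzero first coordinates. -/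
def headProd (A : List (Fin (d + 1) → ℤ)) : ℕ := ((withHead A).map fun a => (a 0).natAbs).prod

/-- Elimination of the first coordinate when no equation involves it. -/
def Arr.pairStep (s : Arr (d + 1)) : Arr d :=
  (s.1.map fun r => Fin.tail r, elimNormals s.2.1,
    (2 * s.2.2.1 + s.2.2.2) * headProd s.2.1 ^ 2, headProd s.2.1 * s.2.2.2)

/-- Elimination of the first coordinate. -/
def Arr.step (s : Arr (d + 1)) : Arr d :=
  match withHead s.1 with
  | [] => s.pairStep
  | p :: _ => s.substStep p

theorem mem_withHead {A : List (Fin (d + 1) → ℤ)} {a : Fin (d + 1) → ℤ} :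
    a ∈ withHead A ↔ a ∈ A ∧ a 0 ≠ 0 := by
  rw [withHead, List.mem_filter, not_isZero_iff]

/-- The equation `p` determines `z` from `x`. Since `y` and `x` agree modulo `p 0` times the period,
the value of `z` over `y` is integral and congruent to the old one. Multiplying a normal by `p 0`
and substituting gives the combined normal, hence the factor in the thickness. -/
theorem Tame.substStep {s : Arr (d + 1)} {X : Set (Fin (d + 1) → ℤ)} (h : Tame s X)
    {p : Fin (d + 1) → ℤ} (hp : p ∈ s.1) (hp0 : p 0 ≠ 0) : Tame (s.substStep p) (proj X) := by
  obtain ⟨heq, h⟩ := h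
  simp only [Tame, Arr.substStep, List.mem_map, forall_exists_index, and_imp,
    forall_apply_eq_imp_iff₂, comb_dotProduct]
  refine ⟨?_, ?_⟩
  · rintro x ⟨z, hz⟩ e he
    have h1 := heq _ hz e he
    have h2 := heq _ hz p hp
    rw [dotProduct_consVec] at h1 h2
    linear_combination p 0 * h1 - e 0 * h2
  · rintro x ⟨z, hz⟩ y hye hyK hyA
    have hdvd : ((p 0).natAbs : ℤ) * s.2.2.2 ∣ Fin.tail p ⬝ᵥ y - Fin.tail p ⬝ᵥ x :=
      dvd_dotProduct_sub (fun i => by exact_mod_cast hyK i) _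
    obtain ⟨u, hu⟩ : p 0 * s.2.2.2 ∣ Fin.tail p ⬝ᵥ y - Fin.tail p ⬝ᵥ x :=
      (mul_dvd_mul_right (Int.dvd_natAbs.2 dvd_rfl) _).trans hdvd
    have hpz := heq _ hz p hp
    rw [dotProduct_consVec] at hpz
    have hpz' : p 0 * (z - s.2.2.2 * u) + Fin.tail p ⬝ᵥ y = 0 := by
      linear_combination hpz + hu
    refine ⟨z - s.2.2.2 * u, h _ hz _ (fun e he => ?_) (fun i => ?_) fun a ha => ?_⟩
    · rw [dotProduct_consVec]
      have := hye e he
      refine mul_left_cancel₀ hp0 ?_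
      linear_combination e 0 * hpz' + this
    · refine Fin.cases ?_ (fun j => ?_) i
      · rw [Fin.cons_zero, Fin.cons_zero, sub_sub_cancel_left]
        exact (dvd_mul_right _ _).neg_right
      · rw [Fin.cons_succ, Fin.cons_succ]
        refine dvd_trans ?_ (hyK j)
        push_cast
        exact dvd_mul_left _ _
    · rw [dotProduct_consVec, dotProduct_consVec]
      refine SameClass.of_mul hp0 ?_
      have e1 : p 0 * (a 0 * z + Fin.tail a ⬝ᵥ x) =
          p 0 * (Fin.tail a ⬝ᵥ x) - a 0 * (Fin.tail p ⬝ᵥ x) := by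
        linear_combination a 0 * hpz
      have e2 : p 0 * (a 0 * (z - s.2.2.2 * u) + Fin.tail a ⬝ᵥ y) =
          p 0 * (Fin.tail a ⬝ᵥ y) - a 0 * (Fin.tail p ⬝ᵥ y) := by
        linear_combination a 0 * hpz'
      rw [e1, e2]
      exact hyA a ha

theorem headProd_pos (A : List (Fin (d + 1) → ℤ)) : 0 < headProd A := by
  refine List.prod_pos fun c hc => ?_
  obtain ⟨a, ha, rfl⟩ := List.mem_map.1 hc
  exact Int.natAbs_pos.2 (mem_withHead.1 ha).2

theorem dvd_headProd {A : List (Fin (d + 1) → ℤ)} {a : Fin (d + 1) → ℤ} (ha : a ∈ withHead A) :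
    (a 0).natAbs ∣ headProd A := List.dvd_prod (List.mem_map.2 ⟨a, ha, rfl⟩)

theorem natAbs_le_headProd {A : List (Fin (d + 1) → ℤ)} {a : Fin (d + 1) → ℤ}
    (ha : a ∈ withHead A) :
    |a 0| ≤ headProd A := by
  have := Nat.le_of_dvd (headProd_pos A) (dvd_headProd ha)
  rw [Int.abs_eq_natAbs]
  exact_mod_cast this

theorem abs_sub_lt_abs {v w : ℤ} (h1 : 1 ≤ |w|) (h2 : |w| < |v|) (h : 0 ≤ v * w) :
    |v - w| < |v| := by
  rcases mul_nonneg_iff.1 h with ⟨hv, hw⟩ | ⟨hv, hw⟩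
  · rw [abs_of_nonneg hv, abs_of_nonneg hw] at *
    rw [abs_of_nonneg] <;> linarith
  · rw [abs_of_nonpos hv, abs_of_nonpos hw] at *
    rw [abs_of_nonpos] <;> linarith

/-- Moving a point of the fibre by multiples of the period, one comes close to a hyperplane. -/
theorem Tame.exists_near {s : Arr (d + 1)} {X : Set (Fin (d + 1) → ℤ)} (h : Tame s X)
    (hK : 0 < s.2.2.2) (h0 : ∀ e ∈ s.1, e 0 = 0) {b : Fin (d + 1) → ℤ} (hb : b ∈ withHead s.2.1)
    (x : Fin d → ℤ) (k : ℕ) : ∀ z : ℤ, (Fin.cons z x : Fin (d + 1) → ℤ) ∈ X →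
      (b ⬝ᵥ (Fin.cons z x : Fin (d + 1) → ℤ)).natAbs ≤ k →
      ∃ z₁ : ℤ, (Fin.cons z₁ x : Fin (d + 1) → ℤ) ∈ X ∧ ∃ p ∈ withHead s.2.1,
        |p ⬝ᵥ (Fin.cons z₁ x : Fin (d + 1) → ℤ)| ≤ (s.2.2.1 + s.2.2.2) * headProd s.2.1 := by
  set M := s.2.2.1
  set K := s.2.2.2
  set H := headProd s.2.1
  have hH : (1 : ℤ) ≤ H := by exact_mod_cast headProd_pos s.2.1
  have hK' : (1 : ℤ) ≤ K := by exact_mod_cast hK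
  have hM' : (0 : ℤ) ≤ M := by positivity
  have hKH : (K : ℤ) * 1 ≤ K * H := mul_le_mul_of_nonneg_left hH (by positivity)
  have hMH : (M : ℤ) * 1 ≤ M * H := mul_le_mul_of_nonneg_left hH hM'
  induction k using Nat.strong_induction_on with
  | _ k ih =>
    intro z hz hk
    by_cases hnear : ∃ p ∈ withHead s.2.1,
        |p ⬝ᵥ (Fin.cons z x : Fin (d + 1) → ℤ)| ≤ (M + K) * H
    · exact ⟨z, hz, hnear⟩
    push Not at hnear
    -- A shift of `z` by the period changes each `a ⬝ v` by at most `K H`. All relevant values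
    -- exceed `(M + K) H` in absolute value, so none of them enters `[-M, M]`.
    have hmove : ∀ t : ℤ, |t| = K → (Fin.cons (z + t) x : Fin (d + 1) → ℤ) ∈ X := by
      intro t ht
      refine h.2 _ hz _ (fun e he => ?_) (fun i => ?_) fun a ha => ?_
      · have := h.1 _ hz e he
        rw [dotProduct_consVec, h0 e he] at this ⊢
        linarith
      · refine Fin.cases ?_ (fun j => ?_) i
        · rw [Fin.cons_zero, Fin.cons_zero, add_sub_cancel_left]
          exact (dvd_abs _ _).1 (by rw [ht])
        · rw [Fin.cons_succ, Fin.cons_succ, sub_self]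
          exact dvd_zero _
      · by_cases ha0 : a 0 = 0
        · left
          rw [dotProduct_consVec, dotProduct_consVec, ha0, zero_mul, zero_mul]
        · have hmem := mem_withHead.2 ⟨ha, ha0⟩
          have h1 := hnear a hmem
          have h2 : |a 0 * t| ≤ K * H := by
            rw [abs_mul, ht, mul_comm]
            exact mul_le_mul_of_nonneg_left (natAbs_le_headProd hmem) (by positivity)
          have h3 : a ⬝ᵥ (Fin.cons (z + t) x : Fin (d + 1) → ℤ) =
              a ⬝ᵥ (Fin.cons z x : Fin (d + 1) → ℤ) + a 0 * t := by
            rw [dotProduct_consVec, dotProduct_consVec]; ring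
          rw [h3]
          right
          rw [abs_le] at h2
          rw [add_mul, lt_abs] at h1
          change (((M : ℤ) < _ ∧ _) ∨ _)
          rcases h1 with h1 | h1
          · left; constructor <;> linarith
          · right; constructor <;> linarith
    have hb0 := (mem_withHead.1 hb).2
    have h1 := hnear b hb
    have h2 : |b 0 * K| ≤ K * H := by
      rw [abs_mul, Nat.abs_cast, mul_comm]
      exact mul_le_mul_of_nonneg_left (natAbs_le_headProd hb) (by positivity)
    have h3 : 1 ≤ |b 0 * K| := by
      rw [abs_mul, Nat.abs_cast]
      have := Int.one_le_abs hb0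
      nlinarith
    -- The sign of the shift is chosen to move toward the hyperplane of `b`. The step is shorter
    -- than the distance and cannot overshoot, so the value decreases in absolute value.
    obtain ⟨t, ht, hlt⟩ : ∃ t : ℤ, |t| = K ∧
        |b ⬝ᵥ (Fin.cons z x : Fin (d + 1) → ℤ) + b 0 * t| <
          |b ⬝ᵥ (Fin.cons z x : Fin (d + 1) → ℤ)| := by
      have h4 : |b 0 * K| < |b ⬝ᵥ (Fin.cons z x : Fin (d + 1) → ℤ)| := by nlinarith
      rcases le_or_gt 0 ((b ⬝ᵥ (Fin.cons z x : Fin (d + 1) → ℤ)) * (b 0 * K)) with hs | hs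
      · refine ⟨-K, by simp, ?_⟩
        rw [mul_neg, ← sub_eq_add_neg]
        exact abs_sub_lt_abs h3 h4 hs
      · refine ⟨K, by simp, ?_⟩
        have := abs_sub_lt_abs (v := b ⬝ᵥ (Fin.cons z x : Fin (d + 1) → ℤ)) (w := -(b 0 * K))
          (by rwa [abs_neg]) (by rwa [abs_neg])
          (by rw [mul_neg]; exact (neg_pos.2 hs).le)
        rwa [sub_neg_eq_add] at this
    refine ih (b ⬝ᵥ (Fin.cons (z + t) x : Fin (d + 1) → ℤ)).natAbs ?_ (z + t) (hmove t ht) le_rfl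
    have h5 : b ⬝ᵥ (Fin.cons (z + t) x : Fin (d + 1) → ℤ) =
        b ⬝ᵥ (Fin.cons z x : Fin (d + 1) → ℤ) + b 0 * t := by
      rw [dotProduct_consVec, dotProduct_consVec]; ring
    rw [h5]
    exact (Int.ofNat_lt.1 (by rwa [← Int.abs_eq_natAbs, ← Int.abs_eq_natAbs])).trans_le hk

/-- Choose the point over `x` near a hyperplane `p`, and lift `y` so that `p` takes the same value
there. For any other normal `a`, `p 0` times its value is the value of the combined normal plus `a
0` times this common small number, so the class of the combined normal with larger thickness
controls the class of `a`. -/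
theorem Tame.pairStep {s : Arr (d + 1)} {X : Set (Fin (d + 1) → ℤ)} (h : Tame s X)
    (hK : 0 < s.2.2.2) (h0 : ∀ e ∈ s.1, e 0 = 0) : Tame s.pairStep (proj X) := by
  have hH := headProd_pos s.2.1
  have hMle : s.2.2.1 ≤ (2 * s.2.2.1 + s.2.2.2) * headProd s.2.1 ^ 2 := by
    have := Nat.one_le_pow 2 _ hH
    nlinarith
  refine ⟨?_, ?_⟩
  · rintro x ⟨z, hz⟩ e he
    obtain ⟨e, he', rfl⟩ := List.mem_map.1 he
    have := h.1 _ hz e he'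
    rwa [dotProduct_consVec, h0 e he', zero_mul, zero_add] at this
  rintro x ⟨z, hz⟩ y hye hyK hyA
  have hyA0 : ∀ a ∈ s.2.1, a 0 = 0 → SameClass s.2.2.1 (Fin.tail a ⬝ᵥ x) (Fin.tail a ⬝ᵥ y) :=
    fun a ha ha0 => (hyA _ (List.mem_append_left _ (List.mem_map.2
      ⟨a, List.mem_filter.2 ⟨ha, isZero_iff.2 ha0⟩, rfl⟩))).mono hMle
  have hyA1 : ∀ p ∈ withHead s.2.1, ∀ q ∈ withHead s.2.1,
      SameClass ((2 * s.2.2.1 + s.2.2.2) * headProd s.2.1 ^ 2)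
        (p 0 * (Fin.tail q ⬝ᵥ x) - q 0 * (Fin.tail p ⬝ᵥ x))
        (p 0 * (Fin.tail q ⬝ᵥ y) - q 0 * (Fin.tail p ⬝ᵥ y)) := fun p hp q hq => by
    have := hyA _ (List.mem_append_right _ (List.mem_flatMap.2
      ⟨p, hp, List.mem_map.2 ⟨q, hq, rfl⟩⟩))
    rwa [comb_dotProduct, comb_dotProduct] at this
  have hyE : ∀ z' : ℤ, ∀ e ∈ s.1, e ⬝ᵥ (Fin.cons z' y : Fin (d + 1) → ℤ) = 0 := fun z' e he => by
    rw [dotProduct_consVec, h0 e he, zero_mul, zero_add]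
    exact hye _ (List.mem_map.2 ⟨e, he, rfl⟩)
  have hyK' : ∀ i, ((headProd s.2.1 : ℤ) * s.2.2.2) ∣ y i - x i := fun i => by
    exact_mod_cast hyK i
  have hdvd : ∀ z z' : ℤ, (s.2.2.2 : ℤ) ∣ z' - z → ∀ i, (s.2.2.2 : ℤ) ∣
      (Fin.cons z' y : Fin (d + 1) → ℤ) i - (Fin.cons z x : Fin (d + 1) → ℤ) i :=
    fun z z' hzz i => by
      refine Fin.cases (by simpa using hzz) (fun j => ?_) i
      simpa using (dvd_mul_left _ _).trans (hyK' j)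
  by_cases hA : withHead s.2.1 = []
  · refine ⟨z, h.2 _ hz _ (hyE z) (hdvd z z (by simp)) fun a ha => ?_⟩
    have ha0 : a 0 = 0 := by
      by_contra ha0
      have := mem_withHead.2 ⟨ha, ha0⟩
      simp [hA] at this
    rw [dotProduct_consVec, dotProduct_consVec, ha0, zero_mul, zero_add, zero_add]
    exact hyA0 a ha ha0
  obtain ⟨b, hb⟩ := List.exists_mem_of_ne_nil _ hA
  obtain ⟨z₁, hz₁, p, hp, hnear⟩ := h.exists_near hK h0 hb x _ z hz le_rfl
  have hp0 := (mem_withHead.1 hp).2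
  -- The period is enlarged by `headProd` because `p` is not known in advance: every possible `p 0`
  -- divides the product, so the required shift of `z` is a multiple of the old period.
  obtain ⟨c, hc⟩ : p 0 ∣ headProd s.2.1 := by
    have := dvd_headProd hp
    exact Int.natAbs_dvd.1 (by exact_mod_cast this)
  obtain ⟨w, hw⟩ := dvd_dotProduct_sub hyK' (Fin.tail p)
  have hp' : p 0 * (z₁ - s.2.2.2 * (c * w)) + Fin.tail p ⬝ᵥ y = p 0 * z₁ + Fin.tail p ⬝ᵥ x := by
    rw [hc] at hw
    linear_combination hw
  refine ⟨z₁ - s.2.2.2 * (c * w), h.2 _ hz₁ _ (hyE _) (hdvd _ _ ?_) fun a ha => ?_⟩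
  · rw [sub_sub_cancel_left]
    exact (dvd_mul_right _ _).neg_right
  rw [dotProduct_consVec, dotProduct_consVec]
  by_cases ha0 : a 0 = 0
  · rw [ha0, zero_mul, zero_mul, zero_add, zero_add]
    exact hyA0 a ha ha0
  have ha' := mem_withHead.2 ⟨ha, ha0⟩
  rw [dotProduct_consVec] at hnear
  refine SameClass.of_mul hp0 ?_
  have e1 : p 0 * (a 0 * z₁ + Fin.tail a ⬝ᵥ x) =
      (p 0 * (Fin.tail a ⬝ᵥ x) - a 0 * (Fin.tail p ⬝ᵥ x)) +
        a 0 * (p 0 * z₁ + Fin.tail p ⬝ᵥ x) := by ring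
  have e2 : p 0 * (a 0 * (z₁ - s.2.2.2 * (c * w)) + Fin.tail a ⬝ᵥ y) =
      (p 0 * (Fin.tail a ⬝ᵥ y) - a 0 * (Fin.tail p ⬝ᵥ y)) +
        a 0 * (p 0 * z₁ + Fin.tail p ⬝ᵥ x) := by
    rw [← hp']; ring
  rw [e1, e2]
  have hle : |a 0 * (p 0 * z₁ + Fin.tail p ⬝ᵥ x)| ≤
      headProd s.2.1 * ((s.2.2.1 + s.2.2.2) * headProd s.2.1) := by
    rw [abs_mul]
    exact mul_le_mul (natAbs_le_headProd ha') hnear (abs_nonneg _) (by positivity)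
  have hpM : |p 0| * s.2.2.1 ≤ headProd s.2.1 * (s.2.2.1 * headProd s.2.1) := by
    have h1 := natAbs_le_headProd hp
    have h2 : (1 : ℤ) ≤ headProd s.2.1 := by exact_mod_cast hH
    refine mul_le_mul h1 ?_ (by positivity) (by positivity)
    nlinarith
  rw [abs_le] at hle
  have hcls := hyA1 p hp a ha'
  unfold SameClass at hcls ⊢
  have hc1 : (((p 0).natAbs * s.2.2.1 : ℕ) : ℤ) = |p 0| * s.2.2.1 := by push_cast; rfl
  rw [hc1]
  push_cast at hcls
  -- With `H = headProd`, the new thickness is `(M + K) H²`, which absorbs the common summand, plus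
  -- `M H²`, which leaves room for `|p 0| M`.
  have hsum : (2 * (s.2.2.1 : ℤ) + s.2.2.2) * headProd s.2.1 ^ 2 =
      headProd s.2.1 * ((s.2.2.1 + s.2.2.2) * headProd s.2.1) +
        headProd s.2.1 * (s.2.2.1 * headProd s.2.1) := by ring
  rw [hsum] at hcls
  rcases hcls with h1 | ⟨h1, h2⟩ | ⟨h1, h2⟩
  · left; rw [h1]
  · right; left; constructor <;> linarith
  · right; right; constructor <;> linarith

theorem Tame.step {s : Arr (d + 1)} {X : Set (Fin (d + 1) → ℤ)} (h : Tame s X)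
    (hK : 0 < s.2.2.2) : Tame s.step (proj X) := by
  unfold Arr.step
  split
  · rename_i hnil
    refine h.pairStep hK fun e he => ?_
    by_contra he0
    have := mem_withHead.2 ⟨he, he0⟩
    simp [hnil] at this
  · rename_i p l hl
    have hp : p ∈ withHead s.1 := by simp [hl]
    exact h.substStep (mem_withHead.1 hp).1 (mem_withHead.1 hp).2

theorem Arr.step_period_pos {s : Arr (d + 1)} (hK : 0 < s.2.2.2) : 0 < s.step.2.2.2 := by
  unfold Arr.step
  split
  · exact Nat.mul_pos (headProd_pos _) hK
  · rename_i p l hl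
    have hp : p ∈ withHead s.1 := by simp [hl]
    exact Nat.mul_pos (Int.natAbs_pos.2 (mem_withHead.1 hp).2) hK

/-- With `u` normals free of the coordinate and `v` involving it, the pairwise step leaves `u + v²`,
at most `(u + v)²`. -/
theorem Arr.length_step_le (s : Arr (d + 1)) : s.step.2.1.length ≤ s.2.1.length ^ 2 := by
  unfold Arr.step
  split
  · simp only [pairStep, elimNormals, List.length_append, List.length_map, List.length_flatMap,
      List.map_const', List.sum_replicate, smul_eq_mul]
    have h1 : (s.2.1.filter fun a => isZero (a 0)).length + (withHead s.2.1).length =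
        s.2.1.length := by
      rw [withHead, ← List.length_eq_length_filter_add]
    rw [← h1]
    generalize (s.2.1.filter fun a => isZero (a 0)).length = u
    generalize (withHead s.2.1).length = v
    nlinarith [Nat.le_mul_self u]
  · simp only [substStep, List.length_map]
    exact Nat.le_self_pow (by norm_num) _

/-- The equations are eliminated exactly over the reals: every solution of the new ones lifts. This
later bounds the dimension of the final solution space. -/
theorem Arr.exists_of_step {s : Arr (d + 1)} {y : Fin d → ℝ} (h : ∀ e ∈ s.step.1, rdot e y = 0) :
    ∃ z : ℝ, ∀ e ∈ s.1, rdot e (Fin.cons z y) = 0 := by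
  unfold Arr.step at h
  split at h
  · rename_i hnil
    refine ⟨0, fun e he => ?_⟩
    rw [rdot_succ, mul_zero, zero_add]
    exact h _ (List.mem_map.2 ⟨e, he, rfl⟩)
  · rename_i p l hl
    have hp : p ∈ withHead s.1 := by simp [hl]
    have hp0 : (p 0 : ℝ) ≠ 0 := by exact_mod_cast (mem_withHead.1 hp).2
    refine ⟨-rdot (Fin.tail p) y / p 0, fun e he => ?_⟩
    have := h _ (List.mem_map.2 ⟨e, he, rfl⟩)
    rw [rdot_comb] at this
    rw [rdot_succ]
    field_simp
    linarith

end Tame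

/-! ### Elimination of a block of coordinates -/

section Elimination

variable {d m n : ℕ} {α : Type} [Enc α]

@[fun_prop]
theorem PT.withHead {f : α → List (Fin (d + 1) → ℤ)} (hf : PT f) : PT fun a => withHead (f a) :=
  PT.filter (f := fun _ (a : Fin (d + 1) → ℤ) => !SemilinearProj.isZero (a 0)) (by fun_prop) hf

@[fun_prop]
theorem PT.elimNormals {f : α → List (Fin (d + 1) → ℤ)} (hf : PT f) :
    PT fun a => elimNormals (f a) := by
  unfold SemilinearProj.elimNormals
  refine PT.append ?_ ?_
  · exact PT.map (f := fun _ (a : Fin (d + 1) → ℤ) => (Fin.tail a : Fin d → ℤ)) (by fun_prop)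
      (PT.filter (f := fun _ (a : Fin (d + 1) → ℤ) => SemilinearProj.isZero (a 0)) (by fun_prop) hf)
  · refine PT.flatMap (l := fun a => SemilinearProj.withHead (f a))
      (f := fun a (p : Fin (d + 1) → ℤ) => (SemilinearProj.withHead (f a)).map fun q =>
        SemilinearProj.comb (p 0) (q 0) (Fin.tail q) (Fin.tail p)) ?_ (by fun_prop)
    exact PT.map (f := fun (s : α × (Fin (d + 1) → ℤ)) (q : Fin (d + 1) → ℤ) =>
      SemilinearProj.comb (s.2 0) (q 0) (Fin.tail q) (Fin.tail s.2)) (by fun_prop) (by fun_prop)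

@[fun_prop]
theorem PT.headProd {f : α → List (Fin (d + 1) → ℤ)} (hf : PT f) : PT fun a => headProd (f a) := by
  unfold SemilinearProj.headProd
  refine PT.natProd ?_
  exact PT.map (f := fun _ (a : Fin (d + 1) → ℤ) => (a 0).natAbs) (by fun_prop) (by fun_prop)

theorem PT.arrStep : PT (Arr.step (d := d)) := by
  have h := PT.listCases (l := fun s : Arr (d + 1) => SemilinearProj.withHead s.1)
    (f := fun s => s.pairStep) (g := fun (s : Arr (d + 1)) p _ => s.substStep p) (by fun_prop) ?_ ?_
  · refine (congrArg PT (funext fun s => ?_)).mp h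
    unfold Arr.step
    cases SemilinearProj.withHead s.1 <;> rfl
  · have : PT fun s : Arr (d + 1) => s.1.map fun r => (Fin.tail r : Fin d → ℤ) :=
      PT.map (f := fun _ (r : Fin (d + 1) → ℤ) => (Fin.tail r : Fin d → ℤ)) (by fun_prop)
        (by fun_prop)
    unfold Arr.pairStep
    fun_prop
  · have h1 : PT fun s : Arr (d + 1) × (Fin (d + 1) → ℤ) × List (Fin (d + 1) → ℤ) =>
        s.1.1.map fun r => SemilinearProj.comb (s.2.1 0) (r 0) (Fin.tail r) (Fin.tail s.2.1) :=
      PT.map (f := fun (s : Arr (d + 1) × (Fin (d + 1) → ℤ) × List (Fin (d + 1) → ℤ))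
        (r : Fin (d + 1) → ℤ) =>
          SemilinearProj.comb (s.2.1 0) (r 0) (Fin.tail r) (Fin.tail s.2.1))
        (by fun_prop) (by fun_prop)
    have h2 : PT fun s : Arr (d + 1) × (Fin (d + 1) → ℤ) × List (Fin (d + 1) → ℤ) =>
        s.1.2.1.map fun r => SemilinearProj.comb (s.2.1 0) (r 0) (Fin.tail r) (Fin.tail s.2.1) :=
      PT.map (f := fun (s : Arr (d + 1) × (Fin (d + 1) → ℤ) × List (Fin (d + 1) → ℤ))
        (r : Fin (d + 1) → ℤ) =>
          SemilinearProj.comb (s.2.1 0) (r 0) (Fin.tail r) (Fin.tail s.2.1))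
        (by fun_prop) (by fun_prop)
    unfold Arr.substStep
    fun_prop

/-- Elimination of the first `m` coordinates. -/
def Arr.elimAll : (m : ℕ) → Arr (d + m) → Arr d
  | 0, s => s
  | m + 1, s => Arr.elimAll m (Arr.step s)

theorem PT.elimAll : PT (Arr.elimAll (d := d) m) := by
  induction m with
  | zero => exact PT.id
  | succ m ih => exact ih.comp PT.arrStep

/-- The vector with the blocks `x` and `y`. -/
def join {R : Type} : {m : ℕ} → (Fin m → R) → (Fin d → R) → Fin (d + m) → R
  | 0, _, y => y
  | _ + 1, x, y => Fin.cons (x 0) (join (Fin.tail x) y)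

theorem PT.join {f : α → Fin m → ℤ} {g : α → Fin d → ℤ} (hf : PT f) (hg : PT g) :
    PT fun a => join (f a) (g a) := by
  induction m with
  | zero => exact hg
  | succ m ih => exact PT.vecCons (hf.apply 0) (ih (PT.vecTail hf))

theorem exists_join {R : Type} : ∀ {m : ℕ} (v : Fin (d + m) → R), ∃ x y, v = join x y
  | 0, v => ⟨Fin.elim0, v, rfl⟩
  | m + 1, v => by
    obtain ⟨x, y, h⟩ := exists_join (m := m) (Fin.tail v)
    refine ⟨Fin.cons (v 0) x, y, ?_⟩
    rw [join, Fin.cons_zero, Fin.tail_cons, ← h, Fin.cons_self_tail]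

theorem join_injective {R : Type} : ∀ {m : ℕ} {x x' : Fin m → R} {y y' : Fin d → R},
    join x y = join x' y' → x = x' ∧ y = y'
  | 0, _, _, _, _, h => ⟨Subsingleton.elim _ _, h⟩
  | m + 1, x, x', y, y', h => by
    obtain ⟨h1, h2⟩ := Fin.cons_inj.1 h
    obtain ⟨h3, h4⟩ := join_injective h2
    refine ⟨?_, h4⟩
    rw [← Fin.cons_self_tail x, ← Fin.cons_self_tail x', h1, h3]

theorem dotProduct_join : ∀ {m : ℕ} (a x : Fin m → ℤ) (b y : Fin d → ℤ),
    join a b ⬝ᵥ join x y = a ⬝ᵥ x + b ⬝ᵥ y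
  | 0, a, x, b, y => by simp [join]
  | m + 1, a, x, b, y => by
    rw [join, join, dotProduct_consVec, Fin.cons_zero, Fin.tail_cons, dotProduct_join]
    have := dotProduct_consVec a (x 0) (Fin.tail x)
    rw [Fin.cons_self_tail] at this
    rw [this, add_assoc]

theorem rdot_join : ∀ {m : ℕ} (a : Fin m → ℤ) (x : Fin m → ℝ) (b : Fin d → ℤ) (y : Fin d → ℝ),
    rdot (join a b) (join x y) = rdot a x + rdot b y
  | 0, a, x, b, y => by simp [join, rdot_apply]
  | m + 1, a, x, b, y => by
    rw [join, join, rdot_cons, rdot_join]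
    have := rdot_succ a (x 0) (Fin.tail x)
    rw [Fin.cons_self_tail] at this
    rw [this, add_assoc]

theorem forall_of_forall_join {R : Type} (p : R → R → Prop) : ∀ {m : ℕ} {x x' : Fin m → R}
    {y y' : Fin d → R}, (∀ i, p (join x y i) (join x' y' i)) → ∀ i, p (x i) (x' i)
  | 0, _, _, _, _, _ => fun i => i.elim0
  | m + 1, x, x', y, y', h => by
    refine Fin.cases ?_ ?_
    · simpa [join] using h 0
    · exact forall_of_forall_join p (x := Fin.tail x) (x' := Fin.tail x') (y := y) (y' := y')
        fun i => by simpa [join] using h i.succ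

theorem Arr.elimAll_period_pos : ∀ {m : ℕ} {s : Arr (d + m)}, 0 < s.2.2.2 →
    0 < (s.elimAll m).2.2.2
  | 0, _, hK => hK
  | m + 1, _, hK => Arr.elimAll_period_pos (m := m) (Arr.step_period_pos hK)

theorem Tame.elimAll : ∀ {m : ℕ} {s : Arr (d + m)} {X : Set (Fin (d + m) → ℤ)}, Tame s X →
    0 < s.2.2.2 → Tame (s.elimAll m) {y | ∃ x : Fin m → ℤ, join x y ∈ X}
  | 0, s, X, h, hK => by simpa [Arr.elimAll, join] using h
  | m + 1, s, X, h, hK => by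
    have e : {y | ∃ x : Fin (m + 1) → ℤ, join x y ∈ X} =
        {y | ∃ x : Fin m → ℤ, join x y ∈ proj X} := by
      ext y
      constructor
      · rintro ⟨x, hx⟩
        exact ⟨Fin.tail x, x 0, hx⟩
      · rintro ⟨x, z, hz⟩
        exact ⟨Fin.cons z x, hz⟩
    rw [e]
    exact Tame.elimAll (h.step hK) (Arr.step_period_pos hK)

theorem Arr.length_elimAll_le : ∀ {m : ℕ} (s : Arr (d + m)),
    (s.elimAll m).2.1.length ≤ s.2.1.length ^ 2 ^ m
  | 0, s => by simp [elimAll]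
  | m + 1, s => by
    refine (length_elimAll_le s.step).trans ?_
    rw [pow_succ', pow_mul]
    exact Nat.pow_le_pow_left s.length_step_le _

theorem Arr.exists_of_elimAll : ∀ {m : ℕ} {s : Arr (d + m)} {y : Fin d → ℝ},
    (∀ e ∈ (s.elimAll m).1, rdot e y = 0) → ∃ x : Fin m → ℝ, ∀ e ∈ s.1, rdot e (join x y) = 0
  | 0, s, y, h => ⟨Fin.elim0, h⟩
  | m + 1, s, y, h => by
    obtain ⟨x, hx⟩ := exists_of_elimAll (s := s.step) h
    obtain ⟨z, hz⟩ := exists_of_step hx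
    exact ⟨Fin.cons z x, hz⟩

end Elimination

/-! ### The graph of a linear map on a presented set -/

section Graph

variable {m n : ℕ}

instance : Enc (Piece m) := ⟨fun q => .pair (enc q.ineqs) (enc q.period)⟩

theorem PT.pieceIneqs {α : Type} [Enc α] {f : α → Piece m} (hf : PT f) :
    PT fun a => (f a).ineqs := DataPT.trans hf DataPT.fst

theorem PT.piecePeriod {α : Type} [Enc α] {f : α → Piece m} (hf : PT f) :
    PT fun a => (f a).period := DataPT.trans hf DataPT.snd

theorem PT.pieceMk {α : Type} [Enc α] {f : α → IneqSystem m}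
    {g : α → Matrix (Fin m) (Fin m) ℤ} (hf : PT f) (hg : PT g) :
    PT fun a => Piece.mk (f a) (g a) := DataPT.pair hf hg

/-- Normals of hyperplanes that suffice to describe the nonempty polyhedra. -/
def Presentation.normals (D : Presentation m) : List (Fin m → ℤ) :=
  D.flatMap fun q => q.ineqs.trimmed.map fun c => c.1.1

/-- A bound for the right hand sides. -/
def Presentation.bound (D : Presentation m) : ℕ :=
  (D.flatMap fun q => q.ineqs.map fun r => r.2.natAbs).sum

/-- A common multiple of the determinants of the period lattices. -/
def Presentation.index (D : Presentation m) : ℕ := (D.map fun q => q.period.det.natAbs).prod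

theorem PT.normals : PT (Presentation.normals (m := m)) := by
  refine PT.flatMap (f := fun _ (q : Piece m) => q.ineqs.trimmed.map fun c => c.1.1) ?_ PT.id
  exact PT.map (f := fun _ (c : Constraint m) => c.1.1) (by fun_prop)
    (PT.trimmed.comp (PT.pieceIneqs (by fun_prop)))

theorem PT.bound : PT (Presentation.bound (m := m)) := by
  refine PT.natSum (PT.flatMap (f := fun _ (q : Piece m) => q.ineqs.map fun r => r.2.natAbs) ?_
    PT.id)
  exact PT.map (f := fun _ (r : Ineq m) => r.2.natAbs) (by fun_prop)
    (PT.pieceIneqs (by fun_prop))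

theorem PT.index : PT (Presentation.index (m := m)) := by
  refine PT.natProd (PT.map (f := fun _ (q : Piece m) => q.period.det.natAbs) ?_ PT.id)
  exact PT.natAbs (PT.det (PT.piecePeriod (by fun_prop)))

/-- The hyperplanes, thickness and period that govern the graph of `T` on a set presented by `D`. -/
def graphArr (D : Presentation m) (T : Matrix (Fin n) (Fin m) ℤ) : Arr (n + m) :=
  (List.ofFn fun t => join (T t) (Pi.single t (-1)), D.normals.map fun a => join a 0,
    D.bound, D.index)

theorem PT.graphArr : PT fun p : Presentation m × Matrix (Fin n) (Fin m) ℤ => graphArr p.1 p.2 := by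
  refine PT.prodMk ?_ (PT.prodMk ?_ ?_)
  · have h : PT (β := Fin n → Fin m → ℤ) fun p : Presentation m × Matrix (Fin n) (Fin m) ℤ => p.2 :=
      PT.snd PT.id
    exact PT.pi (f := fun (p : Presentation m × Matrix (Fin n) (Fin m) ℤ) (t : Fin n) =>
      SemilinearProj.join (p.2 t) (Pi.single t (-1)))
      fun t => PT.join (f := fun p : Presentation m × Matrix (Fin n) (Fin m) ℤ => p.2 t)
        (h.apply t) (PT.const _)
  · exact PT.map (f := fun _ (a : Fin m → ℤ) => SemilinearProj.join a (0 : Fin n → ℤ))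
      (PT.join (by fun_prop) (by fun_prop)) (PT.normals.comp (by fun_prop))
  · exact PT.prodMk (PT.bound.comp (by fun_prop)) (PT.index.comp (by fun_prop))

theorem mulVec_mem_latticeOf (B : Matrix (Fin m) (Fin m) ℤ) (u : Fin m → ℤ) :
    B.mulVec u ∈ latticeOf B := by
  have : B.mulVec u = ∑ j, u j • fun i => B i j := by
    ext i
    rw [Finset.sum_apply]
    simp only [Matrix.mulVec, dotProduct, Pi.smul_apply, smul_eq_mul, mul_comm]
  rw [this]
  exact AddSubgroup.sum_mem _ fun j _ => AddSubgroup.zsmul_mem _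
    (AddSubgroup.subset_closure (Set.mem_range_self j)) _

/-- Cramer's rule: `B * adjugate B` is the determinant times the identity. -/
theorem mem_latticeOf_of_dvd {B : Matrix (Fin m) (Fin m) ℤ} {v : Fin m → ℤ}
    (h : ∀ i, B.det ∣ v i) : v ∈ latticeOf B := by
  choose w hw using h
  have hv : v = B.mulVec (B.adjugate.mulVec w) := by
    rw [Matrix.mulVec_mulVec, Matrix.mul_adjugate, Matrix.smul_mulVec, Matrix.one_mulVec]
    ext i
    simpa using hw i
  exact hv ▸ mulVec_mem_latticeOf B _

theorem IneqSystem.mem_of_mem_trimmed {S : IneqSystem m} {c : Constraint m} (hc : c ∈ S.trimmed) :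
    c.1 ∈ S := by
  have h1 : c ∈ flagged S := by
    unfold trimmed at hc
    cases hf : S.feasible
    · simp [hf] at hc
    · rw [hf, cond_true] at hc
      exact (prune_spec _).2.1 c hc
  obtain ⟨r, hr, rfl⟩ := List.mem_map.1 h1
  exact hr

theorem Presentation.index_pos {D : Presentation m} (hD : D.Valid) : 0 < D.index := by
  refine List.prod_pos fun c hc => ?_
  obtain ⟨q, hq, rfl⟩ := List.mem_map.1 hc
  exact Int.natAbs_pos.2 (hD.1 q hq)

/-- A constraint with right hand side in `[-M, M]` cannot distinguish two values of the same class,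
so the polyhedra do not separate the points. The period is a multiple of each determinant, so the
points also lie in the same cosets. -/
theorem Presentation.Presents.tame {D : Presentation m} {X : Set (Fin m → ℤ)} (h : D.Presents X) :
    Tame ([], D.normals, D.bound, D.index) X := by
  obtain ⟨pat, hpat, rfl⟩ := h
  refine ⟨by simp, ?_⟩
  rintro x hx y - hK hA
  rw [Set.mem_iUnion] at hx ⊢
  obtain ⟨i, hxi, hxp⟩ := hx
  have hmem : D.get i ∈ D := List.get_mem _ _
  refine ⟨i, ?_, ?_⟩
  · have hreg := IneqSystem.region_trimmed ⟨_, hxi⟩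
    rw [← hreg, mem_region_toSystem] at hxi ⊢
    intro c hc
    have hcls := hA c.1.1 (List.mem_flatMap.2 ⟨_, hmem, List.mem_map.2 ⟨c, hc, rfl⟩⟩)
    have hb : c.1.2.natAbs ≤ D.bound := by
      have hc' := IneqSystem.mem_of_mem_trimmed hc
      exact List.le_sum_of_mem (List.mem_flatMap.2 ⟨_, hmem, List.mem_map.2 ⟨c.1, hc', rfl⟩⟩)
    have := hxi c hc
    unfold Constraint.Holds at this ⊢
    rw [rdot_intCast] at this ⊢
    norm_cast at this ⊢
    unfold SameClass at hcls
    dsimp only at hcls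
    generalize c.1.1 ⬝ᵥ x = u at *
    generalize c.1.1 ⬝ᵥ y = v at *
    refine ⟨by omega, fun h2 => ?_⟩
    have := this.2 h2
    omega
  · obtain ⟨S, hS⟩ := hpat i
    rw [hS] at hxp ⊢
    obtain ⟨t, ht, htx⟩ := hxp
    refine ⟨t, ht, ?_⟩
    rw [show y - t = (y - x) + (x - t) by abel]
    refine AddSubgroup.add_mem _ (mem_latticeOf_of_dvd fun j => ?_) htx
    refine Int.natAbs_dvd.1 (dvd_trans ?_ (hK j))
    exact_mod_cast List.dvd_prod (List.mem_map.2 ⟨_, hmem, rfl⟩)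

theorem dotProduct_graphRow (T : Matrix (Fin n) (Fin m) ℤ) (t : Fin n) (x : Fin m → ℤ)
    (y : Fin n → ℤ) : join (T t) (Pi.single t (-1)) ⬝ᵥ join x y = T.mulVec x t - y t := by
  rw [dotProduct_join, single_dotProduct]
  simp [Matrix.mulVec, sub_eq_add_neg]

theorem Presentation.Presents.tame_graph {D : Presentation m} {X : Set (Fin m → ℤ)}
    (h : D.Presents X) (T : Matrix (Fin n) (Fin m) ℤ) :
    Tame (graphArr D T) {v | ∃ x ∈ X, v = join x (T.mulVec x)} := by
  have htame := h.tame
  refine ⟨?_, ?_⟩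
  · rintro _ ⟨x, -, rfl⟩ e he
    obtain ⟨t, rfl⟩ := List.mem_ofFn.1 he
    rw [dotProduct_graphRow, sub_self]
  · rintro _ ⟨x, hx, rfl⟩ v hv hK hA
    obtain ⟨x', y', rfl⟩ := exists_join v
    have hy : y' = T.mulVec x' := by
      ext t
      have := hv _ (List.mem_ofFn.2 ⟨t, rfl⟩)
      rw [dotProduct_graphRow] at this
      omega
    refine ⟨x', htame.2 x hx x' (by simp) ?_ ?_, by rw [hy]⟩
    · exact forall_of_forall_join (fun a b => (D.index : ℤ) ∣ a - b) hK
    · intro a ha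
      have := hA _ (List.mem_map.2 ⟨a, ha, rfl⟩)
      rwa [dotProduct_join, dotProduct_join, zero_dotProduct, zero_dotProduct, add_zero,
        add_zero] at this

/-- The arrangement in the target space that governs the image of a presented set. -/
def imageArr (D : Presentation m) (T : Matrix (Fin n) (Fin m) ℤ) : Arr n := (graphArr D T).elimAll m

theorem PT.imageArr : PT fun p : Presentation m × Matrix (Fin n) (Fin m) ℤ => imageArr p.1 p.2 :=
  PT.elimAll.comp PT.graphArr

theorem Presentation.Presents.tame_image {D : Presentation m} {X : Set (Fin m → ℤ)}
    (hD : D.Valid) (h : D.Presents X) (T : Matrix (Fin n) (Fin m) ℤ) :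
    Tame (imageArr D T) (T.mulVec '' X) := by
  have e : T.mulVec '' X = {y | ∃ x, join x y ∈ {v | ∃ x ∈ X, v = join x (T.mulVec x)}} := by
    ext y
    constructor
    · rintro ⟨x, hx, rfl⟩
      exact ⟨x, x, hx, rfl⟩
    · rintro ⟨x, x', hx', he⟩
      exact ⟨x', hx', (join_injective he).2.symm⟩
  rw [e]
  exact (h.tame_graph T).elimAll (D.index_pos hD)

theorem imageArr_period_pos {D : Presentation m} (hD : D.Valid) (T : Matrix (Fin n) (Fin m) ℤ) :
    0 < (imageArr D T).2.2.2 := Arr.elimAll_period_pos (D.index_pos hD)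

/-- Lifting a solution of the final equations back to the graph gives a real preimage under `T`. The
solution space therefore has dimension at most the rank of `T`. -/
theorem exists_mulVec_of_imageArr {D : Presentation m} {T : Matrix (Fin n) (Fin m) ℤ}
    {y : Fin n → ℝ} (h : ∀ e ∈ (imageArr D T).1, rdot e y = 0) :
    ∃ x : Fin m → ℝ, y = (T.map (Int.cast : ℤ → ℝ)).mulVec x := by
  obtain ⟨x, hx⟩ := Arr.exists_of_elimAll h
  refine ⟨x, ?_⟩
  ext t
  have := hx _ (List.mem_ofFn.2 ⟨t, rfl⟩)
  rw [rdot_join] at this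
  have e : rdot (Pi.single t (-1) : Fin n → ℤ) y = -y t := by
    rw [rdot_apply, Finset.sum_eq_single t]
    · simp
    · intro b _ hb; simp [Pi.single_eq_of_ne hb]
    · simp
  rw [e, rdot_apply] at this
  simp only [Matrix.mulVec, dotProduct, Matrix.map_apply]
  linarith

theorem length_imageArr_le (D : Presentation m) (T : Matrix (Fin n) (Fin m) ℤ) :
    (imageArr D T).2.1.length ≤ D.normals.length ^ 2 ^ m := by
  have := Arr.length_elimAll_le (graphArr D T)
  rwa [show (graphArr D T).2.1.length = D.normals.length from List.length_map ..] at this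

end Graph

/-! ### Cells of an arrangement of thick hyperplanes -/

section Cells

variable {n : ℕ}

/-- The three parts of a polyhedron outside and inside a thick hyperplane. -/
def splitCell (M : ℕ) (a : Fin n → ℤ) (c : IneqSystem n) : List (IneqSystem n) :=
  [(a, -(M + 1 : ℤ)) :: c, (a, (M : ℤ)) :: (-a, (M : ℤ)) :: c, (-a, -(M + 1 : ℤ)) :: c]

/-- The nonempty cells into which a polyhedron is cut by thick hyperplanes. -/
def cells (S₀ : IneqSystem n) (M : ℕ) (A : List (Fin n → ℤ)) : List (IneqSystem n) :=
  A.foldr (fun a L => (L.flatMap (splitCell M a)).filter IneqSystem.feasible) [S₀]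

theorem cells_cons (S₀ : IneqSystem n) (M : ℕ) (a : Fin n → ℤ) (A : List (Fin n → ℤ)) :
    cells S₀ M (a :: A) = ((cells S₀ M A).flatMap (splitCell M a)).filter IneqSystem.feasible := rfl

theorem mem_region_cons {r : Ineq n} {S : IneqSystem n} {x : Fin n → ℝ} :
    x ∈ IneqSystem.region (r :: S) ↔ rdot r.1 x ≤ r.2 ∧ x ∈ S.region := by
  simp [IneqSystem.mem_region]

theorem mem_splitCell {M : ℕ} {a : Fin n → ℤ} {c c' : IneqSystem n} (h : c' ∈ splitCell M a c)
    (x : Fin n → ℝ) : x ∈ c'.region → x ∈ c.region := by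
  simp only [splitCell, List.mem_cons, List.not_mem_nil, or_false] at h
  rcases h with rfl | rfl | rfl <;> simp only [mem_region_cons] <;> tauto

theorem mem_cells_cons {S₀ : IneqSystem n} {M : ℕ} {a : Fin n → ℤ} {A : List (Fin n → ℤ)}
    {c : IneqSystem n} : c ∈ cells S₀ M (a :: A) ↔
      (∃ c' ∈ cells S₀ M A, c ∈ splitCell M a c') ∧ c.region.Nonempty := by
  rw [cells_cons, List.mem_filter, List.mem_flatMap, IneqSystem.feasible_iff]

theorem exists_append_of_mem_cells {S₀ : IneqSystem n} {M : ℕ} {A : List (Fin n → ℤ)} :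
    ∀ {c : IneqSystem n}, c ∈ cells S₀ M A → ∃ S, c = S ++ S₀ ∧ S.length ≤ 2 * A.length := by
  induction A with
  | nil => intro c hc; exact ⟨[], by simpa [cells] using hc, by simp⟩
  | cons a A ih =>
    intro c hc
    obtain ⟨⟨c', hc', hs⟩, -⟩ := mem_cells_cons.1 hc
    obtain ⟨S, rfl, hS⟩ := ih hc'
    simp only [splitCell, List.mem_cons, List.not_mem_nil, or_false] at hs
    rcases hs with rfl | rfl | rfl
    · exact ⟨(a, -(M + 1 : ℤ)) :: S, rfl, by simp; omega⟩
    · exact ⟨(a, (M : ℤ)) :: (-a, (M : ℤ)) :: S, rfl, by simp; omega⟩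
    · exact ⟨(-a, -(M + 1 : ℤ)) :: S, rfl, by simp; omega⟩

theorem region_subset_of_mem_cells {S₀ : IneqSystem n} {M : ℕ} {A : List (Fin n → ℤ)}
    {c : IneqSystem n} (hc : c ∈ cells S₀ M A) {x : Fin n → ℝ} (hx : x ∈ c.region) :
    x ∈ S₀.region := by
  obtain ⟨S, rfl, -⟩ := exists_append_of_mem_cells hc
  exact IneqSystem.mem_region.2 fun r hr => IneqSystem.mem_region.1 hx r (by simp [hr])

/-- The rows added when cells are split. -/
def splitRows (M : ℕ) (a : Fin n → ℤ) : IneqSystem n :=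
  [(a, -(M + 1 : ℤ)), (a, (M : ℤ)), (-a, (M : ℤ)), (-a, -(M + 1 : ℤ))]

theorem esize_le_of_mem_cells {S₀ : IneqSystem n} {M B : ℕ} {A : List (Fin n → ℤ)}
    (hB : ∀ a ∈ A, esize (splitRows M a) ≤ B) :
    ∀ {c : IneqSystem n}, c ∈ cells S₀ M A → esize c ≤ esize S₀ + A.length * B := by
  induction A with
  | nil =>
    intro c hc
    have : c = S₀ := by simpa [cells] using hc
    simp [this]
  | cons a A ih =>
    intro c hc
    obtain ⟨⟨c', hc', hs⟩, -⟩ := mem_cells_cons.1 hc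
    have h1 := ih (fun b hb => hB b (by simp [hb])) hc'
    have h2 := hB a (by simp)
    simp only [splitRows, esize_cons] at h2
    rw [List.length_cons, add_mul, one_mul]
    simp only [splitCell, List.mem_cons, List.not_mem_nil, or_false] at hs
    rcases hs with rfl | rfl | rfl <;> simp only [esize_cons] <;> omega

/-- The three parts have functional values at most `-(M + 1)`, in `[-M, M]`, and at least `M + 1`.
The gaps keep the closed parts disjoint over the reals and contain no integral points. -/
theorem pairwise_disjoint_cells (S₀ : IneqSystem n) (M : ℕ) (A : List (Fin n → ℤ)) :
    (cells S₀ M A).Pairwise fun c c' => Disjoint c.region c'.region := by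
  induction A with
  | nil => exact List.pairwise_singleton _ _
  | cons a A ih =>
    rw [cells_cons]
    refine List.Pairwise.filter _ (List.pairwise_flatMap.2 ⟨fun c _ => ?_, ih.imp ?_⟩)
    · have h : (0 : ℝ) ≤ M := by positivity
      simp only [splitCell, List.pairwise_cons, List.mem_cons, List.not_mem_nil, or_false,
        forall_eq_or_imp, forall_eq, Set.disjoint_left, mem_region_cons, rdot_neg]
      push_cast
      refine ⟨⟨?_, ?_⟩, ?_, by simp⟩
      · rintro x ⟨h1, -⟩ ⟨-, h2, -⟩; linarith
      · rintro x ⟨h1, -⟩ ⟨h2, -⟩; linarith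
      · rintro x ⟨h1, -⟩ ⟨h2, -⟩; linarith
    · intro c c' hd x hx y hy
      rw [Set.disjoint_left] at hd ⊢
      exact fun z hz hz' => hd (mem_splitCell hx z hz) (mem_splitCell hy z hz')

theorem exists_mem_cells {S₀ : IneqSystem n} {M : ℕ} {A : List (Fin n → ℤ)} {y : Fin n → ℤ}
    (h₀ : (fun i => (y i : ℝ)) ∈ S₀.region) :
    ∃ c ∈ cells S₀ M A, (fun i => (y i : ℝ)) ∈ c.region := by
  induction A with
  | nil => exact ⟨S₀, by simp [cells], h₀⟩
  | cons a A ih =>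
    obtain ⟨c, hc, hy⟩ := ih
    have key : ∀ c' ∈ splitCell M a c, (fun i => (y i : ℝ)) ∈ c'.region →
        ∃ c ∈ cells S₀ M (a :: A), (fun i => (y i : ℝ)) ∈ c.region := fun c' hc' h =>
      ⟨c', mem_cells_cons.2 ⟨⟨c, hc, hc'⟩, _, h⟩, h⟩
    have e := rdot_intCast a y
    by_cases h1 : a ⬝ᵥ y ≤ -(M + 1 : ℤ)
    · refine key _ (List.mem_cons_self ..) (mem_region_cons.2 ⟨?_, hy⟩)
      rw [e]; exact_mod_cast h1
    by_cases h2 : a ⬝ᵥ y ≤ M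
    · refine key ((a, (M : ℤ)) :: (-a, (M : ℤ)) :: c) (by simp [splitCell])
        (mem_region_cons.2 ⟨?_, mem_region_cons.2 ⟨?_, hy⟩⟩)
      · rw [e]; exact_mod_cast h2
      · rw [rdot_neg, e]
        have : -(a ⬝ᵥ y) ≤ M := by omega
        exact_mod_cast this
    · refine key ((-a, -(M + 1 : ℤ)) :: c) (by simp [splitCell]) (mem_region_cons.2 ⟨?_, hy⟩)
      rw [rdot_neg, e]
      have : -(a ⬝ᵥ y) ≤ -(M + 1 : ℤ) := by omega
      exact_mod_cast this

/-- Integral points of a cell lie on the same sides of all thick hyperplanes. -/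
theorem position_eq_of_mem_cells {S₀ : IneqSystem n} {M : ℕ} {A : List (Fin n → ℤ)}
    {x y : Fin n → ℤ} :
    ∀ {c : IneqSystem n}, c ∈ cells S₀ M A → (fun i => (x i : ℝ)) ∈ c.region →
      (fun i => (y i : ℝ)) ∈ c.region → ∀ a ∈ A,
      SameClass M (a ⬝ᵥ x) (a ⬝ᵥ y) ∨ (|a ⬝ᵥ x| ≤ M ∧ |a ⬝ᵥ y| ≤ M) := by
  induction A with
  | nil => simp
  | cons b A ih =>
    intro c hc hx hy a ha
    obtain ⟨⟨c', hc', hs⟩, -⟩ := mem_cells_cons.1 hc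
    rcases List.mem_cons.1 ha with rfl | ha
    · have ex := rdot_intCast a x
      have ey := rdot_intCast a y
      unfold SameClass
      rw [abs_le, abs_le]
      simp only [splitCell, List.mem_cons, List.not_mem_nil, or_false] at hs
      rcases hs with rfl | rfl | rfl <;> simp only [mem_region_cons, rdot_neg, ex, ey] at hx hy <;>
        norm_cast at hx hy
      · left; right; right; constructor <;> omega
      · right; omega
      · left; right; left; constructor <;> omega
    · exact ih hc' (mem_splitCell hs _ hx) (mem_splitCell hs _ hy) a ha

/-! ### The number of cells -/

open Classical in
/-- The number of polyhedra in a list that meet a given set. -/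
noncomputable def meetCount (L : List (IneqSystem n)) (Z : Set (Fin n → ℝ)) : ℕ :=
  L.countP fun c => decide (c.region ∩ Z).Nonempty

theorem Convex.exists_eq_of_le {C : Set (Fin n → ℝ)} (hC : Convex ℝ C) (f : (Fin n → ℝ) →ₗ[ℝ] ℝ)
    {t : ℝ} {u w : Fin n → ℝ} (hu : u ∈ C) (hw : w ∈ C) (h1 : f u ≤ t) (h2 : t ≤ f w) :
    ∃ x ∈ C, f x = t := by
  have := hC.isPreconnected.intermediate_value hu hw
    (f.toContinuousLinearMap.continuous.continuousOn)
  exact this ⟨h1, h2⟩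

open Classical in
theorem meetCount_singleton (c : IneqSystem n) (Z : Set (Fin n → ℝ)) :
    meetCount [c] Z = if (c.region ∩ Z).Nonempty then 1 else 0 := by
  simp [meetCount, List.countP_cons]

open Classical in
theorem meetCount_splitCell (M : ℕ) (a : Fin n → ℤ) (c : IneqSystem n) (Z : Set (Fin n → ℝ)) :
    meetCount (splitCell M a c) Z =
      (if ∃ x ∈ c.region, x ∈ Z ∧ (M : ℝ) + 1 ≤ rdot a x then 1 else 0) +
      (if ∃ x ∈ c.region, x ∈ Z ∧ rdot a x ≤ M ∧ -(M : ℝ) ≤ rdot a x then 1 else 0) +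
      (if ∃ x ∈ c.region, x ∈ Z ∧ rdot a x ≤ -((M : ℝ) + 1) then 1 else 0) := by
  have h1 : (IneqSystem.region ((a, -(M + 1 : ℤ)) :: c) ∩ Z).Nonempty ↔
      ∃ x ∈ c.region, x ∈ Z ∧ rdot a x ≤ -(M + 1) := by
    constructor
    · rintro ⟨x, hx, hx'⟩
      rw [mem_region_cons] at hx
      exact ⟨x, hx.2, hx', by simpa using hx.1⟩
    · rintro ⟨x, hx, hx', h⟩
      exact ⟨x, mem_region_cons.2 ⟨by simpa using h, hx⟩, hx'⟩
  have h2 : (IneqSystem.region ((a, (M : ℤ)) :: (-a, (M : ℤ)) :: c) ∩ Z).Nonempty ↔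
      ∃ x ∈ c.region, x ∈ Z ∧ rdot a x ≤ M ∧ -M ≤ rdot a x := by
    constructor
    · rintro ⟨x, hx, hx'⟩
      rw [mem_region_cons, mem_region_cons, rdot_neg] at hx
      exact ⟨x, hx.2.2, hx', by simpa using hx.1, by have := hx.2.1; push_cast at this; linarith⟩
    · rintro ⟨x, hx, hx', h, h'⟩
      refine ⟨x, mem_region_cons.2 ⟨by simpa using h, mem_region_cons.2 ⟨?_, hx⟩⟩, hx'⟩
      rw [rdot_neg]; push_cast; linarith
  have h3 : (IneqSystem.region ((-a, -(M + 1 : ℤ)) :: c) ∩ Z).Nonempty ↔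
      ∃ x ∈ c.region, x ∈ Z ∧ (M : ℝ) + 1 ≤ rdot a x := by
    constructor
    · rintro ⟨x, hx, hx'⟩
      rw [mem_region_cons, rdot_neg] at hx
      exact ⟨x, hx.2, hx', by have := hx.1; push_cast at this; linarith⟩
    · rintro ⟨x, hx, hx', h⟩
      refine ⟨x, mem_region_cons.2 ⟨?_, hx⟩, hx'⟩
      rw [rdot_neg]; push_cast; linarith
  simp only [meetCount, splitCell, List.countP_cons, List.countP_nil, decide_eq_true_eq, h1, h2, h3,
    zero_add]

/-- The trace of the cell on `Z` is convex. If it meets two neighbouring parts, it also meets the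
hyperplane where the functional is `M` or `-M`; each part beyond the first is charged to such a
crossing. -/
theorem meetCount_splitCell_le (M : ℕ) (a : Fin n → ℤ) (c : IneqSystem n) {Z : Set (Fin n → ℝ)}
    (hZ : Convex ℝ Z) : meetCount (splitCell M a c) Z ≤ meetCount [c] Z +
      meetCount [c] (Z ∩ {x | rdot a x = -M}) + meetCount [c] (Z ∩ {x | rdot a x = M}) := by
  have hM : (0 : ℝ) ≤ M := by positivity
  have hconv : Convex ℝ (c.region ∩ Z) := c.convex_region.inter hZ
  have hcut : ∀ (t : ℝ) (u w : Fin n → ℝ), u ∈ c.region → u ∈ Z → w ∈ c.region → w ∈ Z →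
      rdot a u ≤ t → t ≤ rdot a w → (c.region ∩ (Z ∩ {x | rdot a x = t})).Nonempty := by
    intro t u w hu hu' hw hw' h1 h2
    obtain ⟨x, hx, hxt⟩ := Convex.exists_eq_of_le hconv (rdot a) ⟨hu, hu'⟩ ⟨hw, hw'⟩ h1 h2
    exact ⟨x, hx.1, hx.2, hxt⟩
  have h0 : ∀ x ∈ c.region, x ∈ Z → meetCount [c] Z = 1 := fun x hx hx' => by
    rw [meetCount_singleton, if_pos ⟨x, hx, hx'⟩]
  have h1 : ∀ (t : ℝ) (u w : Fin n → ℝ), u ∈ c.region → u ∈ Z → w ∈ c.region → w ∈ Z →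
      rdot a u ≤ t → t ≤ rdot a w → meetCount [c] (Z ∩ {x | rdot a x = t}) = 1 :=
    fun t u w hu hu' hw hw' h1 h2 => by
      rw [meetCount_singleton, if_pos (hcut t u w hu hu' hw hw' h1 h2)]
  rw [meetCount_splitCell]
  split_ifs with b3 b2 b1 b1 b2 b1 b1
  · obtain ⟨x, hx, hx', hxa⟩ := b1
    obtain ⟨y, hy, hy', hya, hya'⟩ := b2
    obtain ⟨z, hz, hz', hza⟩ := b3
    rw [h0 x hx hx', h1 (-M) x y hx hx' hy hy' (by linarith) hya',
      h1 M y z hy hy' hz hz' hya (by linarith)]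
  · obtain ⟨y, hy, hy', hya, hya'⟩ := b2
    obtain ⟨z, hz, hz', hza⟩ := b3
    rw [h0 y hy hy', h1 M y z hy hy' hz hz' hya (by linarith)]
    omega
  · obtain ⟨x, hx, hx', hxa⟩ := b1
    obtain ⟨z, hz, hz', hza⟩ := b3
    rw [h0 x hx hx', h1 M x z hx hx' hz hz' (by linarith) (by linarith)]
    omega
  · obtain ⟨z, hz, hz', -⟩ := b3
    rw [h0 z hz hz']
    omega
  · obtain ⟨x, hx, hx', hxa⟩ := b1
    obtain ⟨y, hy, hy', hya, hya'⟩ := b2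
    rw [h0 x hx hx', h1 (-M) x y hx hx' hy hy' (by linarith) hya']
    omega
  · obtain ⟨y, hy, hy', -⟩ := b2
    rw [h0 y hy hy']
    omega
  · obtain ⟨x, hx, hx', -⟩ := b1
    rw [h0 x hx hx']
    omega
  · omega

theorem meetCount_splitCell_le_of_const (M : ℕ) {a : Fin n → ℤ} (c : IneqSystem n)
    {Z : Set (Fin n → ℝ)} (hZ : ∀ x ∈ Z, ∀ y ∈ Z, rdot a x = rdot a y) :
    meetCount (splitCell M a c) Z ≤ meetCount [c] Z := by
  have hM : (0 : ℝ) ≤ M := by positivity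
  by_cases hne : (c.region ∩ Z).Nonempty
  · rw [meetCount_splitCell]
    rw [meetCount_singleton, if_pos hne]
    split_ifs with b3 b2 b1 b1 b2 b1 b1 <;> try omega
    · obtain ⟨x, hx, hx', h1⟩ := b2
      obtain ⟨y, hy, hy', h2⟩ := b3
      linarith [hZ x hx' y hy']
    · obtain ⟨x, hx, hx', h1⟩ := b2
      obtain ⟨y, hy, hy', h2⟩ := b3
      linarith [hZ x hx' y hy']
    · obtain ⟨x, hx, hx', h1⟩ := b1
      obtain ⟨y, hy, hy', h2⟩ := b3
      linarith [hZ x hx' y hy']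
    · obtain ⟨x, hx, hx', h1⟩ := b1
      obtain ⟨y, hy, hy', h2, h3⟩ := b2
      linarith [hZ x hx' y hy']
  · have : ∀ c' ∈ splitCell M a c, ¬ (c'.region ∩ Z).Nonempty := fun c' hc' ⟨x, hx, hx'⟩ =>
      hne ⟨x, mem_splitCell hc' x hx, hx'⟩
    have h0 : meetCount (splitCell M a c) Z = 0 := by
      unfold meetCount
      rw [List.countP_eq_zero]
      simpa using this
    omega

theorem meetCount_cons (c : IneqSystem n) (L : List (IneqSystem n)) (Z : Set (Fin n → ℝ)) :
    meetCount (c :: L) Z = meetCount [c] Z + meetCount L Z := by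
  unfold meetCount
  rw [← List.countP_append]
  rfl

theorem meetCount_flatMap_cons (f : IneqSystem n → List (IneqSystem n)) (c : IneqSystem n)
    (L : List (IneqSystem n)) (Z : Set (Fin n → ℝ)) :
    meetCount ((c :: L).flatMap f) Z = meetCount (f c) Z + meetCount (L.flatMap f) Z := by
  unfold meetCount
  rw [List.flatMap_cons, List.countP_append]

theorem meetCount_flatMap_splitCell_le (M : ℕ) (a : Fin n → ℤ) (L : List (IneqSystem n))
    {Z : Set (Fin n → ℝ)} (hZ : Convex ℝ Z) : meetCount (L.flatMap (splitCell M a)) Z ≤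
      meetCount L Z + meetCount L (Z ∩ {x | rdot a x = -M}) +
        meetCount L (Z ∩ {x | rdot a x = M}) := by
  induction L with
  | nil => simp [meetCount]
  | cons c L ih =>
    have := meetCount_splitCell_le M a c hZ
    rw [meetCount_flatMap_cons, meetCount_cons c L Z, meetCount_cons c L (Z ∩ _),
      meetCount_cons c L (Z ∩ _)]
    omega

theorem meetCount_flatMap_splitCell_le_of_const (M : ℕ) {a : Fin n → ℤ} (L : List (IneqSystem n))
    {Z : Set (Fin n → ℝ)} (hZ : ∀ x ∈ Z, ∀ y ∈ Z, rdot a x = rdot a y) :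
    meetCount (L.flatMap (splitCell M a)) Z ≤ meetCount L Z := by
  induction L with
  | nil => simp [meetCount]
  | cons c L ih =>
    have := meetCount_splitCell_le_of_const M c hZ
    rw [meetCount_flatMap_cons, meetCount_cons c L Z]
    omega

/-- The translate of a linear subspace. -/
def coset (p : Fin n → ℝ) (W : Submodule ℝ (Fin n → ℝ)) : Set (Fin n → ℝ) := {x | x - p ∈ W}

theorem convex_coset (p : Fin n → ℝ) (W : Submodule ℝ (Fin n → ℝ)) : Convex ℝ (coset p W) := by
  intro x hx y hy s t hs ht hst
  have : s • x + t • y - p = s • (x - p) + t • (y - p) := by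
    rw [smul_sub, smul_sub, sub_add_sub_comm, ← add_smul, hst, one_smul]
  change s • x + t • y - p ∈ W
  rw [this]
  exact W.add_mem (W.smul_mem _ hx) (W.smul_mem _ hy)

theorem coset_inter_eq {p q : Fin n → ℝ} {W : Submodule ℝ (Fin n → ℝ)} {a : Fin n → ℤ} {t : ℝ}
    (hq : q ∈ coset p W ∩ {x | rdot a x = t}) :
    coset p W ∩ {x | rdot a x = t} = coset q (W ⊓ LinearMap.ker (rdot a)) := by
  obtain ⟨hq1, hq2⟩ := hq
  ext x
  simp only [coset, Set.mem_inter_iff, Set.mem_ofPred_eq, Submodule.mem_inf, LinearMap.mem_ker,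
    map_sub, sub_eq_zero] at hq1 hq2 ⊢
  have : x - q = (x - p) - (q - p) := by abel
  rw [this, W.sub_mem_iff_left hq1, hq2]

/-- Deletion and restriction: a new slab adds at most the cells met by its two boundary hyperplanes,
whose traces on the affine subspace have dimension one less. The induction closes by `(2k + 1) ^ (e
+ 1) + 2 (2k + 1) ^ e = (2k + 1) ^ e (2k + 3)`. A functional constant on the subspace splits
nothing. -/
theorem meetCount_cells_le (S₀ : IneqSystem n) (M : ℕ) (A : List (Fin n → ℤ)) :
    ∀ (p : Fin n → ℝ) (W : Submodule ℝ (Fin n → ℝ)),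
      meetCount (cells S₀ M A) (coset p W) ≤ (2 * A.length + 1) ^ Module.finrank ℝ W := by
  induction A with
  | nil =>
    intro p W
    simp only [List.length_nil, mul_zero, zero_add, one_pow]
    unfold meetCount
    exact List.countP_le_length
  | cons a A ih =>
    intro p W
    have h1 : meetCount (cells S₀ M (a :: A)) (coset p W) ≤
        meetCount ((cells S₀ M A).flatMap (splitCell M a)) (coset p W) := by
      rw [cells_cons]
      exact List.Sublist.countP_le List.filter_sublist
    refine h1.trans ?_
    rw [List.length_cons]
    by_cases hW : ∃ v ∈ W, rdot a v ≠ 0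
    · have h2 := finrank_inf_ker_add_one hW
      have h3 : ∀ t : ℝ, meetCount (cells S₀ M A) (coset p W ∩ {x | rdot a x = t}) ≤
          (2 * A.length + 1) ^ Module.finrank ℝ
            (W ⊓ LinearMap.ker (rdot a) : Submodule ℝ (Fin n → ℝ)) := by
        intro t
        rcases (coset p W ∩ {x | rdot a x = t}).eq_empty_or_nonempty with he | ⟨q, hq⟩
        · rw [he]
          simp [meetCount]
        · rw [coset_inter_eq hq]
          exact ih _ _
      have h4 := meetCount_flatMap_splitCell_le M a (cells S₀ M A) (convex_coset p W)
      have h5 := ih p W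
      have h6 := h3 (-M)
      have h7 := h3 M
      rw [← h2] at h5 ⊢
      generalize Module.finrank ℝ (W ⊓ LinearMap.ker (rdot a) : Submodule ℝ (Fin n → ℝ)) = e at *
      calc _ ≤ _ := h4
        _ ≤ (2 * A.length + 1) ^ (e + 1) + (2 * A.length + 1) ^ e + (2 * A.length + 1) ^ e := by
          omega
        _ = (2 * A.length + 1) ^ e * (2 * (A.length + 1) + 1) := by ring
        _ ≤ (2 * (A.length + 1) + 1) ^ e * (2 * (A.length + 1) + 1) :=
          Nat.mul_le_mul_right _ (Nat.pow_le_pow_left (by omega) _)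
        _ = _ := by rw [pow_succ]
    · push Not at hW
      refine (meetCount_flatMap_splitCell_le_of_const M _ fun x hx y hy => ?_).trans
        ((ih p W).trans (Nat.pow_le_pow_left (by omega) _))
      have := hW _ (W.sub_mem hx hy)
      rw [sub_sub_sub_cancel_right, map_sub, sub_eq_zero] at this
      exact this

theorem length_cells_le {S₀ : IneqSystem n} {M : ℕ} {A : List (Fin n → ℤ)} {p : Fin n → ℝ}
    {W : Submodule ℝ (Fin n → ℝ)} (h : S₀.region ⊆ coset p W) :
    (cells S₀ M A).length ≤ (2 * A.length + 1) ^ Module.finrank ℝ W := by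
  cases A with
  -- With no normals the single cell has not passed the feasibility filter and may be empty, so it
  -- is counted directly.
  | nil => simp [cells]
  | cons a A =>
    refine le_trans (le_of_eq ?_) (meetCount_cells_le S₀ M (a :: A) p W)
    unfold meetCount
    rw [eq_comm, List.countP_eq_length]
    intro c hc
    obtain ⟨x, hx⟩ := (mem_cells_cons.1 hc).2
    exact @decide_eq_true _ (Classical.propDecidable _)
      ⟨x, hx, h (region_subset_of_mem_cells hc hx)⟩

end Cells

/-! ### The presentation of the image -/

section CellPresentation

variable {n : ℕ}

/-- The system of inequalities that expresses linear equations. -/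
def eqSystem (Eq : List (Fin n → ℤ)) : IneqSystem n := toSystem (Eq.map fun e => ((e, 0), true))

theorem mem_region_eqSystem {Eq : List (Fin n → ℤ)} {x : Fin n → ℝ} :
    x ∈ (eqSystem Eq).region ↔ ∀ e ∈ Eq, rdot e x = 0 := by
  rw [eqSystem, mem_region_toSystem]
  simp only [List.mem_map, forall_exists_index, and_imp, forall_apply_eq_imp_iff₂,
    Constraint.Holds, Int.cast_zero, forall_const]
  exact ⟨fun h e he => (h e he).2, fun h e he => ⟨(h e he).le, h e he⟩⟩

theorem tight_of_mem_eqSystem {Eq : List (Fin n → ℤ)} {x : Fin n → ℝ}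
    (hx : x ∈ (eqSystem Eq).region) {r : Ineq n} (hr : r ∈ eqSystem Eq) : rdot r.1 x = r.2 := by
  have h := mem_region_eqSystem.1 hx
  simp only [eqSystem, toSystem, List.mem_flatMap, List.mem_map, exists_exists_and_eq_and,
    cond_true, List.mem_cons, List.not_mem_nil, or_false] at hr
  obtain ⟨e, he, rfl | rfl⟩ := hr
  · simpa using h e he
  · simpa [Ineq.neg, rdot_neg] using h e he

/-- The scalar matrix with the given entry. -/
def scalarPeriod (n K : ℕ) : Matrix (Fin n) (Fin n) ℤ := Matrix.diagonal fun _ => (K : ℤ)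

theorem mem_latticeOf_scalarPeriod {K : ℕ} {v : Fin n → ℤ} :
    v ∈ latticeOf (scalarPeriod n K) ↔ ∀ i, (K : ℤ) ∣ v i := by
  constructor
  · intro h i
    induction h using AddSubgroup.closure_induction with
    | mem x hx =>
      obtain ⟨j, rfl⟩ := hx
      simp only [scalarPeriod, Matrix.diagonal_apply]
      split_ifs
      exacts [dvd_rfl, dvd_zero _]
    | zero => exact dvd_zero _
    | add x y _ _ hx hy => exact dvd_add hx hy
    | neg x _ hx => exact hx.neg_right
  · intro h
    choose w hw using h
    have : v = (scalarPeriod n K).mulVec w := by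
      ext i
      rw [scalarPeriod, Matrix.mulVec_diagonal, hw]
    rw [this]
    exact mulVec_mem_latticeOf _ _

/-- The representatives are the points of `P` in the cube `[0, K)ⁿ`. -/
theorem isPattern_scalarPeriod {K : ℕ} (hK : 0 < K) {P : Set (Fin n → ℤ)}
    (hP : ∀ x ∈ P, ∀ y, (∀ i, (K : ℤ) ∣ y i - x i) → y ∈ P) :
    IsPattern (latticeOf (scalarPeriod n K)) P := by
  classical
  have hK' : (0 : ℤ) < K := by exact_mod_cast hK
  refine ⟨(Fintype.piFinset fun _ => Finset.Ico (0 : ℤ) K).filter (· ∈ P), ?_⟩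
  ext x
  simp only [Set.mem_ofPred_eq, Finset.mem_filter, Fintype.mem_piFinset, Finset.mem_Ico,
    mem_latticeOf_scalarPeriod, Pi.sub_apply]
  constructor
  · intro hx
    refine ⟨fun i => x i % K, ⟨fun i => ⟨Int.emod_nonneg _ hK'.ne', Int.emod_lt_of_pos _ hK'⟩,
      hP x hx _ fun i => ?_⟩, fun i => Int.dvd_self_sub_emod⟩
    rw [dvd_sub_comm]
    exact Int.dvd_self_sub_emod
  · rintro ⟨s, ⟨-, hs⟩, hx⟩
    exact hP s hs x hx

/-- The cells of an arrangement, with a period that separates the values inside the thick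
hyperplanes. -/
def Arr.toPresentation (s : Arr n) : Presentation n :=
  (cells (eqSystem s.1) s.2.2.1 s.2.1).map fun c =>
    ⟨c, scalarPeriod n (s.2.2.2 * (2 * s.2.2.1 + 1))⟩

theorem Arr.valid_toPresentation {s : Arr n} (hK : 0 < s.2.2.2) : s.toPresentation.Valid := by
  constructor
  · intro q hq
    obtain ⟨c, -, rfl⟩ := List.mem_map.1 hq
    simp only [scalarPeriod, Matrix.det_diagonal, Finset.prod_const]
    exact pow_ne_zero _ (by positivity)
  · rw [toPresentation, List.pairwise_map]
    exact pairwise_disjoint_cells _ _ _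

/-- On each cell the pattern consists of the residue classes of the points of `Y` in that cell. Two
integral points of a cell lie on the same sides of all slabs; the factor `2M + 1` of the period
settles the values inside a slab, and tameness then transfers membership. -/
theorem Tame.presents {s : Arr n} (hK : 0 < s.2.2.2) {Y : Set (Fin n → ℤ)} (h : Tame s Y) :
    s.toPresentation.Presents Y := by
  set K := s.2.2.2 * (2 * s.2.2.1 + 1) with hKdef
  have hper : ∀ i, (s.toPresentation.get i).period = scalarPeriod n K := fun i => by
    obtain ⟨c, -, hc⟩ := List.mem_map.1 (List.get_mem s.toPresentation i)
    rw [← hc]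
  have hcell : ∀ i, (s.toPresentation.get i).ineqs ∈ cells (eqSystem s.1) s.2.2.1 s.2.1 :=
    fun i => by
      obtain ⟨c, hc', hc⟩ := List.mem_map.1 (List.get_mem s.toPresentation i)
      rwa [← hc]
  have hEq : ∀ y : Fin n → ℤ, (fun i => (y i : ℝ)) ∈ (eqSystem s.1).region ↔
      ∀ e ∈ s.1, e ⬝ᵥ y = 0 := fun y => by
    rw [mem_region_eqSystem]
    simp only [rdot_intCast, Int.cast_eq_zero]
  refine ⟨fun i => {y | ∃ x ∈ Y, (fun t => (x t : ℝ)) ∈ (s.toPresentation.get i).ineqs.region ∧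
    ∀ t, (K : ℤ) ∣ y t - x t}, fun i => ?_, ?_⟩
  · rw [hper]
    refine isPattern_scalarPeriod (Nat.mul_pos hK (by omega)) ?_
    rintro y ⟨x, hx, hxr, hxy⟩ z hz
    refine ⟨x, hx, hxr, fun t => ?_⟩
    have := dvd_add (hz t) (hxy t)
    rwa [sub_add_sub_cancel] at this
  · ext y
    rw [Set.mem_iUnion]
    constructor
    · intro hy
      obtain ⟨c, hc, hyc⟩ := exists_mem_cells (M := s.2.2.1) (A := s.2.1)
        ((hEq y).2 (h.1 y hy))
      obtain ⟨i, hi⟩ : ∃ i, s.toPresentation.get i = ⟨c, scalarPeriod n K⟩ :=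
        List.get_of_mem (List.mem_map.2 ⟨c, hc, rfl⟩)
      have hyi : (fun t => (y t : ℝ)) ∈ (s.toPresentation.get i).ineqs.region := by rwa [hi]
      exact ⟨i, hyi, y, hy, hyi, fun t => by simp⟩
    · rintro ⟨i, hyi, x, hx, hxi, hK'⟩
      refine h.2 x hx y ((hEq y).1 (region_subset_of_mem_cells (hcell i) hyi)) (fun t => ?_)
        fun a ha => ?_
      · refine dvd_trans ?_ (hK' t)
        rw [hKdef]
        push_cast
        exact dvd_mul_right _ _
      · rcases position_eq_of_mem_cells (hcell i) hxi hyi a ha with h1 | ⟨h1, h2⟩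
        · exact h1
        · left
          -- Two values in `[-M, M]` differ by at most `2M`, so a difference divisible by `2M + 1`
          -- vanishes.
          have h3 : (2 * s.2.2.1 + 1 : ℤ) ∣ a ⬝ᵥ y - a ⬝ᵥ x := by
            refine dvd_trans ?_ (dvd_dotProduct_sub hK' a)
            rw [hKdef]
            push_cast
            exact dvd_mul_left _ _
          rw [abs_le] at h1 h2
          have h4 := Int.eq_zero_of_abs_lt_dvd h3 (by rw [abs_lt]; constructor <;> linarith)
          omega

/-- Only the rows added by splitting can define facets, and each normal adds at most two; the rows
of the equations are tight on the whole cell. -/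
theorem Arr.facetCount_toPresentation_le {s : Arr n} {q : Piece n} (hq : q ∈ s.toPresentation) :
    facetCount q.ineqs.region ≤ 2 * s.2.1.length := by
  obtain ⟨c, hc, rfl⟩ := List.mem_map.1 hq
  obtain ⟨S, hS, hlen⟩ := exists_append_of_mem_cells hc
  dsimp only
  rw [hS]
  refine (facetCount_le fun r hr x hx => ?_).trans hlen
  rw [← hS] at hx
  exact tight_of_mem_eqSystem (region_subset_of_mem_cells hc hx) hr

theorem PT.eqSystem {α : Type} [Enc α] {f : α → List (Fin n → ℤ)} (hf : PT f) :
    PT fun a => eqSystem (f a) := by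
  refine PT.toSystem ?_
  exact PT.map (f := fun _ (e : Fin n → ℤ) => ((e, (0 : ℤ)), true)) (by fun_prop) hf

@[fun_prop]
theorem PT.scalarPeriod {α : Type} [Enc α] {f : α → ℕ} (hf : PT f) :
    PT fun a => scalarPeriod n (f a) := by
  refine PT.pi (β := Fin n → ℤ) fun i => PT.pi fun j => ?_
  by_cases h : i = j
  · subst h
    simpa [SemilinearProj.scalarPeriod] using hf.natCast
  · simpa [SemilinearProj.scalarPeriod, Matrix.diagonal_apply_ne _ h] using
      PT.const (α := α) (0 : ℤ)

/-- Empty cells are discarded after every split. The bound on the number of cells, with the whole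
space as affine subspace, therefore applies to every intermediate list, which would otherwise triple
at each normal. -/
theorem PT.cells : PT fun s : Arr n =>
    SemilinearProj.cells (SemilinearProj.eqSystem s.1) s.2.2.1 s.2.1 := by
  have hS : PT fun s : Arr n => [SemilinearProj.eqSystem s.1] :=
    (PT.eqSystem (by fun_prop)).cons (PT.const _)
  have hS' : PT fun s : Arr n => SemilinearProj.eqSystem s.1 := PT.eqSystem (by fun_prop)
  obtain ⟨qS, hqS⟩ := hS'.esize_le
  have hrows : PT fun p : ℕ × (Fin n → ℤ) => splitRows p.1 p.2 := by
    unfold splitRows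
    fun_prop
  obtain ⟨qr, hqr⟩ := hrows.esize_le
  refine PT.foldr (l := fun s : Arr n => s.2.1)
    (s := fun s : Arr n => [SemilinearProj.eqSystem s.1])
    (step := fun s a L => (L.flatMap (splitCell s.2.2.1 a)).filter IneqSystem.feasible)
    ?_ hS (by fun_prop) ((2 * .X + 1) ^ n * (qS + .X * qr.comp .X + 1) + 1) ?_
  · refine PT.filter (f := fun (_ : Arr n × (Fin n → ℤ) × List (IneqSystem n)) c =>
      IneqSystem.feasible c) (PT.feasible.comp (by fun_prop)) ?_
    refine PT.flatMap (f := fun (p : Arr n × (Fin n → ℤ) × List (IneqSystem n)) c =>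
      splitCell p.1.2.2.1 p.2.1 c) ?_ (by fun_prop)
    unfold splitCell
    fun_prop
  · intro s A' hA'
    change esize (SemilinearProj.cells (SemilinearProj.eqSystem s.1) s.2.2.1 A') ≤ _
    have hA : esize s.2.1 ≤ esize s := by
      change _ ≤ esize (s.1, s.2.1, s.2.2)
      rw [esize_prod, esize_prod]
      omega
    have hlen : A'.length ≤ esize s :=
      ((length_le_esize A').trans (esize_le_of_sublist hA'.sublist)).trans hA
    have hB : ∀ a ∈ A', esize (splitRows s.2.2.1 a) ≤ qr.eval (esize s) := by
      intro a ha
      refine (hqr (s.2.2.1, a)).trans (eval_mono qr ?_)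
      have h1 := esize_le_of_mem (hA'.subset ha)
      change _ ≤ esize (s.1, s.2.1, s.2.2.1, s.2.2.2)
      rw [esize_prod, esize_prod, esize_prod, esize_prod]
      omega
    have hcard := length_cells_le (S₀ := SemilinearProj.eqSystem s.1) (M := s.2.2.1) (A := A')
      (p := 0) (W := ⊤) fun x _ => (Submodule.mem_top : x - 0 ∈ (⊤ : Submodule ℝ (Fin n → ℝ)))
    rw [finrank_top, Module.finrank_fin_fun] at hcard
    refine (esize_list_le _ fun c hc => esize_le_of_mem_cells hB hc).trans ?_
    simp only [Polynomial.eval_add, Polynomial.eval_mul, Polynomial.eval_comp, Polynomial.eval_one,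
      Polynomial.eval_X, Polynomial.eval_pow, Polynomial.eval_ofNat]
    refine Nat.add_le_add_right (Nat.mul_le_mul (hcard.trans (Nat.pow_le_pow_left ?_ _)) ?_) 1
    · omega
    · exact Nat.add_le_add_right (add_le_add (hqS s) (Nat.mul_le_mul_right _ hlen)) 1

theorem PT.toPresentation : PT (Arr.toPresentation (n := n)) := by
  refine PT.map (f := fun (s : Arr n) (c : IneqSystem n) =>
    (⟨c, SemilinearProj.scalarPeriod n (s.2.2.2 * (2 * s.2.2.1 + 1))⟩ : Piece n)) ?_ PT.cells
  exact PT.pieceMk (by fun_prop) (by fun_prop)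

end CellPresentation

/-! ### Sizes -/

section Sizes

variable {m n : ℕ}

theorem esize_fin {α : Type} [Enc α] (v : Fin n → α) : esize v = ∑ i, esize (v i) + n + 1 := by
  induction n with
  | zero => simp [esize, enc, encList, Data.size, intLen]
  | succ n ih =>
    have h : esize v = esize (v 0) + esize (Fin.tail v) + 1 := by
      simp only [esize, enc_fin_succ, Data.size]
    rw [h, ih, Fin.sum_univ_succ]
    simp only [Fin.tail]
    ring

theorem esize_vec (v : Fin n → ℤ) : esize v = ∑ i, intLen (v i) + n + 1 := esize_fin v

theorem esize_matrix (A : Matrix (Fin m) (Fin n) ℤ) :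
    esize A = matLen A + m * (n + 1) + m + 1 := by
  have h : esize A = ∑ i, esize (A i) + m + 1 := esize_fin (α := Fin n → ℤ) A
  rw [h]
  simp only [esize_vec, matLen, add_assoc, Finset.sum_add_distrib, Finset.sum_const,
    Finset.card_univ, Fintype.card_fin, smul_eq_mul]
  ring

theorem esize_system_le (S : IneqSystem n) : esize S ≤ (n + 4) * S.len + 1 := by
  induction S with
  | nil => simp [esize_nil]
  | cons r S ih =>
    have h1 : esize r = (∑ i, intLen (r.1 i) + n + 1) + intLen r.2 + 1 := by
      rw [← esize_vec]; rfl
    have h2 : IneqSystem.len (r :: S) = (∑ i, intLen (r.1 i) + intLen r.2) + IneqSystem.len S := by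
      simp [IneqSystem.len]
    have h3 := intLen_pos r.2
    rw [esize_cons, h1, h2]
    generalize ∑ i, intLen (r.1 i) = u
    nlinarith [Nat.mul_le_mul_left n h3, Nat.zero_le (n * u)]

theorem length_le_psi_of_empty {D : Presentation m} (h : ∀ q ∈ D, q.ineqs.region = ∅) :
    D.length ≤ D.psi := by
  induction D with
  | nil => simp
  | cons q D ih =>
    have h1 := ih fun q' hq' => h q' (by simp [hq'])
    have h2 : 1 ≤ q.ineqs.len := by
      cases hq : q.ineqs with
      | nil =>
        have := h q (by simp)
        rw [hq] at this
        exact absurd (this ▸ (show (0 : Fin m → ℝ) ∈ IneqSystem.region [] by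
          simp [IneqSystem.region])) (Set.notMem_empty _)
      | cons r S =>
        have := intLen_pos r.2
        simp only [IneqSystem.len, List.map_cons, List.sum_cons]
        omega
    simp only [Presentation.psi, List.map_cons, List.sum_cons, List.length_cons] at h1 ⊢
    omega

/-- In dimension zero a piece without inequalities has binary length zero. Such a piece is the whole
space, so by disjointness all others are empty and must have at least one row each; this accounts
for the extra `1`. -/
theorem Presentation.Valid.length_le_psi {D : Presentation m} (hD : D.Valid) :
    D.length ≤ D.psi + 1 := by
  induction D with
  | nil => simp
  | cons q D ih =>
    have h1 := ih ⟨fun q' hq' => hD.1 q' (by simp [hq']), (List.pairwise_cons.1 hD.2).2⟩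
    cases hq : q.ineqs with
    | nil =>
      have h2 := length_le_psi_of_empty (D := D) fun q' hq' => by
        have := (List.pairwise_cons.1 hD.2).1 q' hq'
        rw [hq, show IneqSystem.region ([] : IneqSystem m) = Set.univ by
          ext; simp [IneqSystem.region], Set.univ_disjoint] at this
        exact this
      simp only [Presentation.psi, List.map_cons, List.sum_cons, List.length_cons] at h2 ⊢
      omega
    | cons r S =>
      have := intLen_pos r.2
      simp only [Presentation.psi, List.map_cons, List.sum_cons, List.length_cons, hq,
        IneqSystem.len] at h1 ⊢
      omega

theorem esize_presentation_le (D : Presentation m) :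
    esize D ≤ (m + 4) * D.psi + D.length * (m * (m + 1) + m + 4) + 1 := by
  induction D with
  | nil => simp [esize_nil]
  | cons q D ih =>
    have h1 : esize q = esize q.ineqs + esize q.period + 1 := rfl
    have h2 := esize_system_le q.ineqs
    have h3 := esize_matrix q.period
    have h4 : Presentation.psi (q :: D) = q.ineqs.len + matLen q.period + Presentation.psi D := by
      simp [Presentation.psi]
    rw [esize_cons, h1, h3, h4, List.length_cons]
    nlinarith [Nat.zero_le (m * matLen q.period)]

theorem length_normals_le (D : Presentation m) : D.normals.length ≤ D.eta + m * D.kappa := by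
  classical
  have h1 : D.normals.length = ∑ i : Fin D.length, (D.get i).ineqs.trimmed.length := by
    rw [Presentation.normals, List.length_flatMap, ← Fin.sum_univ_fun_getElem]
    simp
  have h2 : D.eta = ∑ i : Fin D.length, facetCount (D.get i).ineqs.region := by
    rw [Presentation.eta, ← Fin.sum_univ_fun_getElem]
    simp
  have h3 : m * D.kappa = ∑ i : Fin D.length, if (D.get i).ineqs.region.Nonempty ∧
      affineSpan ℝ (D.get i).ineqs.region ≠ ⊤ then m else 0 := by
    rw [← Finset.sum_filter, Finset.sum_const, smul_eq_mul, mul_comm, Presentation.kappa,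
      ← Set.ncard_coe_finset]
    congr 2
    ext i
    simp
  rw [h1, h2, h3, ← Finset.sum_add_distrib]
  exact Finset.sum_le_sum fun i _ => by convert IneqSystem.length_trimmed_le _

/-- The exponent that the construction gives is at most a constant times a factorial. -/
theorem exponent_le (m : ℕ) : (m + 1) * ((m + 1) * 2 ^ m + 2) ≤ 3 * 8 ^ 8 * m.factorial := by
  have h1 : m + 1 ≤ 2 ^ m := Nat.lt_two_pow_self
  -- Beyond `m = 8` the factorial gains a factor larger than `8` at each step, so `8 ^ 8` covers the
  -- initial range.
  have h2 : 8 ^ m ≤ 8 ^ 8 * m.factorial := by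
    rcases le_or_gt m 8 with h | h
    · exact (Nat.pow_le_pow_right (by norm_num) h).trans
        (Nat.le_mul_of_pos_right _ (Nat.factorial_pos _))
    · induction m, h.le using Nat.le_induction with
      | base => exact Nat.le_mul_of_pos_right _ (Nat.factorial_pos _)
      | succ k hk ih =>
        have h3 : 8 ^ k ≤ 8 ^ 8 * k.factorial := by
          rcases hk.eq_or_lt with rfl | hk'
          · exact Nat.le_mul_of_pos_right _ (Nat.factorial_pos _)
          · exact ih Nat.lt_two_pow_self hk'
        rw [pow_succ, Nat.factorial_succ]
        calc 8 ^ k * 8 ≤ 8 ^ 8 * k.factorial * (k + 1) := Nat.mul_le_mul h3 (by omega)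
          _ = _ := by ring
  have h3 : (8 : ℕ) ^ m = 2 ^ m * 2 ^ m * 2 ^ m := by
    rw [← mul_pow, ← mul_pow]; norm_num
  have h4 : (m + 1) * ((m + 1) * 2 ^ m + 2) ≤ 2 ^ m * (2 ^ m * 2 ^ m + 2) :=
    Nat.mul_le_mul h1 (Nat.add_le_add_right (Nat.mul_le_mul_right _ h1) 2)
  have h5 : 1 ≤ 2 ^ m := Nat.one_le_two_pow
  nlinarith

theorem length_imageArr_le_pow (D : Presentation m) (T : Matrix (Fin n) (Fin m) ℤ) :
    2 * (imageArr D T).2.1.length + 1 ≤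
      (max 2 (D.eta + D.kappa)) ^ ((m + 1) * 2 ^ m + 2) := by
  set N := max 2 (D.eta + D.kappa)
  have hN : 2 ≤ N := le_max_left _ _
  -- The factor `m + 1` is absorbed by `N ^ m`, since `N ≥ 2`; below, `N ^ 2 ≥ 4` absorbs the
  -- passage from `k` to `2k + 1`.
  have h1 : D.normals.length ≤ N ^ (m + 1) := by
    refine (length_normals_le D).trans ?_
    calc D.eta + m * D.kappa ≤ (m + 1) * (D.eta + D.kappa) := by
          nlinarith [Nat.zero_le (m * D.eta)]
      _ ≤ N ^ m * N := Nat.mul_le_mul ((Nat.lt_two_pow_self).trans_le (Nat.pow_le_pow_left hN m))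
          (le_max_right _ _)
      _ = _ := (pow_succ _ _).symm
  have h2 : (imageArr D T).2.1.length ≤ N ^ ((m + 1) * 2 ^ m) := by
    rw [pow_mul]
    exact (length_imageArr_le D T).trans (Nat.pow_le_pow_left h1 _)
  have h3 : 1 ≤ N ^ ((m + 1) * 2 ^ m) := Nat.one_le_pow _ _ (by omega)
  have h4 : 4 ≤ N ^ 2 := by nlinarith
  rw [pow_add]
  nlinarith

end Sizes

end SemilinearProj

theorem theorem3p4 :
    ∃ C : ℕ, ∀ m n : ℕ,
      ∃ (prog : SemilinearProj.Prog) (time : Polynomial ℕ),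
        ∀ (D : SemilinearProj.Presentation m) (T : Matrix (Fin n) (Fin m) ℤ), D.Valid →
          ∃ (E : SemilinearProj.Presentation n) (t : ℕ),
            SemilinearProj.Runs prog
              (.pair (SemilinearProj.encPresentation D) (SemilinearProj.encMat T))
              (SemilinearProj.encPresentation E) t ∧
            t ≤ time.eval (D.psi + SemilinearProj.matLen T) ∧
            E.Valid ∧
            E.length ≤ (max 2 (D.eta + D.kappa)) ^ (C * m.factorial) ∧
            (∀ R ∈ E, SemilinearProj.facetCount R.ineqs.region ≤
              (max 2 (D.eta + D.kappa)) ^ (C * m.factorial)) ∧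
            ∀ X : Set (Fin m → ℤ), D.Presents X → E.Presents (T.mulVec '' X) := by
  open SemilinearProj in
  refine ⟨3 * 8 ^ 8, fun m n => ?_⟩
  obtain ⟨prog, q, hq⟩ : PT fun p : Presentation m × Matrix (Fin n) (Fin m) ℤ =>
    (imageArr p.1 p.2).toPresentation := PT.toPresentation.comp PT.imageArr
  -- The machine reads trees, whose size exceeds the binary length by list nodes. This overhead is
  -- linear in the number of pieces, hence in `D.psi + 1`.
  refine ⟨prog, q.comp (Polynomial.C ((m + 4) + (m * (m + 1) + m + 4) + 1) * Polynomial.X +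
    Polynomial.C ((m * (m + 1) + m + 4) + n * (m + 1) + n + 3)), fun D T hD => ?_⟩
  obtain ⟨t, hrun, ht⟩ := hq (D, T)
  have hK := imageArr_period_pos hD T
  have hN : 0 < max 2 (D.eta + D.kappa) := by omega
  have hlen := length_imageArr_le_pow D T
  have hexp := exponent_le m
  refine ⟨(imageArr D T).toPresentation, t, hrun, ht.trans ?_, Arr.valid_toPresentation hK, ?_, ?_,
    fun X hX => (hX.tame_image hD T).presents hK⟩
  · rw [Polynomial.eval_comp]
    refine eval_mono q ?_
    change esize (D, T) ≤ _
    have h1 := esize_presentation_le D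
    have h2 := esize_matrix T
    have h3 := hD.length_le_psi
    have h4 := Nat.mul_le_mul_right (m * (m + 1) + m + 4) h3
    simp only [Polynomial.eval_add, Polynomial.eval_mul, Polynomial.eval_C, Polynomial.eval_X]
    rw [esize_prod, h2]
    generalize m * (m + 1) + m + 4 = c at *
    nlinarith [Nat.zero_le (c * matLen T), Nat.zero_le (m * matLen T)]
  -- Counting cells inside the range of `T`, of dimension at most `m`, makes the exponent
  -- independent of `n`.
  · have h1 : (eqSystem (imageArr D T).1).region ⊆
        coset 0 (LinearMap.range (T.map (Int.cast : ℤ → ℝ)).mulVecLin) := by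
      intro y hy
      obtain ⟨x, hx⟩ := exists_mulVec_of_imageArr (mem_region_eqSystem.1 hy)
      exact ⟨x, by simpa using hx.symm⟩
    have h2 : (imageArr D T).toPresentation.length ≤ _ :=
      (List.length_map _).trans_le (length_cells_le h1)
    have h3 : Module.finrank ℝ (LinearMap.range (T.map (Int.cast : ℤ → ℝ)).mulVecLin) ≤ m :=
      (LinearMap.finrank_range_le _).trans (by simp)
    calc _ ≤ _ := h2
      _ ≤ (2 * (imageArr D T).2.1.length + 1) ^ m := Nat.pow_le_pow_right (by omega) h3
      _ ≤ _ := Nat.pow_le_pow_left hlen m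
      _ = _ := (pow_mul _ _ _).symm
      _ ≤ _ := Nat.pow_le_pow_right hN (by nlinarith)
  · intro R hR
    calc _ ≤ _ := Arr.facetCount_toPresentation_le hR
      _ ≤ 2 * (imageArr D T).2.1.length + 1 := Nat.le_succ _
      _ ≤ _ := hlen
      _ ≤ _ := Nat.pow_le_pow_right hN (by nlinarith)
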